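/- **Conventions.** Let $\Bbbk$ be a field. Quivers are finite, paths are composed from left to right, and for an admissible ideal $I$ of the path algebra $\Bbbk Q$ (i.e. $J_Q^m\subseteq I\subseteq J_Q^2$ for some $m\ge 2$, where $J_Q$ is the ideal generated by the arrows) modules over $\Bbbk Q/I$ are right modules and $\operatorname{mod}$ denotes the finitely generated ones. For a finite dimensional algebra $\Lambda$, $\Omega_\Lambda(M)$ is the kernel of a projective cover of $M$, $\Omega_\Lambda^0(M)=M$, and $\operatorname{add}\mathcal C$ consists of the direct summands of finite direct sums of modules in $\mathcal C$. $K_0(\Lambda)$ is the abelian group generated by the symbols $[M]$, $M\in\operatorname{mod}\Lambda$, with the relations $[M]=[M']+[M'']$ if $M\cong M'\oplus M''$ and $[P]=0$ if $P$ is projective; $\langle\mathcal C\rangle\subseteq K_0(\Lambda)$ is the subgroup generated by the classes of direct summands of modules in $\mathcal C$. A module $V\in\operatorname{mod}\Lambda$ is an *$n$-Igusa–Todorov module* if every $M\in\operatorname{mod}\Lambda$ admits an exact sequence $0\to V_1\to V_0\to\Omega_\Lambda^n(M)\to 0$ with $V_0,V_1\in\operatorname{add}V$; $\Lambda$ is an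 *$n$-Igusa–Todorov algebra* if such a $V$ exists. **Statement.** Let $A=\Bbbk Q_A/I_A$, $B=\Bbbk Q_B/I_B$ and $C=\Bbbk\Gamma/I_C$ with $I_A,I_B,I_C$ admissible, and suppose: * (H1) the vertex set of $\Gamma$ is the disjoint union of the vertex sets of $Q_A$ and $Q_B$; * (H2) the arrows of $\Gamma$ are those of $Q_A$, those of $Q_B$, finitely many arrows $\alpha_j$ $(j\in J)$ from vertices of $Q_A$ to vertices of $Q_B$, and finitely many arrows $\beta_k$ $(k\in K)$ from vertices of $Q_B$ to vertices of $Q_A$; * (H3) $I_C$ contains $I_A$, $I_B$ and all products $\alpha\alpha_j$, $\beta\beta_k$, $\alpha_j\beta_k$, $\beta_k\alpha_j$, where $\alpha$ is an arrow of $Q_A$, $\beta$ is an arrow of $Q_B$, $j\in J$ and $k\in K$; * ($C$ is a Morita context algebra with $A$ and $B$ on the diagonal) $I_C\cap\Bbbk Q_A=I_A$ and $I_C\cap\Bbbk Q_B=I_B$. Let $\Pi_A:\operatorname{mod}C\to\operatorname{mod}A$ and $\Pi_B:\operatorname{mod}C\to\operatorname{mod}B$ be the restrictions of representations to $Q_A$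 and $Q_B$, and regard $A$-modules and $B$-modules as $C$-modules through extension by zero. Let $C_0$ be the direct sum of the simple $C$-modules, one from each isomorphism class, and put $$\mathcal O=\big\langle\{X\oplus Y : X\in\operatorname{add}\{\Omega_A^i(\Pi_A(\Omega_C(C_0)))\}_{i\ge 0},\ Y\in\operatorname{add}\{\Omega_B^i(\Pi_B(\Omega_C(C_0)))\}_{i\ge 0}\}\big\rangle\subseteq K_0(C).$$ Assume that $\mathcal O$ is finitely generated. Let $n\ge 0$ and let $A$ and $B$ be $n$-Igusa–Todorov algebras. Then $C$ is an $(n+1)$-Igusa–Todorov algebra. Moreover, up to isomorphism there are only finitely many indecomposable modules $O_1,\dots,O_m\in\operatorname{mod}C$ with class in $\mathcal O$, and for every $n$-Igusa–Todorov $A$-module $V_A$ and every $n$-Igusa–Todorov $B$-module $W_B$ the $C$-module $$V_A\oplus A\oplus W_B\oplus B\oplus O_1\oplus\dots\oplus O_m$$ is an $(n+1)$-Igusa–Todorov module. -/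

import Mathlib

universe u

set_option linter.unusedSectionVars false

noncomputable section

/-! ## Path algebras -/

/-- The set of all paths of a quiver (including the trivial path at each vertex). -/
abbrev AllPaths (Q : Type u) [Quiver.{u} Q] : Type u :=
  Σ a : Q, Σ b : Q, Quiver.Path a b

/-- The path algebra `kQ`: the `k`-vector space with basis the set of all paths of `Q`. -/
def PathAlgebra (k : Type u) [Field k] (Q : Type u) [Quiver.{u} Q] : Type u :=
  AllPaths Q →₀ k

namespace PathAlgebra

variable {k : Type u} [Field k] {Q : Type u} [Quiver.{u} Q]

instance : AddCommGroup (PathAlgebra k Q) := inferInstanceAs (AddCommGroup (AllPaths Q →₀ k))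

instance : Module k (PathAlgebra k Q) := inferInstanceAs (Module k (AllPaths Q →₀ k))

variable (k) in
/-- The basis element of `kQ` given by a path. -/
def ofPath {a b : Q} (p : Quiver.Path a b) : PathAlgebra k Q :=
  Finsupp.single ⟨a, b, p⟩ (1 : k)

open Classical in
variable (k) in
/-- The product of two paths: their concatenation (first `p`, then `q`) if `p` ends
where `q` starts, and zero otherwise. -/
def pathMul (p q : AllPaths Q) : PathAlgebra k Q :=
  if h : q.1 = p.2.1 then ofPath k (p.2.2.comp (q.2.2.cast h rfl)) else 0

/-- Extend a function on paths to a `k`-linear map on the path algebra. -/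
def linExt {M : Type*} [AddCommGroup M] [Module k M] (f : AllPaths Q → M) :
    PathAlgebra k Q →ₗ[k] M :=
  Finsupp.lift M k (AllPaths Q) f

/-- The multiplication of the path algebra, as a bilinear map. -/
def mulBilin : PathAlgebra k Q →ₗ[k] PathAlgebra k Q →ₗ[k] PathAlgebra k Q :=
  linExt fun p => linExt fun q => pathMul k p q

instance : Mul (PathAlgebra k Q) := ⟨fun x y => mulBilin x y⟩

instance [Fintype Q] : One (PathAlgebra k Q) := ⟨∑ a : Q, ofPath k (Quiver.Path.nil : Quiver.Path a a)⟩

theorem mul_def' (x y : PathAlgebra k Q) : x * y = mulBilin x y := rfl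

theorem one_def' [Fintype Q] :
    (1 : PathAlgebra k Q) = ∑ a : Q, ofPath k (Quiver.Path.nil : Quiver.Path a a) := rfl

theorem linExt_ofPath {M : Type*} [AddCommGroup M] [Module k M] (f : AllPaths Q → M)
    {a b : Q} (p : Quiver.Path a b) : linExt (k := k) f (ofPath k p) = f ⟨a, b, p⟩ := by
  exact (Finsupp.sum_single_index (h := fun x (c : k) => c • f x) (zero_smul k _)).trans
    (one_smul k _)

/-- Two linear maps which agree on all paths are equal. -/
theorem hom_ext {M : Type*} [AddCommGroup M] [Module k M] {f g : PathAlgebra k Q →ₗ[k] M}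
    (h : ∀ {a b : Q} (p : Quiver.Path a b), f (ofPath k p) = g (ofPath k p)) : f = g := by
  refine Finsupp.lhom_ext' fun x => LinearMap.ext_ring ?_
  exact h x.2.2

theorem ofPath_mul_ofPath {a b c d : Q} (p : Quiver.Path a b) (q : Quiver.Path c d) :
    ofPath k p * ofPath k q = pathMul k ⟨a, b, p⟩ ⟨c, d, q⟩ := by
  rw [mul_def', mulBilin, linExt_ofPath, linExt_ofPath]

theorem ofPath_mul_comp {a b c : Q} (p : Quiver.Path a b) (q : Quiver.Path b c) :
    ofPath k p * ofPath k q = ofPath k (p.comp q) := by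
  rw [ofPath_mul_ofPath, pathMul, dif_pos rfl]; rfl

theorem ofPath_mul_of_ne {a b c d : Q} (p : Quiver.Path a b) (q : Quiver.Path c d) (h : c ≠ b) :
    ofPath k p * ofPath k q = 0 := by
  rw [ofPath_mul_ofPath, pathMul, dif_neg h]

theorem ofPath_assoc {a b c d e f : Q} (p : Quiver.Path a b) (q : Quiver.Path c d)
    (r : Quiver.Path e f) :
    ofPath k p * ofPath k q * ofPath k r = ofPath k p * (ofPath k q * ofPath k r) := by
  by_cases h : c = b
  · subst h
    rw [ofPath_mul_comp]
    by_cases h' : e = d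
    · subst h'
      rw [ofPath_mul_comp, ofPath_mul_comp, ofPath_mul_comp, Quiver.Path.comp_assoc]
    · rw [ofPath_mul_of_ne _ _ h', ofPath_mul_of_ne _ _ h']
      simp [mul_def']
  · rw [ofPath_mul_of_ne _ _ h]
    by_cases h' : e = d
    · subst h'
      rw [ofPath_mul_comp, ofPath_mul_of_ne _ _ h]
      simp [mul_def']
    · rw [ofPath_mul_of_ne _ _ h']
      simp [mul_def']

instance : NonUnitalRing (PathAlgebra k Q) where
  left_distrib x y z := by simp [mul_def']
  right_distrib x y z := by simp [mul_def']
  zero_mul x := by simp [mul_def']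
  mul_zero x := by simp [mul_def']
  mul_assoc x y z := by
    let T : PathAlgebra k Q →ₗ[k] PathAlgebra k Q →ₗ[k] PathAlgebra k Q →ₗ[k] PathAlgebra k Q :=
      mulBilin.compr₂ mulBilin
    let T' : PathAlgebra k Q →ₗ[k] PathAlgebra k Q →ₗ[k] PathAlgebra k Q →ₗ[k] PathAlgebra k Q :=
      ((LinearMap.llcomp k _ _ _).comp mulBilin).flip.comp mulBilin |>.flip
    have : T = T' := by
      refine hom_ext fun p => hom_ext fun q => hom_ext fun r => ?_
      exact ofPath_assoc p q r
    exact congrArg (fun F => F x y z) this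

instance [Fintype Q] : Ring (PathAlgebra k Q) where
  one_mul x := by
    have : mulBilin (1 : PathAlgebra k Q) = LinearMap.id := by
      refine hom_ext fun {a b} p => ?_
      rw [← mul_def', one_def', Finset.sum_mul, Finset.sum_eq_single a]
      · rw [ofPath_mul_comp, Quiver.Path.nil_comp]; rfl
      · intro c _ hc
        exact ofPath_mul_of_ne _ _ (Ne.symm hc)
      · simp
    exact congrArg (fun F => F x) this
  mul_one x := by
    have : mulBilin.flip (1 : PathAlgebra k Q) = LinearMap.id := by
      refine hom_ext fun {a b} p => ?_
      rw [LinearMap.flip_apply, ← mul_def', one_def', Finset.mul_sum, Finset.sum_eq_single b]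
      · rw [ofPath_mul_comp, Quiver.Path.comp_nil]; rfl
      · intro c _ hc
        exact ofPath_mul_of_ne _ _ hc
      · simp
    exact congrArg (fun F => F x) this
  neg_add_cancel := neg_add_cancel
  sub_eq_add_neg := sub_eq_add_neg
  zsmul := (· • ·)
  zsmul_zero' := SubNegMonoid.zsmul_zero'
  zsmul_succ' := SubNegMonoid.zsmul_succ'
  zsmul_neg' := SubNegMonoid.zsmul_neg'

instance [Fintype Q] : Algebra k (PathAlgebra k Q) :=
  Algebra.ofModule (fun c x y => by simp [mul_def']) (fun c x y => by simp [mul_def'])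

variable (k Q) in
/-- Images of the vertices and the arrows of `Q` in a `k`-algebra `R`: the vertices go to
orthogonal idempotents, and an arrow `e : a ⟶ b` goes to an element of `vert a * R * vert b`. -/
structure LiftData (R : Type u) [Ring R] [Algebra k R] where
  /-- the images of the trivial paths -/
  vert : Q → R
  /-- the images of the arrows -/
  arr : ∀ {a b : Q}, (a ⟶ b) → R
  idem : ∀ a, vert a * vert a = vert a
  orth : ∀ a b, a ≠ b → vert a * vert b = 0
  vert_arr : ∀ {a b : Q} (e : a ⟶ b), vert a * arr e = arr e
  arr_vert : ∀ {a b : Q} (e : a ⟶ b), arr e * vert b = arr e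

namespace LiftData

variable {R : Type u} [Ring R] [Algebra k R] (L : LiftData k Q R)

/-- The image of a path: the product of the images of its arrows. -/
def path {a : Q} : ∀ {b : Q}, Quiver.Path a b → R
  | _, .nil => L.vert a
  | _, .cons p e => path p * L.arr e

theorem path_vert {a b : Q} (p : Quiver.Path a b) : L.path p * L.vert b = L.path p := by
  cases p with
  | nil => exact L.idem a
  | cons p e => rw [path, mul_assoc, L.arr_vert]

theorem vert_path {a b : Q} (p : Quiver.Path a b) : L.vert a * L.path p = L.path p := by
  induction p with
  | nil => exact L.idem a
  | cons p e ih => rw [path, ← mul_assoc, ih]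

theorem path_comp {a b c : Q} (p : Quiver.Path a b) (q : Quiver.Path b c) :
    L.path (p.comp q) = L.path p * L.path q := by
  induction q with
  | nil => exact (L.path_vert p).symm
  | cons q e ih => rw [Quiver.Path.comp_cons, path, ih, path, mul_assoc]

/-- The `k`-linear multiplicative (not necessarily unital) map `kQ → R` induced by `L`. -/
def hom : PathAlgebra k Q →ₙ+* R where
  toFun := linExt (k := k) fun p => L.path p.2.2
  map_zero' := map_zero _
  map_add' := map_add _
  map_mul' x y := by
    let f : PathAlgebra k Q →ₗ[k] R := linExt (k := k) fun p => L.path p.2.2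
    have : mulBilin.compr₂ f = (LinearMap.mul k R).compl₁₂ f f := by
      refine hom_ext fun {a b} p => hom_ext fun {c d} q => ?_
      change f (ofPath k p * ofPath k q) = f (ofPath k p) * f (ofPath k q)
      rw [show f (ofPath k p) = L.path p from linExt_ofPath _ p,
        show f (ofPath k q) = L.path q from linExt_ofPath _ q]
      by_cases h : c = b
      · subst h
        rw [ofPath_mul_comp, show f (ofPath k (p.comp q)) = L.path (p.comp q) from linExt_ofPath _ _,
          path_comp]
      · rw [ofPath_mul_of_ne _ _ h, map_zero, ← L.path_vert p, ← L.vert_path q, mul_assoc,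
          ← mul_assoc (L.vert b), L.orth b c (Ne.symm h), zero_mul, mul_zero]
    exact congrArg (fun F => F x y) this

theorem hom_ofPath {a b : Q} (p : Quiver.Path a b) : L.hom (ofPath k p) = L.path p :=
  linExt_ofPath _ p

theorem hom_smul (c : k) (x : PathAlgebra k Q) : L.hom (c • x) = c • L.hom x :=
  map_smul (linExt (k := k) fun p => L.path p.2.2) c x

theorem hom_one [Fintype Q] : L.hom 1 = ∑ a, L.vert a := by
  rw [one_def', map_sum]
  exact Finset.sum_congr rfl fun a _ => L.hom_ofPath _

/-- The unital ring homomorphism `kQ → R` induced by `L` if the idempotents sum to `1`. -/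
def ringHom [Fintype Q] (h : ∑ a, L.vert a = 1) : PathAlgebra k Q →+* R where
  __ := L.hom
  map_one' := L.hom_one.trans h

theorem ringHom_apply [Fintype Q] (h : ∑ a, L.vert a = 1) (x : PathAlgebra k Q) :
    L.ringHom h x = L.hom x := rfl

end LiftData

/-- An ideal `I` of `kQ` is admissible if `J ^ m ⊆ I ⊆ J ^ 2` for some `m ≥ 2`, where `J` is the
ideal generated by the arrows; here `J ^ m` is the span of all paths of length at least `m`. -/
def IsAdmissible [Fintype Q] (I : Ideal (PathAlgebra k Q)) : Prop :=
  (∀ x ∈ I, x ∈ Submodule.span k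
      {y | ∃ (a b : Q) (p : Quiver.Path a b), 2 ≤ p.length ∧ y = ofPath k p}) ∧
    ∃ m : ℕ, 2 ≤ m ∧ ∀ (a b : Q) (p : Quiver.Path a b), m ≤ p.length → ofPath k p ∈ I

end PathAlgebra

/-! ## Modules over a ring: syzygies, `add`, Igusa-Todorov modules, the group `K₀`

Everything in this part is written for left modules over a ring `R`; it is applied to
`R = Λᵐᵒᵖ`, that is, to right modules over an algebra `Λ`. -/

section Modules

variable (R : Type u) [Ring R]

/-- `N` is isomorphic to a direct summand of `M`. -/
def IsDirectSummand (N M : Type u) [AddCommGroup N] [Module R N] [AddCommGroup M] [Module R M] :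
    Prop :=
  ∃ L : ModuleCat.{u} R, Nonempty ((N × L) ≃ₗ[R] M)

/-- `N` belongs to `add 𝒞`: it is a direct summand of a finite direct sum of members of `𝒞`. -/
def MemAdd (𝒞 : ModuleCat.{u} R → Prop) (N : Type u) [AddCommGroup N] [Module R N] : Prop :=
  ∃ (m : ℕ) (F : Fin m → ModuleCat.{u} R), (∀ i, 𝒞 (F i)) ∧ IsDirectSummand R N (∀ i, F i)

/-- `N` is isomorphic to the syzygy `Ω(M)`, the kernel of a projective cover `π : P → M`
(a surjection from a projective module whose kernel is superfluous). -/
def IsSyzygy (M N : Type u) [AddCommGroup M] [Module R M] [AddCommGroup N] [Module R N] : Prop :=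
  ∃ (P : ModuleCat.{u} R) (π : P →ₗ[R] M), Module.Projective R P ∧ Function.Surjective π ∧
    (∀ U : Submodule R P, U ⊔ LinearMap.ker π = ⊤ → U = ⊤) ∧
    Nonempty (N ≃ₗ[R] LinearMap.ker π)

/-- `N` is isomorphic to the `n`-th syzygy `Ωⁿ(M)`, where `Ω⁰(M) = M`. -/
def IsNthSyzygy : ℕ → ModuleCat.{u} R → ModuleCat.{u} R → Prop
  | 0, M, N => Nonempty (N ≃ₗ[R] M)
  | n + 1, M, N => ∃ L : ModuleCat.{u} R, IsSyzygy R M L ∧ IsNthSyzygy n L N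

/-- `V` is an `n`-Igusa-Todorov module: `V` is finitely generated, and every finitely generated `M`
has an exact sequence `0 → V₁ → V₀ → Ωⁿ(M) → 0` with `V₀, V₁ ∈ add V`. -/
def IsIgusaTodorovModule (n : ℕ) (V : ModuleCat.{u} R) : Prop :=
  Module.Finite R V ∧
    ∀ M : ModuleCat.{u} R, Module.Finite R M →
      ∃ N : ModuleCat.{u} R, IsNthSyzygy R n M N ∧
        ∃ (V₁ V₀ : ModuleCat.{u} R) (f : V₁ →ₗ[R] V₀) (g : V₀ →ₗ[R] N),
          MemAdd R (fun X => X = V) V₁ ∧ MemAdd R (fun X => X = V) V₀ ∧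
          Function.Injective f ∧ Function.Exact f g ∧ Function.Surjective g

/-- `M` is indecomposable: it is nonzero, and it is not the direct sum of two nonzero submodules. -/
def IsIndecomposableModule (M : Type u) [AddCommGroup M] [Module R M] : Prop :=
  Nontrivial M ∧ ∀ U W : Submodule R M, IsCompl U W → U = ⊥ ∨ W = ⊥

/-- `S` is the direct sum of all simple modules, one from each isomorphism class. -/
def IsSumOfSimples (S : Type u) [AddCommGroup S] [Module R S] : Prop :=
  ∃ (m : ℕ) (T : Fin m → ModuleCat.{u} R), (∀ i, IsSimpleModule R (T i)) ∧
    (∀ i j, Nonempty (T i ≃ₗ[R] T j) → i = j) ∧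
    (∀ T' : ModuleCat.{u} R, IsSimpleModule R T' → ∃ i, Nonempty (T' ≃ₗ[R] T i)) ∧
    Nonempty (S ≃ₗ[R] ∀ i, T i)

/-- The relations of `K₀`: `[M] - [M'] - [M'']` if `M ≅ M' ⊕ M''`, and `[P]` if `P` is
projective. -/
def syzygyK0Relations : Set (FreeAbelianGroup (FGModuleCat.{u} R)) :=
  {x | ∃ M M' M'' : FGModuleCat.{u} R, Nonempty (M ≃ₗ[R] M' × M'') ∧
      x = FreeAbelianGroup.of M - FreeAbelianGroup.of M' - FreeAbelianGroup.of M''} ∪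
  {x | ∃ P : FGModuleCat.{u} R, Module.Projective R P ∧ x = FreeAbelianGroup.of P}

/-- The group `K₀` of Igusa and Todorov: the abelian group generated by the symbols `[M]`, for `M`
finitely generated, modulo the above relations. -/
abbrev SyzygyK0 : Type (u + 1) :=
  FreeAbelianGroup (FGModuleCat.{u} R) ⧸ AddSubgroup.closure (syzygyK0Relations R)

/-- The class `[M]` in `K₀`. -/
def SyzygyK0.mk (M : FGModuleCat.{u} R) : SyzygyK0 R :=
  QuotientAddGroup.mk (FreeAbelianGroup.of M)

end Modules

/-- `Λ` is an `n`-Igusa-Todorov algebra: there is an `n`-Igusa-Todorov right `Λ`-module. -/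
def IsIgusaTodorovAlgebra (n : ℕ) (Λ : Type u) [Ring Λ] : Prop :=
  ∃ V : ModuleCat.{u} Λᵐᵒᵖ, IsIgusaTodorovModule Λᵐᵒᵖ n V

/-! ## Restriction and inflation of right modules -/

section Restriction

open MulOpposite

variable {A C : Type u} [Ring A] [Ring C]

/-- The additive group `M e` for a right `C`-module `M`, where `e` is the image of `1` under
a multiplicative map `j : A → C`. -/
def restrictedPart (j : A →ₙ+* C) (M : Type u) [AddCommGroup M] [Module Cᵐᵒᵖ M] :
    AddSubgroup M where
  carrier := {m | op (j 1) • m = m}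
  zero_mem' := smul_zero _
  add_mem' {x y} hx hy := by
    simp only [Set.mem_ofPred_eq] at *
    rw [smul_add, hx, hy]
  neg_mem' {x} hx := by
    simp only [Set.mem_ofPred_eq] at *
    rw [smul_neg, hx]

/-- `M e` is a right `A`-module: `a : A` acts through `j a`. -/
instance restrictedPart.module (j : A →ₙ+* C) (M : Type u) [AddCommGroup M] [Module Cᵐᵒᵖ M] :
    Module Aᵐᵒᵖ (restrictedPart j M) where
  smul a m := ⟨op (j (unop a)) • (m : M), by
    change op (j 1) • op (j (unop a)) • (m : M) = _
    rw [smul_smul, ← op_mul, ← map_mul, mul_one]⟩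
  one_smul m := Subtype.ext m.2
  mul_smul a b m := Subtype.ext (by
    change op (j (unop (a * b))) • (m : M) = op (j (unop a)) • op (j (unop b)) • (m : M)
    rw [smul_smul, ← op_mul, ← map_mul, unop_mul])
  smul_zero a := Subtype.ext (smul_zero _)
  smul_add a x y := Subtype.ext (smul_add _ _ _)
  add_smul a b m := Subtype.ext (by
    change op (j (unop (a + b))) • (m : M) = op (j (unop a)) • (m : M) + op (j (unop b)) • (m : M)
    rw [unop_add, map_add, op_add, add_smul])
  zero_smul m := Subtype.ext (by
    change op (j (unop 0)) • (m : M) = 0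
    rw [unop_zero, map_zero, op_zero, zero_smul])

/-- The restriction of the right `C`-module `M` to a right `A`-module along `j : A → C`. -/
abbrev restrictModule (j : A →ₙ+* C) (M : ModuleCat.{u} Cᵐᵒᵖ) : ModuleCat.{u} Aᵐᵒᵖ :=
  ModuleCat.of Aᵐᵒᵖ (restrictedPart j M)

/-- A right `A`-module regarded as a right `C`-module through a ring homomorphism `C → A`. -/
abbrev inflateModule (r : C →+* A) (X : ModuleCat.{u} Aᵐᵒᵖ) : ModuleCat.{u} Cᵐᵒᵖ :=
  (ModuleCat.restrictScalars (RingHom.op r)).obj X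

end Restriction

/-! ## The quiver of the Morita context algebra -/

/-- The vertices of `Γ`: the disjoint union of the vertices of `QA` and of `QB`. -/
inductive MoritaQuiver {QA QB : Type u} (J : QA → QB → Type u) (K : QB → QA → Type u) : Type u
  | inA : QA → MoritaQuiver J K
  | inB : QB → MoritaQuiver J K

namespace MoritaQuiver

variable {QA QB : Type u} {J : QA → QB → Type u} {K : QB → QA → Type u}

instance [Fintype QA] [Fintype QB] : Fintype (MoritaQuiver J K) :=
  Fintype.ofEquiv (QA ⊕ QB)
    { toFun := Sum.elim inA inB
      invFun := fun x => match x with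
        | inA a => Sum.inl a
        | inB b => Sum.inr b
      left_inv := by rintro (a | b) <;> rfl
      right_inv := by rintro (a | b) <;> rfl }

theorem sum_univ [Fintype QA] [Fintype QB] {M : Type*} [AddCommMonoid M]
    (f : MoritaQuiver J K → M) : ∑ x, f x = ∑ a, f (inA a) + ∑ b, f (inB b) := by
  refine Eq.trans ?_ (Fintype.sum_sum_type (fun x => f (Sum.elim inA inB x)))
  refine (Fintype.sum_bijective (Sum.elim inA inB) ⟨?_, ?_⟩ _ _ fun _ => rfl).symm
  · rintro (a | b) (a' | b') h <;> simp_all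
  · rintro (a | b)
    exacts [⟨Sum.inl a, rfl⟩, ⟨Sum.inr b, rfl⟩]

/-- The arrows of `Γ`: those of `QA`, those of `QB`, the arrows in `J` from vertices of `QA` to
vertices of `QB`, and the arrows in `K` from vertices of `QB` to vertices of `QA`. -/
inductive Arrow [Quiver.{u} QA] [Quiver.{u} QB] : MoritaQuiver J K → MoritaQuiver J K → Type u
  | arrA {a a' : QA} (α : a ⟶ a') : Arrow (inA a) (inA a')
  | arrB {b b' : QB} (β : b ⟶ b') : Arrow (inB b) (inB b')
  | arrJ {a : QA} {b : QB} (j : J a b) : Arrow (inA a) (inB b)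
  | arrK {b : QB} {a : QA} (κ : K b a) : Arrow (inB b) (inA a)

variable [Quiver.{u} QA] [Quiver.{u} QB]

instance : Quiver.{u} (MoritaQuiver J K) := ⟨Arrow⟩

variable (J K) in
/-- An arrow of `QA` as an arrow of `Γ`. -/
def homA {a a' : QA} (α : a ⟶ a') : (inA a : MoritaQuiver J K) ⟶ inA a' := Arrow.arrA α

variable (J K) in
/-- An arrow of `QB` as an arrow of `Γ`. -/
def homB {b b' : QB} (β : b ⟶ b') : (inB b : MoritaQuiver J K) ⟶ inB b' := Arrow.arrB β

variable (K) in
/-- An element of `J` as an arrow of `Γ`. -/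
def homJ {a : QA} {b : QB} (j : J a b) : (inA a : MoritaQuiver J K) ⟶ inB b := Arrow.arrJ j

variable (J) in
/-- An element of `K` as an arrow of `Γ`. -/
def homK {b : QB} {a : QA} (κ : K b a) : (inB b : MoritaQuiver J K) ⟶ inA a := Arrow.arrK κ

open PathAlgebra

variable (k : Type u) [Field k]

/-- The product in `kΓ` of two consecutive arrows: the path that runs first through `e` and then
through `f`. -/
def twoArrows {x y z : MoritaQuiver J K} (e : x ⟶ y) (f : y ⟶ z) :
    PathAlgebra k (MoritaQuiver J K) :=
  ofPath k (e.toPath.comp f.toPath)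

theorem ofPath_cons {x y z : MoritaQuiver J K} (p : Quiver.Path x y) (e : y ⟶ z) :
    ofPath k (p.cons e) = ofPath k p * ofPath k e.toPath := by
  rw [ofPath_mul_comp]; rfl

variable [Fintype QA] [Fintype QB]

variable (J K) in
/-- The inclusion of `kQA` in `kΓ`. -/
def inclA : PathAlgebra k QA →ₙ+* PathAlgebra k (MoritaQuiver J K) :=
  LiftData.hom
    { vert := fun a => ofPath k (Quiver.Path.nil : Quiver.Path (inA a : MoritaQuiver J K) (inA a))
      arr := fun e => ofPath k (homA J K e).toPath
      idem := fun a => ofPath_mul_comp _ _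
      orth := fun a b h => ofPath_mul_of_ne _ _ (by simpa using Ne.symm h)
      vert_arr := fun e => by rw [ofPath_mul_comp, Quiver.Path.nil_comp]
      arr_vert := fun e => by rw [ofPath_mul_comp, Quiver.Path.comp_nil] }

variable (J K) in
/-- The inclusion of `kQB` in `kΓ`. -/
def inclB : PathAlgebra k QB →ₙ+* PathAlgebra k (MoritaQuiver J K) :=
  LiftData.hom
    { vert := fun b => ofPath k (Quiver.Path.nil : Quiver.Path (inB b : MoritaQuiver J K) (inB b))
      arr := fun e => ofPath k (homB J K e).toPath
      idem := fun a => ofPath_mul_comp _ _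
      orth := fun a b h => ofPath_mul_of_ne _ _ (by simpa using Ne.symm h)
      vert_arr := fun e => by rw [ofPath_mul_comp, Quiver.Path.nil_comp]
      arr_vert := fun e => by rw [ofPath_mul_comp, Quiver.Path.comp_nil] }

variable (J K) in
/-- The projection `kΓ → kQA` which kills the vertices of `QB` and all arrows outside `QA`. -/
def projA : PathAlgebra k (MoritaQuiver J K) →+* PathAlgebra k QA :=
  LiftData.ringHom
    { vert := fun x => match x with
        | inA a => ofPath k (Quiver.Path.nil : Quiver.Path a a)
        | inB _ => 0
      arr := fun e => match e with
        | .arrA α => ofPath k α.toPath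
        | .arrB _ => 0
        | .arrJ _ => 0
        | .arrK _ => 0
      idem := by rintro (a | b); exacts [ofPath_mul_comp _ _, mul_zero _]
      orth := by
        rintro (a | b) (a' | b') h
        exacts [ofPath_mul_of_ne _ _ (by rintro rfl; exact h rfl), mul_zero _, zero_mul _,
          mul_zero _]
      vert_arr := by
        rintro _ _ (α | β | j | κ)
        exacts [by rw [ofPath_mul_comp, Quiver.Path.nil_comp], mul_zero _, mul_zero _, mul_zero _]
      arr_vert := by
        rintro _ _ (α | β | j | κ)
        exacts [by rw [ofPath_mul_comp, Quiver.Path.comp_nil], mul_zero _, mul_zero _,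
          zero_mul _] }
    (by rw [sum_univ]; simp [one_def'])

variable (J K) in
/-- The projection `kΓ → kQB` which kills the vertices of `QA` and all arrows outside `QB`. -/
def projB : PathAlgebra k (MoritaQuiver J K) →+* PathAlgebra k QB :=
  LiftData.ringHom
    { vert := fun x => match x with
        | inA _ => 0
        | inB b => ofPath k (Quiver.Path.nil : Quiver.Path b b)
      arr := fun e => match e with
        | .arrA _ => 0
        | .arrB β => ofPath k β.toPath
        | .arrJ _ => 0
        | .arrK _ => 0
      idem := by rintro (a | b); exacts [mul_zero _, ofPath_mul_comp _ _]
      orth := by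
        rintro (a | b) (a' | b') h
        exacts [mul_zero _, zero_mul _, mul_zero _,
          ofPath_mul_of_ne _ _ (by rintro rfl; exact h rfl)]
      vert_arr := by
        rintro _ _ (α | β | j | κ)
        exacts [mul_zero _, by rw [ofPath_mul_comp, Quiver.Path.nil_comp], mul_zero _, mul_zero _]
      arr_vert := by
        rintro _ _ (α | β | j | κ)
        exacts [zero_mul _, by rw [ofPath_mul_comp, Quiver.Path.comp_nil], zero_mul _,
          mul_zero _] }
    (by rw [sum_univ]; simp [one_def'])


theorem inclA_nil (a : QA) : inclA J K k (ofPath k (Quiver.Path.nil : Quiver.Path a a)) =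
    ofPath k (Quiver.Path.nil : Quiver.Path (inA a : MoritaQuiver J K) (inA a)) :=
  LiftData.hom_ofPath _ _

theorem inclA_arrow {a a' : QA} (α : a ⟶ a') : inclA J K k (ofPath k α.toPath) =
    ofPath k (homA J K α).toPath := by
  refine (LiftData.hom_ofPath _ _).trans ?_
  change ofPath k Quiver.Path.nil * ofPath k (homA J K α).toPath = _
  rw [ofPath_mul_comp, Quiver.Path.nil_comp]

theorem projA_nil_inA (a : QA) :
    projA J K k (ofPath k (Quiver.Path.nil : Quiver.Path (inA a : MoritaQuiver J K) (inA a))) =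
      ofPath k (Quiver.Path.nil : Quiver.Path a a) :=
  LiftData.hom_ofPath _ _

theorem projA_nil_inB (b : QB) :
    projA J K k (ofPath k (Quiver.Path.nil : Quiver.Path (inB b : MoritaQuiver J K) (inB b))) =
      0 :=
  LiftData.hom_ofPath _ _

theorem projA_homA {a a' : QA} (α : a ⟶ a') :
    projA J K k (ofPath k (homA J K α).toPath) = ofPath k α.toPath := by
  refine (LiftData.hom_ofPath _ _).trans ?_
  change ofPath k Quiver.Path.nil * ofPath k α.toPath = _
  rw [ofPath_mul_comp, Quiver.Path.nil_comp]

theorem ofPath_mul_inclA_one {x : MoritaQuiver J K} {a : QA} (p : Quiver.Path x (inA a)) :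
    ofPath k p * inclA J K k 1 = ofPath k p := by
  rw [one_def', map_sum, Finset.mul_sum, Finset.sum_eq_single a]
  · rw [inclA_nil, ofPath_mul_comp, Quiver.Path.comp_nil]
  · intro a' _ h
    rw [inclA_nil, ofPath_mul_of_ne]
    simpa using h
  · simp

theorem ofPath_mul_inclA_one' {x : MoritaQuiver J K} {b : QB} (p : Quiver.Path x (inB b)) :
    ofPath k p * inclA J K k 1 = 0 := by
  rw [one_def', map_sum, Finset.mul_sum, Finset.sum_eq_zero]
  intro a' _
  rw [inclA_nil, ofPath_mul_of_ne]
  simp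

theorem inclA_one_mul_ofPath {x : MoritaQuiver J K} {a : QA} (p : Quiver.Path (inA a) x) :
    inclA J K k 1 * ofPath k p = ofPath k p := by
  rw [one_def', map_sum, Finset.sum_mul, Finset.sum_eq_single a]
  · rw [inclA_nil, ofPath_mul_comp, Quiver.Path.nil_comp]
  · intro a' _ h
    rw [inclA_nil, ofPath_mul_of_ne]
    simpa using h.symm
  · simp

theorem inclA_one_mul_ofPath' {x : MoritaQuiver J K} {b : QB} (p : Quiver.Path (inB b) x) :
    inclA J K k 1 * ofPath k p = 0 := by
  rw [one_def', map_sum, Finset.sum_mul, Finset.sum_eq_zero]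
  intro a' _
  rw [inclA_nil, ofPath_mul_of_ne]
  simp

theorem projA_of_source {x : MoritaQuiver J K} {b : QB} (p : Quiver.Path (inB b) x) :
    projA J K k (ofPath k p) = 0 := by
  rw [← Quiver.Path.nil_comp p, ← ofPath_mul_comp, map_mul, projA_nil_inB, zero_mul]

theorem projA_of_target {x : MoritaQuiver J K} {b : QB} (p : Quiver.Path x (inB b)) :
    projA J K k (ofPath k p) = 0 := by
  rw [← Quiver.Path.comp_nil p, ← ofPath_mul_comp, map_mul, projA_nil_inB, mul_zero]

theorem inclB_nil (a : QB) : inclB J K k (ofPath k (Quiver.Path.nil : Quiver.Path a a)) =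
    ofPath k (Quiver.Path.nil : Quiver.Path (inB a : MoritaQuiver J K) (inB a)) :=
  LiftData.hom_ofPath _ _

theorem inclB_arrow {a a' : QB} (α : a ⟶ a') : inclB J K k (ofPath k α.toPath) =
    ofPath k (homB J K α).toPath := by
  refine (LiftData.hom_ofPath _ _).trans ?_
  change ofPath k Quiver.Path.nil * ofPath k (homB J K α).toPath = _
  rw [ofPath_mul_comp, Quiver.Path.nil_comp]

theorem projB_nil_inB (a : QB) :
    projB J K k (ofPath k (Quiver.Path.nil : Quiver.Path (inB a : MoritaQuiver J K) (inB a))) =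
      ofPath k (Quiver.Path.nil : Quiver.Path a a) :=
  LiftData.hom_ofPath _ _

theorem projB_nil_inA (b : QA) :
    projB J K k (ofPath k (Quiver.Path.nil : Quiver.Path (inA b : MoritaQuiver J K) (inA b))) =
      0 :=
  LiftData.hom_ofPath _ _

theorem projB_homB {a a' : QB} (α : a ⟶ a') :
    projB J K k (ofPath k (homB J K α).toPath) = ofPath k α.toPath := by
  refine (LiftData.hom_ofPath _ _).trans ?_
  change ofPath k Quiver.Path.nil * ofPath k α.toPath = _
  rw [ofPath_mul_comp, Quiver.Path.nil_comp]

theorem ofPath_mul_inclB_one {x : MoritaQuiver J K} {a : QB} (p : Quiver.Path x (inB a)) :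
    ofPath k p * inclB J K k 1 = ofPath k p := by
  rw [one_def', map_sum, Finset.mul_sum, Finset.sum_eq_single a]
  · rw [inclB_nil, ofPath_mul_comp, Quiver.Path.comp_nil]
  · intro a' _ h
    rw [inclB_nil, ofPath_mul_of_ne]
    simpa using h
  · simp

theorem ofPath_mul_inclB_one' {x : MoritaQuiver J K} {b : QA} (p : Quiver.Path x (inA b)) :
    ofPath k p * inclB J K k 1 = 0 := by
  rw [one_def', map_sum, Finset.mul_sum, Finset.sum_eq_zero]
  intro a' _
  rw [inclB_nil, ofPath_mul_of_ne]
  simp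

theorem inclB_one_mul_ofPath {x : MoritaQuiver J K} {a : QB} (p : Quiver.Path (inB a) x) :
    inclB J K k 1 * ofPath k p = ofPath k p := by
  rw [one_def', map_sum, Finset.sum_mul, Finset.sum_eq_single a]
  · rw [inclB_nil, ofPath_mul_comp, Quiver.Path.nil_comp]
  · intro a' _ h
    rw [inclB_nil, ofPath_mul_of_ne]
    simpa using h.symm
  · simp

theorem inclB_one_mul_ofPath' {x : MoritaQuiver J K} {b : QA} (p : Quiver.Path (inA b) x) :
    inclB J K k 1 * ofPath k p = 0 := by
  rw [one_def', map_sum, Finset.sum_mul, Finset.sum_eq_zero]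
  intro a' _
  rw [inclB_nil, ofPath_mul_of_ne]
  simp

theorem projB_of_source {x : MoritaQuiver J K} {b : QA} (p : Quiver.Path (inA b) x) :
    projB J K k (ofPath k p) = 0 := by
  rw [← Quiver.Path.nil_comp p, ← ofPath_mul_comp, map_mul, projB_nil_inA, zero_mul]

theorem projB_of_target {x : MoritaQuiver J K} {b : QA} (p : Quiver.Path x (inA b)) :
    projB J K k (ofPath k p) = 0 := by
  rw [← Quiver.Path.comp_nil p, ← ofPath_mul_comp, map_mul, projB_nil_inA, mul_zero]

end MoritaQuiver

/-! ## Morita context algebras given by quivers with relations -/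

/-- The map of quotient rings induced by a multiplicative map. -/
def quotientMap {R S : Type u} [Ring R] [Ring S] (f : R →ₙ+* S) (I : Ideal R) (I' : Ideal S)
    [I.IsTwoSided] [I'.IsTwoSided] (h : ∀ x ∈ I, f x ∈ I') : (R ⧸ I) →ₙ+* (S ⧸ I') where
  toFun := QuotientAddGroup.map I.toAddSubgroup I'.toAddSubgroup f.toAddMonoidHom h
  map_zero' := map_zero _
  map_add' := map_add _
  map_mul' x y := by
    obtain ⟨x, rfl⟩ := Ideal.Quotient.mk_surjective x
    obtain ⟨y, rfl⟩ := Ideal.Quotient.mk_surjective y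
    change Ideal.Quotient.mk I' (f (x * y)) =
      Ideal.Quotient.mk I' (f x) * Ideal.Quotient.mk I' (f y)
    rw [map_mul, map_mul]

/-- The bound quiver algebra `kQ/I`. -/
abbrev BoundQuiverAlgebra {k : Type u} [Field k] {Q : Type u} [Quiver.{u} Q] [Fintype Q]
    (I : Ideal (PathAlgebra k Q)) : Type u :=
  PathAlgebra k Q ⧸ I

open MoritaQuiver PathAlgebra

section Morita

variable {k : Type u} [Field k] {QA QB : Type u} [Quiver.{u} QA] [Quiver.{u} QB]
  [Fintype QA] [Fintype QB] {J : QA → QB → Type u} {K : QB → QA → Type u}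

/-- The conditions on the ideal `IC` of `kΓ`: it contains `IA`, `IB` and the products
`α αⱼ`, `β βₖ`, `αⱼ βₖ`, `βₖ αⱼ`, where `α`, `β`, `αⱼ`, `βₖ` are arrows of `QA`, of `QB`, in `J`
and in `K`, and it induces on `kQA` and `kQB` no relations besides those in `IA` and `IB`,
so that `C = kΓ/IC` is a Morita context algebra with `A = kQA/IA` and `B = kQB/IB` on the
diagonal. Products of arrows that are not consecutive are zero in `kΓ` and need no condition. -/
structure IsMoritaIdeal (IA : Ideal (PathAlgebra k QA)) (IB : Ideal (PathAlgebra k QB))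
    (IC : Ideal (PathAlgebra k (MoritaQuiver J K))) : Prop where
  inclA_mem : ∀ x ∈ IA, inclA J K k x ∈ IC
  inclB_mem : ∀ x ∈ IB, inclB J K k x ∈ IC
  arrA_arrJ : ∀ {a a' : QA} {b : QB} (α : a ⟶ a') (j : J a' b),
    twoArrows k (homA J K α) (homJ K j) ∈ IC
  arrB_arrK : ∀ {b b' : QB} {a : QA} (β : b ⟶ b') (κ : K b' a),
    twoArrows k (homB J K β) (homK J κ) ∈ IC
  arrJ_arrK : ∀ {a a' : QA} {b : QB} (j : J a b) (κ : K b a'),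
    twoArrows k (homJ K j) (homK J κ) ∈ IC
  arrK_arrJ : ∀ {b b' : QB} {a : QA} (κ : K b a) (j : J a b'),
    twoArrows k (homK J κ) (homJ K j) ∈ IC
  mem_of_inclA_mem : ∀ x, inclA J K k x ∈ IC → x ∈ IA
  mem_of_inclB_mem : ∀ x, inclB J K k x ∈ IC → x ∈ IB

namespace IsMoritaIdeal

variable {IA : Ideal (PathAlgebra k QA)} {IB : Ideal (PathAlgebra k QB)}
  {IC : Ideal (PathAlgebra k (MoritaQuiver J K))}
  [IA.IsTwoSided] [IB.IsTwoSided] [IC.IsTwoSided]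

/-- The inclusion `A → C`, which sends `1` to the sum of the vertices of `QA`. -/
def jA (h : IsMoritaIdeal IA IB IC) : (BoundQuiverAlgebra IA) →ₙ+* (BoundQuiverAlgebra IC) :=
  quotientMap (inclA J K k) IA IC h.inclA_mem

/-- The inclusion `B → C`, which sends `1` to the sum of the vertices of `QB`. -/
def jB (h : IsMoritaIdeal IA IB IC) : (BoundQuiverAlgebra IB) →ₙ+* (BoundQuiverAlgebra IC) :=
  quotientMap (inclB J K k) IB IC h.inclB_mem

/-- Modulo `IC`, a path of `Γ` that starts and ends in `QA` equals its part inside `QA`. -/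
theorem keyA (h : IsMoritaIdeal IA IB IC) {a : QA} {x : MoritaQuiver J K} (p : Quiver.Path (inA a) x) :
    inclA J K k (projA J K k (ofPath k p)) - ofPath k p * inclA J K k 1 ∈ IC := by
  induction p with
  | nil =>
    rw [projA_nil_inA, inclA_nil, ofPath_mul_inclA_one, sub_self]
    exact IC.zero_mem
  | cons p e ih =>
    change Arrow _ _ at e
    cases e with
    | arrA α =>
      have h1 : ofPath k (p.cons (homA J K α)) = ofPath k p * ofPath k (homA J K α).toPath :=
        ofPath_cons k p _
      change inclA J K k (projA J K k (ofPath k (p.cons (homA J K α)))) -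
        ofPath k (p.cons (homA J K α)) * inclA J K k 1 ∈ IC
      have h2 := IC.mul_mem_right (ofPath k (homA J K α).toPath) ih
      rw [sub_mul, mul_assoc, inclA_one_mul_ofPath] at h2
      rw [ofPath_mul_inclA_one, h1, map_mul, map_mul, projA_homA, inclA_arrow]
      exact h2
    | arrB β =>
      rw [projA_of_target, ofPath_mul_inclA_one', map_zero, sub_self]
      exact IC.zero_mem
    | arrJ j =>
      rw [projA_of_target, ofPath_mul_inclA_one', map_zero, sub_self]
      exact IC.zero_mem
    | arrK κ =>
      have h0 : projA J K k (ofPath k (p.cons (homK J κ))) = 0 := by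
        rw [ofPath_cons, map_mul, projA_of_target, zero_mul]
      change inclA J K k (projA J K k (ofPath k (p.cons (homK J κ)))) -
        ofPath k (p.cons (homK J κ)) * inclA J K k 1 ∈ IC
      rw [h0, ofPath_mul_inclA_one, map_zero, zero_sub, neg_mem_iff]
      cases p with
      | cons p' e' =>
        have h1 : ofPath k ((p'.cons e').cons (homK J κ)) =
            ofPath k p' * twoArrows k e' (homK J κ) := by
          rw [twoArrows, ofPath_mul_comp]; rfl
        rw [h1]
        refine IC.mul_mem_left _ ?_
        change Arrow _ _ at e'
        cases e' with
        | arrB β => exact h.arrB_arrK β κ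
        | arrJ j => exact h.arrJ_arrK j κ

theorem projA_mem (h : IsMoritaIdeal IA IB IC) (x : PathAlgebra k (MoritaQuiver J K)) (hx : x ∈ IC) : projA J K k x ∈ IA := by
  let f : PathAlgebra k (MoritaQuiver J K) →ₗ[k] PathAlgebra k (MoritaQuiver J K) :=
    { toFun := fun x => inclA J K k (projA J K k x) - inclA J K k 1 * x * inclA J K k 1
      map_add' := fun x y => by simp only [map_add, mul_add, add_mul]; abel
      map_smul' := fun c x => by
        rw [show projA J K k (c • x) = c • projA J K k x from LiftData.hom_smul _ c x,
          show inclA J K k (c • projA J K k x) = c • inclA J K k (projA J K k x) from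
            LiftData.hom_smul _ c _, mul_smul_comm, smul_mul_assoc, smul_sub, RingHom.id_apply] }
  have hf : (IC.restrictScalars k).mkQ.comp f = 0 := by
    refine hom_ext fun {y z} p => (Submodule.Quotient.mk_eq_zero _).2 ?_
    change inclA J K k (projA J K k (ofPath k p)) -
      inclA J K k 1 * ofPath k p * inclA J K k 1 ∈ IC
    cases y with
    | inA a =>
      rw [inclA_one_mul_ofPath]
      exact h.keyA p
    | inB b =>
      rw [inclA_one_mul_ofPath', projA_of_source, map_zero, zero_mul, sub_zero]
      exact IC.zero_mem
  have h1 : f x ∈ IC :=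
    (Submodule.Quotient.mk_eq_zero (IC.restrictScalars k)).1 (congrArg (fun F => F x) hf)
  have h2 : inclA J K k 1 * x * inclA J K k 1 ∈ IC :=
    IC.mul_mem_right _ (IC.mul_mem_left _ hx)
  refine h.mem_of_inclA_mem _ ?_
  have h3 := IC.add_mem h1 h2
  rwa [show f x + inclA J K k 1 * x * inclA J K k 1 = inclA J K k (projA J K k x) from
    sub_add_cancel _ _] at h3

/-- The projection `C → A`, the quotient by the ideal generated by the vertices of `QB`. -/
def rA (h : IsMoritaIdeal IA IB IC) : (BoundQuiverAlgebra IC) →+* (BoundQuiverAlgebra IA) :=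
  Ideal.Quotient.lift IC ((Ideal.Quotient.mk IA).comp (projA J K k))
    fun x hx => Ideal.Quotient.eq_zero_iff_mem.2 (h.projA_mem x hx)

/-- Modulo `IC`, a path of `Γ` that starts and ends in `QB` equals its part inside `QB`. -/
theorem keyB (h : IsMoritaIdeal IA IB IC) {a : QB} {x : MoritaQuiver J K} (p : Quiver.Path (inB a) x) :
    inclB J K k (projB J K k (ofPath k p)) - ofPath k p * inclB J K k 1 ∈ IC := by
  induction p with
  | nil =>
    rw [projB_nil_inB, inclB_nil, ofPath_mul_inclB_one, sub_self]
    exact IC.zero_mem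
  | cons p e ih =>
    change Arrow _ _ at e
    cases e with
    | arrB β =>
      have h1 : ofPath k (p.cons (homB J K β)) = ofPath k p * ofPath k (homB J K β).toPath :=
        ofPath_cons k p _
      change inclB J K k (projB J K k (ofPath k (p.cons (homB J K β)))) -
        ofPath k (p.cons (homB J K β)) * inclB J K k 1 ∈ IC
      have h2 := IC.mul_mem_right (ofPath k (homB J K β).toPath) ih
      rw [sub_mul, mul_assoc, inclB_one_mul_ofPath] at h2
      rw [ofPath_mul_inclB_one, h1, map_mul, map_mul, projB_homB, inclB_arrow]
      exact h2
    | arrA α =>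
      rw [projB_of_target, ofPath_mul_inclB_one', map_zero, sub_self]
      exact IC.zero_mem
    | arrK κ =>
      rw [projB_of_target, ofPath_mul_inclB_one', map_zero, sub_self]
      exact IC.zero_mem
    | arrJ j =>
      have h0 : projB J K k (ofPath k (p.cons (homJ K j))) = 0 := by
        rw [ofPath_cons, map_mul, projB_of_target, zero_mul]
      change inclB J K k (projB J K k (ofPath k (p.cons (homJ K j)))) -
        ofPath k (p.cons (homJ K j)) * inclB J K k 1 ∈ IC
      rw [h0, ofPath_mul_inclB_one, map_zero, zero_sub, neg_mem_iff]
      cases p with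
      | cons p' e' =>
        have h1 : ofPath k ((p'.cons e').cons (homJ K j)) =
            ofPath k p' * twoArrows k e' (homJ K j) := by
          rw [twoArrows, ofPath_mul_comp]; rfl
        rw [h1]
        refine IC.mul_mem_left _ ?_
        change Arrow _ _ at e'
        cases e' with
        | arrA α => exact h.arrA_arrJ α j
        | arrK κ => exact h.arrK_arrJ κ j

theorem projB_mem (h : IsMoritaIdeal IA IB IC) (x : PathAlgebra k (MoritaQuiver J K)) (hx : x ∈ IC) : projB J K k x ∈ IB := by
  let f : PathAlgebra k (MoritaQuiver J K) →ₗ[k] PathAlgebra k (MoritaQuiver J K) :=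
    { toFun := fun x => inclB J K k (projB J K k x) - inclB J K k 1 * x * inclB J K k 1
      map_add' := fun x y => by simp only [map_add, mul_add, add_mul]; abel
      map_smul' := fun c x => by
        rw [show projB J K k (c • x) = c • projB J K k x from LiftData.hom_smul _ c x,
          show inclB J K k (c • projB J K k x) = c • inclB J K k (projB J K k x) from
            LiftData.hom_smul _ c _, mul_smul_comm, smul_mul_assoc, smul_sub, RingHom.id_apply] }
  have hf : (IC.restrictScalars k).mkQ.comp f = 0 := by
    refine hom_ext fun {y z} p => (Submodule.Quotient.mk_eq_zero _).2 ?_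
    change inclB J K k (projB J K k (ofPath k p)) -
      inclB J K k 1 * ofPath k p * inclB J K k 1 ∈ IC
    cases y with
    | inB a =>
      rw [inclB_one_mul_ofPath]
      exact h.keyB p
    | inA b =>
      rw [inclB_one_mul_ofPath', projB_of_source, map_zero, zero_mul, sub_zero]
      exact IC.zero_mem
  have h1 : f x ∈ IC :=
    (Submodule.Quotient.mk_eq_zero (IC.restrictScalars k)).1 (congrArg (fun F => F x) hf)
  have h2 : inclB J K k 1 * x * inclB J K k 1 ∈ IC :=
    IC.mul_mem_right _ (IC.mul_mem_left _ hx)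
  refine h.mem_of_inclB_mem _ ?_
  have h3 := IC.add_mem h1 h2
  rwa [show f x + inclB J K k 1 * x * inclB J K k 1 = inclB J K k (projB J K k x) from
    sub_add_cancel _ _] at h3

/-- The projection `C → B`, the quotient by the ideal generated by the vertices of `QA`. -/
def rB (h : IsMoritaIdeal IA IB IC) : (BoundQuiverAlgebra IC) →+* (BoundQuiverAlgebra IB) :=
  Ideal.Quotient.lift IC ((Ideal.Quotient.mk IB).comp (projB J K k))
    fun x hx => Ideal.Quotient.eq_zero_iff_mem.2 (h.projB_mem x hx)

/-- The class of right `A`-modules `Orb_{Ω_A}(Π_A(Ω_C(C₀)))`: all `Ω_Aⁿ(Π_A(Ω_C(C₀)))` with `n ≥ 0`,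
where `C₀` is the direct sum of the simple `C`-modules and `Π_A` is the restriction to `A`. -/
def orbitA (h : IsMoritaIdeal IA IB IC) (X : ModuleCat.{u} (BoundQuiverAlgebra IA)ᵐᵒᵖ) : Prop :=
  ∃ (S L : ModuleCat.{u} (BoundQuiverAlgebra IC)ᵐᵒᵖ) (n : ℕ),
    IsSumOfSimples (BoundQuiverAlgebra IC)ᵐᵒᵖ S ∧ IsSyzygy (BoundQuiverAlgebra IC)ᵐᵒᵖ S L ∧ IsNthSyzygy _ n (restrictModule h.jA L) X

/-- The class of right `B`-modules `Orb_{Ω_B}(Π_B(Ω_C(C₀)))`. -/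
def orbitB (h : IsMoritaIdeal IA IB IC) (Y : ModuleCat.{u} (BoundQuiverAlgebra IB)ᵐᵒᵖ) : Prop :=
  ∃ (S L : ModuleCat.{u} (BoundQuiverAlgebra IC)ᵐᵒᵖ) (n : ℕ),
    IsSumOfSimples (BoundQuiverAlgebra IC)ᵐᵒᵖ S ∧ IsSyzygy (BoundQuiverAlgebra IC)ᵐᵒᵖ S L ∧ IsNthSyzygy _ n (restrictModule h.jB L) Y

/-- The orbit group `𝒪 ⊆ K₀(C)`, generated by the classes of all direct summands of the
`C`-modules `X ⊕ Y` with `X ∈ add Orb_{Ω_A}(Π_A(Ω_C(C₀)))` and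
`Y ∈ add Orb_{Ω_B}(Π_B(Ω_C(C₀)))`. -/
def orbitGroup (h : IsMoritaIdeal IA IB IC) :
    AddSubgroup (SyzygyK0 (BoundQuiverAlgebra IC)ᵐᵒᵖ) :=
  AddSubgroup.closure
    {x | ∃ (X : ModuleCat.{u} (BoundQuiverAlgebra IA)ᵐᵒᵖ)
        (Y : ModuleCat.{u} (BoundQuiverAlgebra IB)ᵐᵒᵖ)
        (N : FGModuleCat.{u} (BoundQuiverAlgebra IC)ᵐᵒᵖ),
      MemAdd _ h.orbitA X ∧ MemAdd _ h.orbitB Y ∧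
      IsDirectSummand (BoundQuiverAlgebra IC)ᵐᵒᵖ N
        (inflateModule h.rA X × inflateModule h.rB Y) ∧
      x = SyzygyK0.mk _ N}

/-- The family `O` is a finite list of representatives, without repetition, of the isomorphism
classes of the indecomposable finitely generated `C`-modules whose class lies in `𝒪`. -/
def IsOrbitIndecomposables (h : IsMoritaIdeal IA IB IC) {m : ℕ}
    (O : Fin m → FGModuleCat.{u} (BoundQuiverAlgebra IC)ᵐᵒᵖ) : Prop :=
  (∀ i, IsIndecomposableModule (BoundQuiverAlgebra IC)ᵐᵒᵖ (O i) ∧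
    SyzygyK0.mk _ (O i) ∈ h.orbitGroup) ∧
  (∀ i j, Nonempty (O i ≃ₗ[(BoundQuiverAlgebra IC)ᵐᵒᵖ] O j) → i = j) ∧
  ∀ N : FGModuleCat.{u} (BoundQuiverAlgebra IC)ᵐᵒᵖ,
    IsIndecomposableModule (BoundQuiverAlgebra IC)ᵐᵒᵖ N →
    SyzygyK0.mk _ N ∈ h.orbitGroup →
    ∃ i, Nonempty (N ≃ₗ[(BoundQuiverAlgebra IC)ᵐᵒᵖ] O i)

/-- The right `C`-module `V ⊕ A ⊕ W ⊕ B ⊕ (⊕ᵢ Oᵢ)`. -/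
abbrev igusaTodorovSum (h : IsMoritaIdeal IA IB IC)
    (V : ModuleCat.{u} (BoundQuiverAlgebra IA)ᵐᵒᵖ) (W : ModuleCat.{u} (BoundQuiverAlgebra IB)ᵐᵒᵖ)
    {m : ℕ} (O : Fin m → FGModuleCat.{u} (BoundQuiverAlgebra IC)ᵐᵒᵖ) :
    ModuleCat.{u} (BoundQuiverAlgebra IC)ᵐᵒᵖ :=
  ModuleCat.of (BoundQuiverAlgebra IC)ᵐᵒᵖ
    (inflateModule h.rA V ×
      inflateModule h.rA (ModuleCat.of (BoundQuiverAlgebra IA)ᵐᵒᵖ (BoundQuiverAlgebra IA)) ×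
      inflateModule h.rB W ×
      inflateModule h.rB (ModuleCat.of (BoundQuiverAlgebra IB)ᵐᵒᵖ (BoundQuiverAlgebra IB)) ×
      (∀ i, O i))

end IsMoritaIdeal
end Morita

end

/-!
Write `e` and `f` for the idempotents of `C` with `A = e C e` and `B = f C f`. A path of positive
length that ends in one of the two quivers and then crosses to the other one contains a zero
relation, so `rad C * f C e = 0 = rad C * e C f`. This and the fact that `A` and `B` are quotients
of `C` are all that is used of the quivers (`IsMoritaSplitting`).

If `P → M` is a projective cover over `C`, its kernel `K` lies in `P * rad C`, so `K f C e` and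
`K e C f` vanish and `K = K e ⊕ K f` is the sum of an `A`-module and a `B`-module
(`IsMoritaSplitting.splitEquiv`). If moreover `M = X` is an `A`-module, then `P f ⊆ K`, which gives
two things. First, `P f C e = 0`, so `P e → X` is a projective cover over `A` and `K e = Ω_A(X)`.
Second, `K f = P f = (P * rad C) f`, and `P * rad C` is the syzygy of the semisimple module
`P / P * rad C`; hence `K f ∈ add Π_B(Ω_C(C₀))` (`IsMoritaSplitting.exists_isSyzygy_inflate`).
Iterating this on both sides at once, `Ω_C^i(X) = Ω_A^i(X) ⊕ Z`, where `Z` is the sum of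
modules in the additive closures of the two orbits (`IsMoritaSplitting.syzygiesDecompose`). So
`Ω_C^{n+1}(M) = Ω_A^n(X) ⊕ Ω_B^n(Y) ⊕ Z` with `X = K e` and `Y = K f`. The first two terms are
presented by `V_A` and `W_B`, and `Z` is a direct sum of indecomposable modules with class in `𝒪`.

That there are only finitely many such indecomposable modules is a form of the Krull-Schmidt
theorem: for a nonprojective indecomposable module `N`, with local endomorphism ring by Fitting's
lemma, the dimension of `Hom(N, M)` modulo the maps that are not split monomorphisms is additive in
`M`, is nonzero for `M = N`, and vanishes unless `N` is a summand of `M`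
(`exists_multiplicity_hom`). Thus only summands of the finitely many modules that occur in
generators of `𝒪`, and the finitely many indecomposable projective modules, can have class in `𝒪`.
-/

/-! ### Direct summands and `add` -/

section Summands

variable {R : Type u} [Ring R] {L M N M' N' : Type u}
  [AddCommGroup L] [Module R L] [AddCommGroup M] [Module R M] [AddCommGroup N] [Module R N]
  [AddCommGroup M'] [Module R M'] [AddCommGroup N'] [Module R N']

/-- Being a direct summand up to isomorphism is the same as being a retract. -/
theorem isDirectSummand_iff_retract :
    IsDirectSummand R N M ↔ ∃ (i : N →ₗ[R] M) (p : M →ₗ[R] N), ∀ x, p (i x) = x := by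
  constructor
  · rintro ⟨L, ⟨e⟩⟩
    exact ⟨e.toLinearMap ∘ₗ LinearMap.inl R N L, LinearMap.fst R N L ∘ₗ e.symm.toLinearMap,
      fun x => by simp⟩
  · rintro ⟨i, p, h⟩
    refine ⟨ModuleCat.of R (LinearMap.ker p), ⟨?_⟩⟩
    exact
      { toFun := fun x => i x.1 + (x.2 : LinearMap.ker p)
        map_add' := fun x y => by
          rw [Prod.fst_add, Prod.snd_add, map_add, Submodule.coe_add]; abel
        map_smul' := fun c x => by
          rw [Prod.smul_fst, Prod.smul_snd, map_smul, Submodule.coe_smul, smul_add]; rfl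
        invFun := fun y => (p y, ⟨y - i (p y), by simp [h]⟩)
        left_inv := fun ⟨x, y, hy⟩ => by
          have : p y = 0 := hy
          simp [h, this]
        right_inv := fun y => by simp }

namespace IsDirectSummand

theorem of_retract (i : N →ₗ[R] M) (p : M →ₗ[R] N) (h : ∀ x, p (i x) = x) :
    IsDirectSummand R N M :=
  isDirectSummand_iff_retract.2 ⟨i, p, h⟩

theorem of_equiv (e : N ≃ₗ[R] M) : IsDirectSummand R N M :=
  of_retract e.toLinearMap e.symm.toLinearMap fun x => by simp

variable (R M) in
theorem refl : IsDirectSummand R M M := of_equiv (LinearEquiv.refl R M)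

theorem trans (h : IsDirectSummand R L M) (h' : IsDirectSummand R M N) :
    IsDirectSummand R L N := by
  obtain ⟨i, p, h⟩ := isDirectSummand_iff_retract.1 h
  obtain ⟨i', p', h'⟩ := isDirectSummand_iff_retract.1 h'
  exact of_retract (i' ∘ₗ i) (p ∘ₗ p') fun x => by simp [h, h']

/-- Retractions combine to a retraction of the product. This is not stated with `IsDirectSummand`
because `ι` may be in a higher universe, and then the product is not in `Type u`. -/
theorem pi {ι : Type*} {F G : ι → Type u} [∀ i, AddCommGroup (F i)] [∀ i, Module R (F i)]
    [∀ i, AddCommGroup (G i)] [∀ i, Module R (G i)] [Finite ι]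
    (h : ∀ i, IsDirectSummand R (F i) (G i)) :
    ∃ (i : (∀ i, F i) →ₗ[R] (∀ i, G i)) (p : (∀ i, G i) →ₗ[R] (∀ i, F i)), ∀ x, p (i x) = x := by
  choose i p h using fun j => isDirectSummand_iff_retract.1 (h j)
  exact ⟨LinearMap.pi fun j => i j ∘ₗ LinearMap.proj j,
    LinearMap.pi fun j => p j ∘ₗ LinearMap.proj j, fun x => by ext j; simp [h]⟩

theorem fst : IsDirectSummand R M (M × N) :=
  of_retract (LinearMap.inl R M N) (LinearMap.fst R M N) fun _ => rfl

theorem snd : IsDirectSummand R N (M × N) :=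
  of_retract (LinearMap.inr R M N) (LinearMap.snd R M N) fun _ => rfl

theorem of_pi {m : ℕ} {F : Fin m → Type u} [∀ i, AddCommGroup (F i)] [∀ i, Module R (F i)]
    (i : Fin m) : IsDirectSummand R (F i) (∀ i, F i) :=
  of_retract (LinearMap.single R F i) (LinearMap.proj i) fun x => by simp

theorem prod (h : IsDirectSummand R M M') (h' : IsDirectSummand R N N') :
    IsDirectSummand R (M × N) (M' × N') := by
  obtain ⟨i, p, h⟩ := isDirectSummand_iff_retract.1 h
  obtain ⟨i', p', h'⟩ := isDirectSummand_iff_retract.1 h'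
  exact of_retract (i.prodMap i') (p.prodMap p') fun x => by ext <;> simp [h, h']

theorem finite (h : IsDirectSummand R N M) [Module.Finite R M] : Module.Finite R N := by
  obtain ⟨i, p, h⟩ := isDirectSummand_iff_retract.1 h
  exact Module.Finite.of_surjective p fun x => ⟨i x, h x⟩

theorem projective (h : IsDirectSummand R N M) [Module.Projective R M] :
    Module.Projective R N := by
  obtain ⟨i, p, h⟩ := isDirectSummand_iff_retract.1 h
  exact Module.Projective.of_split i p (LinearMap.ext h)

end IsDirectSummand

namespace MemAdd

variable {𝒞 𝒟 : ModuleCat.{u} R → Prop}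

theorem of_isDirectSummand (hM : MemAdd R 𝒞 M) (h : IsDirectSummand R N M) : MemAdd R 𝒞 N := by
  obtain ⟨m, F, hF, hM⟩ := hM
  exact ⟨m, F, hF, h.trans hM⟩

theorem of_equiv (hM : MemAdd R 𝒞 M) (e : N ≃ₗ[R] M) : MemAdd R 𝒞 N :=
  hM.of_isDirectSummand (.of_equiv e)

/-- Any finite index type may be used in the definition of `add`. -/
theorem of_finite {ι : Type*} [Finite ι] (F : ι → ModuleCat.{u} R) (hF : ∀ i, 𝒞 (F i))
    (i : N →ₗ[R] (∀ i, F i)) (p : (∀ i, F i) →ₗ[R] N) (h : ∀ x, p (i x) = x) : MemAdd R 𝒞 N := by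
  obtain ⟨m, ⟨e⟩⟩ := Finite.exists_equiv_fin ι
  let E := LinearEquiv.piCongrLeft R (fun i => F i) e.symm
  exact ⟨m, fun i => F (e.symm i), fun _ => hF _, .of_retract (E.symm.toLinearMap ∘ₗ i)
    (p ∘ₗ E.toLinearMap) fun x => by simp [h]⟩

theorem of_mem {X : ModuleCat.{u} R} (h : 𝒞 X) : MemAdd R 𝒞 X :=
  of_finite (fun _ : Unit => X) (fun _ => h) (LinearMap.pi fun _ => LinearMap.id)
    (LinearMap.proj ()) fun _ => rfl

theorem of_subsingleton [Subsingleton N] : MemAdd R 𝒞 N :=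
  of_finite (fun i : Empty => i.elim) (fun i => i.elim) 0 0 fun _ => Subsingleton.elim _ _

theorem pi {m : ℕ} {F : Fin m → Type u} [∀ i, AddCommGroup (F i)] [∀ i, Module R (F i)]
    (h : ∀ i, MemAdd R 𝒞 (F i)) : MemAdd R 𝒞 (∀ i, F i) := by
  choose n G hG hF using h
  obtain ⟨i, p, hip⟩ := IsDirectSummand.pi hF
  let E := LinearEquiv.piCurry R (fun (i : Fin m) (j : Fin (n i)) => (G i j : Type u))
  exact of_finite (fun x : Σ i : Fin m, Fin (n i) => G x.1 x.2) (fun _ => hG _ _)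
    (E.symm.toLinearMap ∘ₗ i) (p ∘ₗ E.toLinearMap) fun x => by
      simp only [LinearMap.comp_apply, LinearEquiv.coe_coe, LinearEquiv.apply_symm_apply, hip]

theorem prod (hM : MemAdd R 𝒞 M) (hN : MemAdd R 𝒞 N) : MemAdd R 𝒞 (M × N) := by
  obtain ⟨m, F, hF, hM⟩ := hM
  obtain ⟨n, G, hG, hN⟩ := hN
  obtain ⟨i, p, h⟩ := isDirectSummand_iff_retract.1 (hM.prod hN)
  let E := LinearEquiv.sumPiEquivProdPi R (Fin m) (Fin n)
    (fun x => ((Sum.elim F G x : ModuleCat.{u} R) : Type u))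
  exact of_finite (Sum.elim F G) (by rintro (x | x); exacts [hF x, hG x])
    (E.symm.toLinearMap ∘ₗ i) (p ∘ₗ E.toLinearMap) fun x =>
      (congrArg p (E.apply_symm_apply (i x))).trans (h x)

theorem trans (h : ∀ X, 𝒞 X → MemAdd R 𝒟 X) (hN : MemAdd R 𝒞 N) : MemAdd R 𝒟 N := by
  obtain ⟨m, F, hF, hN⟩ := hN
  exact (MemAdd.pi fun i => h _ (hF i)).of_isDirectSummand hN

theorem finite (h : ∀ X, 𝒞 X → Module.Finite R X) (hN : MemAdd R 𝒞 N) : Module.Finite R N := by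
  obtain ⟨m, F, hF, hN⟩ := hN
  have := fun i => h _ (hF i)
  exact hN.finite

end MemAdd

end Summands

/-! ### Projective covers and syzygies -/

section Syzygies

variable {R : Type u} [Ring R]

/-- `π : P → M` is a projective cover: `P` is projective, and `π` is onto with superfluous
kernel. -/
structure IsProjectiveCover {P M : Type u} [AddCommGroup P] [Module R P] [AddCommGroup M]
    [Module R M] (π : P →ₗ[R] M) : Prop where
  projective : Module.Projective R P
  surjective : Function.Surjective π
  superfluous : ∀ U : Submodule R P, U ⊔ LinearMap.ker π = ⊤ → U = ⊤

variable {P P' M M' N N' : Type u}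
  [AddCommGroup P] [Module R P] [AddCommGroup P'] [Module R P']
  [AddCommGroup M] [Module R M] [AddCommGroup N] [Module R N]
  [AddCommGroup M'] [Module R M'] [AddCommGroup N'] [Module R N']

theorem isSyzygy_iff : IsSyzygy R M N ↔ ∃ (P : ModuleCat.{u} R) (π : P →ₗ[R] M),
    IsProjectiveCover π ∧ Nonempty (N ≃ₗ[R] LinearMap.ker π) :=
  ⟨fun ⟨P, π, h₁, h₂, h₃, h₄⟩ => ⟨P, π, ⟨h₁, h₂, h₃⟩, h₄⟩,
    fun ⟨P, π, ⟨h₁, h₂, h₃⟩, h₄⟩ => ⟨P, π, h₁, h₂, h₃, h₄⟩⟩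

namespace IsProjectiveCover

theorem isSyzygy {π : P →ₗ[R] M} (h : IsProjectiveCover π) :
    IsSyzygy R M (LinearMap.ker π) :=
  ⟨ModuleCat.of R P, π, h.projective, h.surjective, h.superfluous, ⟨LinearEquiv.refl R _⟩⟩

/-- Projective covers are unique: an isomorphism lifts to projective covers. -/
theorem exists_equiv {π : P →ₗ[R] M} {π' : P' →ₗ[R] M'} (h : IsProjectiveCover π)
    (h' : IsProjectiveCover π') (e : M ≃ₗ[R] M') :
    ∃ E : P ≃ₗ[R] P', ∀ x, π' (E x) = e (π x) := by
  have := h.projective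
  have := h'.projective
  obtain ⟨φ, hφ⟩ := Module.projective_lifting_property π' (e.toLinearMap ∘ₗ π) h'.surjective
  replace hφ : ∀ x, π' (φ x) = e (π x) := fun x => LinearMap.congr_fun hφ x
  have hsurj : Function.Surjective φ := by
    rw [← LinearMap.range_eq_top]
    refine h'.superfluous _ (eq_top_iff.2 fun y _ => ?_)
    obtain ⟨x, hx⟩ := h.surjective (e.symm (π' y))
    refine Submodule.mem_sup.2 ⟨φ x, ⟨x, rfl⟩, y - φ x, ?_, by abel⟩
    rw [LinearMap.mem_ker, map_sub, hφ, hx, e.apply_symm_apply, sub_self]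
  obtain ⟨s, hs⟩ := φ.exists_rightInverse_of_surjective (LinearMap.range_eq_top.2 hsurj)
  replace hs : ∀ y, φ (s y) = y := fun y => LinearMap.congr_fun hs y
  have hs' : Function.Surjective s := by
    rw [← LinearMap.range_eq_top]
    refine h.superfluous _ (eq_top_iff.2 fun x _ => ?_)
    refine Submodule.mem_sup.2 ⟨s (φ x), ⟨_, rfl⟩, x - s (φ x), ?_, by abel⟩
    apply e.injective
    rw [← hφ, map_sub, hs, sub_self, map_zero, map_zero]
  refine ⟨LinearEquiv.ofBijective φ ⟨?_, hsurj⟩, hφ⟩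
  intro x y hxy
  obtain ⟨x, rfl⟩ := hs' x
  obtain ⟨y, rfl⟩ := hs' y
  rw [hs, hs] at hxy
  rw [hxy]

theorem comp_equiv {π : P →ₗ[R] M} (h : IsProjectiveCover π) (e : M ≃ₗ[R] M') :
    IsProjectiveCover (e.toLinearMap ∘ₗ π) where
  projective := h.projective
  surjective := e.surjective.comp h.surjective
  superfluous U hU := h.superfluous U (by rwa [LinearEquiv.ker_comp] at hU)

/-- The image of a superfluous submodule is superfluous. -/
theorem eq_top_of_sup_map_ker {X : Type u} [AddCommGroup X] [Module R X] {π : P →ₗ[R] M}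
    (h : IsProjectiveCover π) (f : P →ₗ[R] X) (U : Submodule R X)
    (hU : U ⊔ (LinearMap.ker π).map f = ⊤) : U = ⊤ := by
  have : U.comap f = ⊤ := by
    refine h.superfluous _ (eq_top_iff.2 fun x _ => ?_)
    have hx : f x ∈ U ⊔ (LinearMap.ker π).map f := by rw [hU]; trivial
    obtain ⟨u, hu, _, ⟨v, hv, rfl⟩, huv⟩ := Submodule.mem_sup.1 hx
    refine Submodule.mem_sup.2 ⟨x - v, ?_, v, hv, by abel⟩
    rw [Submodule.mem_comap, map_sub, ← huv, add_sub_cancel_right]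
    exact hu
  rw [← hU, eq_comm, sup_eq_left, Submodule.map_le_iff_le_comap, this]
  exact le_top

theorem prod {π : P →ₗ[R] M} {π' : P' →ₗ[R] M'} (h : IsProjectiveCover π)
    (h' : IsProjectiveCover π') : IsProjectiveCover (π.prodMap π') where
  projective := by
    have := h.projective
    have := h'.projective
    infer_instance
  surjective := h.surjective.prodMap h'.surjective
  superfluous U hU := by
    refine h.eq_top_of_sup_map_ker (LinearMap.inl R P P') U
      (h'.eq_top_of_sup_map_ker (LinearMap.inr R P P') _ ?_)
    rwa [LinearMap.ker_prodMap, LinearMap.prod_eq_sup_map, ← sup_assoc] at hU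

/-- The source of a projective cover of a finitely generated module is finitely generated. -/
theorem finite {π : P →ₗ[R] M} (h : IsProjectiveCover π) [Module.Finite R M] :
    Module.Finite R P := by
  obtain ⟨s, hs⟩ := Module.Finite.fg_top (R := R) (M := M)
  choose σ hσ using h.surjective
  classical
  have : Submodule.span R (s.image σ : Set P) = ⊤ := by
    refine h.superfluous _ (eq_top_iff.2 fun x _ => ?_)
    have hx : π x ∈ (Submodule.span R (s.image σ : Set P)).map π := by
      rw [Submodule.map_span, Finset.coe_image, ← Set.image_comp]
      simp [hσ, hs]
    obtain ⟨y, hy, hxy⟩ := hx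
    exact Submodule.mem_sup.2 ⟨y, hy, x - y, by simp [hxy], by abel⟩
  exact ⟨⟨_, this⟩⟩

end IsProjectiveCover

/-- Over an Artinian ring every finitely generated module has a projective cover. -/
theorem exists_isProjectiveCover [IsArtinianRing R] (M : Type u) [AddCommGroup M] [Module R M]
    [Module.Finite R M] :
    ∃ (P : ModuleCat.{u} R) (π : P →ₗ[R] M), IsProjectiveCover π := by
  obtain ⟨m, f, hf⟩ := Module.Finite.exists_fin' R M
  -- a minimal submodule of a free module that still maps onto `M`
  obtain ⟨U, hU, hmin⟩ := IsArtinian.set_has_minimal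
    {U : Submodule R (Fin m → R) | U.map f = ⊤}
    ⟨⊤, by simpa [LinearMap.range_eq_top] using hf⟩
  have hU' : ∀ W : Submodule R (Fin m → R), W ≤ U → W.map f = ⊤ → W = U := fun W hW h =>
    by_contra fun hne => hmin W h (lt_of_le_of_ne hW hne)
  let π : U →ₗ[R] M := f ∘ₗ U.subtype
  have hπ : Function.Surjective π := by
    intro x
    have : x ∈ U.map f := by rw [show U.map f = ⊤ from hU]; trivial
    obtain ⟨y, hy, rfl⟩ := this
    exact ⟨⟨y, hy⟩, rfl⟩
  have hsup : ∀ W : Submodule R U, W ⊔ LinearMap.ker π = ⊤ → W = ⊤ := by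
    intro W hW
    have h₀ : (LinearMap.ker π).map π = ⊥ := by
      rw [← LinearMap.le_ker_iff_map]
    have h₁ : (W.map U.subtype).map f = ⊤ := by
      rw [← Submodule.map_comp]
      change W.map π = ⊤
      have := congrArg (Submodule.map π) hW
      rwa [Submodule.map_sup, h₀, sup_bot_eq, Submodule.map_top,
        LinearMap.range_eq_top.2 hπ] at this
    have h₂ := hU' _ (Submodule.map_subtype_le U W) h₁
    refine eq_top_iff.2 fun x _ => ?_
    have : (x : Fin m → R) ∈ W.map U.subtype := by rw [h₂]; exact x.2
    obtain ⟨y, hy, hxy⟩ := this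
    rwa [← Subtype.ext hxy]
  -- lifting `f` along `π` gives a retraction of the free module onto `U`
  obtain ⟨ρ, hρ⟩ := Module.projective_lifting_property π f hπ
  replace hρ : ∀ x, π (ρ x) = f x := fun x => LinearMap.congr_fun hρ x
  have hsurj : Function.Surjective (ρ ∘ₗ U.subtype) := by
    rw [← LinearMap.range_eq_top]
    refine hsup _ (eq_top_iff.2 fun x _ => ?_)
    refine Submodule.mem_sup.2 ⟨ρ x, ⟨x, rfl⟩, x - ρ x, ?_, by abel⟩
    rw [LinearMap.mem_ker, map_sub, hρ]
    exact sub_self _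
  let E := LinearEquiv.ofBijective (ρ ∘ₗ U.subtype)
    ⟨IsNoetherian.injective_of_surjective_endomorphism _ hsurj, hsurj⟩
  refine ⟨ModuleCat.of R U, π, ?_, hπ, hsup⟩
  exact Module.Projective.of_split U.subtype (E.symm.toLinearMap ∘ₗ ρ)
    (LinearMap.ext fun x => E.symm_apply_apply x)

namespace IsSyzygy

theorem exists_equiv (h : IsSyzygy R M N) (h' : IsSyzygy R M' N') (e : M ≃ₗ[R] M') :
    Nonempty (N ≃ₗ[R] N') := by
  obtain ⟨P, π, hπ, ⟨f⟩⟩ := isSyzygy_iff.1 h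
  obtain ⟨P', π', hπ', ⟨f'⟩⟩ := isSyzygy_iff.1 h'
  obtain ⟨E, hE⟩ := hπ.exists_equiv hπ' e
  refine ⟨f.trans ((E.submoduleMap (LinearMap.ker π)).trans
    ((LinearEquiv.ofEq _ _ ?_).trans f'.symm))⟩
  ext y
  simp only [Submodule.mem_map, LinearMap.mem_ker]
  constructor
  · rintro ⟨x, hx, rfl⟩
    exact (hE x).trans (by rw [hx, map_zero])
  · intro hy
    refine ⟨E.symm y, e.injective ?_, E.apply_symm_apply y⟩
    rw [← hE, E.apply_symm_apply, hy, map_zero]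

theorem of_equiv (h : IsSyzygy R M N) (e : M ≃ₗ[R] M') (f : N' ≃ₗ[R] N) :
    IsSyzygy R M' N' := by
  obtain ⟨P, π, hπ, ⟨g⟩⟩ := isSyzygy_iff.1 h
  refine isSyzygy_iff.2 ⟨P, e.toLinearMap ∘ₗ π, hπ.comp_equiv e,
    ⟨f.trans (g.trans (LinearEquiv.ofEq _ _ ?_))⟩⟩
  rw [LinearEquiv.ker_comp]

theorem prod (h : IsSyzygy R M N) (h' : IsSyzygy R M' N') :
    IsSyzygy R (M × M') (N × N') := by
  obtain ⟨P, π, hπ, ⟨f⟩⟩ := isSyzygy_iff.1 h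
  obtain ⟨P', π', hπ', ⟨f'⟩⟩ := isSyzygy_iff.1 h'
  let g : (LinearMap.ker π × LinearMap.ker π') ≃ₗ[R] LinearMap.ker (π.prodMap π') :=
    { toFun := fun x => ⟨(x.1, x.2), Prod.ext x.1.2 x.2.2⟩
      map_add' := fun _ _ => rfl
      map_smul' := fun _ _ => rfl
      invFun := fun x => (⟨x.1.1, congrArg Prod.fst x.2⟩, ⟨x.1.2, congrArg Prod.snd x.2⟩)
      left_inv := fun _ => rfl
      right_inv := fun _ => rfl }
  exact isSyzygy_iff.2 ⟨ModuleCat.of R (P × P'), π.prodMap π', hπ.prod hπ',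
    ⟨(f.prodCongr f').trans g⟩⟩

theorem of_subsingleton [Subsingleton M] [Subsingleton N] : IsSyzygy R M N := by
  let π : N →ₗ[R] M := 0
  refine isSyzygy_iff.2 ⟨ModuleCat.of R N, π, ⟨?_, fun x => ⟨0, Subsingleton.elim _ _⟩,
    fun U _ => ?_⟩, ⟨LinearEquiv.ofBijective (0 : N →ₗ[R] LinearMap.ker π)
      ⟨Function.injective_of_subsingleton _, fun x => ⟨0, Subsingleton.elim _ _⟩⟩⟩⟩
  · exact Module.Projective.of_free
  · exact eq_top_iff.2 fun x _ => by
      rw [Subsingleton.elim x 0]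
      exact U.zero_mem

theorem pi {m : ℕ} {F G : Fin m → Type u} [∀ i, AddCommGroup (F i)] [∀ i, Module R (F i)]
    [∀ i, AddCommGroup (G i)] [∀ i, Module R (G i)] (h : ∀ i, IsSyzygy R (F i) (G i)) :
    IsSyzygy R (∀ i, F i) (∀ i, G i) := by
  induction m with
  | zero => exact of_subsingleton
  | succ m ih =>
    exact ((h 0).prod (ih fun i => h i.succ)).of_equiv (Fin.consLinearEquiv R F)
      (Fin.consLinearEquiv R G).symm

theorem finite [IsNoetherianRing R] (h : IsSyzygy R M N) [Module.Finite R M] :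
    Module.Finite R N := by
  obtain ⟨P, π, hπ, ⟨f⟩⟩ := isSyzygy_iff.1 h
  have := hπ.finite
  exact Module.Finite.equiv f.symm

end IsSyzygy

theorem exists_isSyzygy [IsArtinianRing R] (M : Type u) [AddCommGroup M] [Module R M]
    [Module.Finite R M] : ∃ N : ModuleCat.{u} R, IsSyzygy R M N := by
  obtain ⟨P, π, h⟩ := exists_isProjectiveCover (R := R) M
  exact ⟨ModuleCat.of R (LinearMap.ker π), h.isSyzygy⟩

/-- Syzygies of direct summands are direct summands of syzygies, as the complement has a syzygy
too. -/
theorem IsSyzygy.isDirectSummand [IsArtinianRing R] [Module.Finite R M'] (h : IsSyzygy R M N)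
    (h' : IsSyzygy R M' N') (hM : IsDirectSummand R M M') : IsDirectSummand R N N' := by
  obtain ⟨L, ⟨e⟩⟩ := hM
  have : Module.Finite R L := (IsDirectSummand.snd.trans (.of_equiv e)).finite
  obtain ⟨L', hL⟩ := exists_isSyzygy (R := R) L
  exact ⟨L', (h.prod hL).exists_equiv h' e⟩

namespace IsNthSyzygy

variable {X X' Y Y' : ModuleCat.{u} R} {n : ℕ}

theorem exists_equiv (h : IsNthSyzygy R n X Y) (h' : IsNthSyzygy R n X' Y') (e : X ≃ₗ[R] X') :
    Nonempty (Y ≃ₗ[R] Y') := by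
  induction n generalizing X X' with
  | zero =>
    obtain ⟨f⟩ := h
    obtain ⟨f'⟩ := h'
    exact ⟨f.trans (e.trans f'.symm)⟩
  | succ n ih =>
    obtain ⟨L, hL, h⟩ := h
    obtain ⟨L', hL', h'⟩ := h'
    obtain ⟨f⟩ := hL.exists_equiv hL' e
    exact ih h h' f

theorem of_equiv_left (h : IsNthSyzygy R n X Y) (e : X ≃ₗ[R] X') : IsNthSyzygy R n X' Y := by
  cases n with
  | zero =>
    obtain ⟨f⟩ := h
    exact ⟨f.trans e⟩
  | succ n =>
    obtain ⟨L, hL, h⟩ := h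
    exact ⟨L, hL.of_equiv e (LinearEquiv.refl R L), h⟩

theorem of_equiv_right (h : IsNthSyzygy R n X Y) (e : Y' ≃ₗ[R] Y) : IsNthSyzygy R n X Y' := by
  induction n generalizing X with
  | zero =>
    obtain ⟨f⟩ := h
    exact ⟨e.trans f⟩
  | succ n ih =>
    obtain ⟨L, hL, h⟩ := h
    exact ⟨L, hL, ih h⟩

theorem prod (h : IsNthSyzygy R n X Y) (h' : IsNthSyzygy R n X' Y') :
    IsNthSyzygy R n (ModuleCat.of R (X × X')) (ModuleCat.of R (Y × Y')) := by
  induction n generalizing X X' with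
  | zero =>
    obtain ⟨f⟩ := h
    obtain ⟨f'⟩ := h'
    exact ⟨f.prodCongr f'⟩
  | succ n ih =>
    obtain ⟨L, hL, h⟩ := h
    obtain ⟨L', hL', h'⟩ := h'
    exact ⟨ModuleCat.of R (L × L'), hL.prod hL', ih h h'⟩

theorem pi {m : ℕ} {F G : Fin m → ModuleCat.{u} R} (h : ∀ i, IsNthSyzygy R n (F i) (G i)) :
    IsNthSyzygy R n (ModuleCat.of R (∀ i, F i)) (ModuleCat.of R (∀ i, G i)) := by
  induction n generalizing F with
  | zero =>
    have h (i : Fin m) : Nonempty (G i ≃ₗ[R] F i) := h i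
    exact ⟨LinearEquiv.piCongrRight fun i => (h i).some⟩
  | succ n ih =>
    choose L hL h using h
    exact ⟨ModuleCat.of R (∀ i, L i), IsSyzygy.pi hL, ih h⟩

theorem finite [IsNoetherianRing R] (h : IsNthSyzygy R n X Y) [Module.Finite R X] :
    Module.Finite R Y := by
  induction n generalizing X with
  | zero =>
    obtain ⟨f⟩ := h
    exact Module.Finite.equiv f.symm
  | succ n ih =>
    obtain ⟨L, hL, h⟩ := h
    have := hL.finite
    exact ih h

theorem isDirectSummand [IsArtinianRing R] [Module.Finite R X'] (h : IsNthSyzygy R n X Y)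
    (h' : IsNthSyzygy R n X' Y') (hX : IsDirectSummand R X X') : IsDirectSummand R Y Y' := by
  induction n generalizing X X' with
  | zero =>
    obtain ⟨f⟩ := h
    obtain ⟨f'⟩ := h'
    exact (IsDirectSummand.of_equiv f).trans (hX.trans (.of_equiv f'.symm))
  | succ n ih =>
    obtain ⟨L, hL, h⟩ := h
    obtain ⟨L', hL', h'⟩ := h'
    have := hL'.finite
    exact ih h h' (hL.isDirectSummand hL' hX)

end IsNthSyzygy

theorem exists_isNthSyzygy [IsArtinianRing R] (n : ℕ) (X : ModuleCat.{u} R)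
    [Module.Finite R X] : ∃ Y : ModuleCat.{u} R, IsNthSyzygy R n X Y := by
  induction n generalizing X with
  | zero => exact ⟨X, ⟨LinearEquiv.refl R X⟩⟩
  | succ n ih =>
    obtain ⟨L, hL⟩ := exists_isSyzygy (R := R) X
    have := hL.finite
    obtain ⟨Y, hY⟩ := ih L
    exact ⟨Y, L, hL, hY⟩

end Syzygies

/-! ### Decomposition into indecomposable modules -/

section KrullSchmidt

variable {R : Type u} [Ring R]

section Indecomposable

variable {N : Type u} [AddCommGroup N] [Module R N]

/-- Fitting's lemma: an endomorphism of an indecomposable module of finite length is invertible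
or nilpotent. -/
theorem IsIndecomposableModule.isUnit_or_isNilpotent [IsArtinian R N] [IsNoetherian R N]
    (hN : IsIndecomposableModule R N) (f : Module.End R N) : IsUnit f ∨ IsNilpotent f := by
  obtain ⟨n, hn⟩ := Filter.eventually_atTop.1 f.eventually_isCompl_ker_pow_range_pow
  have hc := hn (n + 1) n.le_succ
  rcases hN.2 _ _ hc with h | h
  · left
    refine (isUnit_pow_iff n.succ_ne_zero).1 ((Module.End.isUnit_iff _).2
      ⟨LinearMap.ker_eq_bot.1 h, LinearMap.range_eq_top.1 ?_⟩)
    simpa [h] using hc.sup_eq_top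
  · exact Or.inr ⟨n + 1, LinearMap.range_eq_bot.1 h⟩

theorem IsIndecomposableModule.isLocalRing [IsArtinian R N] [IsNoetherian R N]
    (hN : IsIndecomposableModule R N) : IsLocalRing (Module.End R N) := by
  have := hN.1
  refine ⟨fun {a b} h => ?_⟩
  rcases hN.isUnit_or_isNilpotent a with ha | ha
  · exact Or.inl ha
  · rw [eq_sub_of_add_eq' h]
    exact Or.inr ha.isUnit_one_sub

/-- A nonzero direct summand of an indecomposable module is the whole module. -/
theorem IsIndecomposableModule.equiv_of_isDirectSummand {M : Type u} [AddCommGroup M]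
    [Module R M] (hM : IsIndecomposableModule R M) [Nontrivial N]
    (h : IsDirectSummand R N M) : Nonempty (N ≃ₗ[R] M) := by
  obtain ⟨i, p, h⟩ := isDirectSummand_iff_retract.1 h
  have hc : IsCompl (LinearMap.range i) (LinearMap.ker p) := by
    refine IsCompl.of_eq ?_ ?_
    · refine (Submodule.eq_bot_iff _).2 ?_
      rintro _ ⟨⟨x, rfl⟩, hx⟩
      rw [← h x, LinearMap.mem_ker.1 hx, map_zero]
    · refine eq_top_iff.2 fun y _ => Submodule.mem_sup.2
        ⟨i (p y), ⟨_, rfl⟩, y - i (p y), ?_, by abel⟩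
      rw [LinearMap.mem_ker, map_sub, h, sub_self]
  rcases hM.2 _ _ hc with h₁ | h₁
  · obtain ⟨x, hx⟩ := exists_ne (0 : N)
    exact absurd (by rw [← h x, LinearMap.range_eq_bot.1 h₁]; simp) hx
  · exact ⟨LinearEquiv.ofBijective i ⟨fun x y hxy => by rw [← h x, hxy, h],
      LinearMap.range_eq_top.1 (by simpa [h₁] using hc.sup_eq_top)⟩⟩

/-- A module with local endomorphism ring that is a summand of a finite direct sum is a summand
of one of the terms. -/
theorem IsDirectSummand.exists_of_pi [IsLocalRing (Module.End R N)] {m : ℕ}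
    {F : Fin m → Type u} [∀ i, AddCommGroup (F i)] [∀ i, Module R (F i)]
    (h : IsDirectSummand R N (∀ i, F i)) : ∃ i, IsDirectSummand R N (F i) := by
  obtain ⟨i, p, h⟩ := isDirectSummand_iff_retract.1 h
  have hsum :
      ∑ j, (p ∘ₗ LinearMap.single R F j ∘ₗ LinearMap.proj j ∘ₗ i : Module.End R N) = 1 := by
    ext x
    rw [LinearMap.sum_apply]
    simp only [LinearMap.comp_apply, LinearMap.proj_apply, LinearMap.single_apply, ← map_sum]
    rw [Finset.univ_sum_single, h]
    rfl
  obtain ⟨j, -, u, hu⟩ := IsLocalRing.exists_of_isUnit_sum (hsum ▸ isUnit_one)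
  refine ⟨j, .of_retract (LinearMap.proj j ∘ₗ i)
    ((↑u⁻¹ : Module.End R N) ∘ₗ p ∘ₗ LinearMap.single R F j) fun x => ?_⟩
  have : (↑u⁻¹ * ↑u : Module.End R N) x = x := by rw [Units.inv_mul]; rfl
  rwa [hu] at this

theorem IsIndecomposableModule.of_isSimpleModule [IsSimpleModule R N] :
    IsIndecomposableModule R N := by
  refine ⟨IsSimpleModule.nontrivial R N, fun U W h => ?_⟩
  rcases eq_bot_or_eq_top U with hU | hU
  · exact Or.inl hU
  · right
    simpa [hU] using h.inf_eq_bot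

theorem IsIndecomposableModule.isSimpleModule [IsSemisimpleModule R N]
    (hN : IsIndecomposableModule R N) : IsSimpleModule R N := by
  have := hN.1
  refine { eq_bot_or_eq_top := fun U => ?_ }
  obtain ⟨W, h⟩ := exists_isCompl U
  refine (hN.2 _ _ h).imp id fun hW => ?_
  simpa [hW] using h.sup_eq_top

end Indecomposable

/-- An Artinian module is a finite direct sum of indecomposable modules. -/
theorem memAdd_indecomposable (M : Type u) [AddCommGroup M] [Module R M] [IsArtinian R M] :
    MemAdd R (fun X => IsIndecomposableModule R X ∧ IsDirectSummand R X M) M := by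
  suffices H : ∀ U : Submodule R M,
      MemAdd R (fun X => IsIndecomposableModule R X ∧ IsDirectSummand R X U) U by
    refine MemAdd.of_equiv (MemAdd.trans (fun X hX => ?_) (H ⊤)) Submodule.topEquiv.symm
    exact MemAdd.of_mem ⟨hX.1, hX.2.trans (.of_equiv Submodule.topEquiv)⟩
  intro U
  induction U using IsArtinian.induction with
  | hgt U ih =>
    by_cases hU : Subsingleton U
    · exact MemAdd.of_subsingleton
    by_cases hU' : IsIndecomposableModule R U
    · exact MemAdd.of_mem (X := ModuleCat.of R U) ⟨hU', .refl R U⟩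
    rw [IsIndecomposableModule, not_and] at hU'
    push Not at hU'
    obtain ⟨V, W, hc, hV, hW⟩ := hU' (not_subsingleton_iff_nontrivial.1 hU)
    have key (V W : Submodule R U) (hc : IsCompl V W) (hW : W ≠ ⊥) :
        MemAdd R (fun X => IsIndecomposableModule R X ∧ IsDirectSummand R X U) V := by
      have e := Submodule.equivMapOfInjective U.subtype U.injective_subtype V
      have hlt : V.map U.subtype < U := by
        refine lt_of_le_of_ne (Submodule.map_subtype_le U V) fun h => hW ?_
        have : V = ⊤ := eq_top_iff.2 fun x _ => by
          have hx : (x : M) ∈ V.map U.subtype := by rw [h]; exact x.2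
          obtain ⟨y, hy, hxy⟩ := hx
          rwa [← Subtype.ext hxy]
        simpa [this] using hc.inf_eq_bot
      refine MemAdd.of_equiv (MemAdd.trans (fun X hX => MemAdd.of_mem ⟨hX.1, ?_⟩) (ih _ hlt)) e
      refine hX.2.trans ((IsDirectSummand.of_equiv e.symm).trans ?_)
      exact IsDirectSummand.fst.trans (.of_equiv (Submodule.prodEquivOfIsCompl V W hc))
    exact ((key V W hc hW).prod (key W V hc.symm hV)).of_equiv
      (Submodule.prodEquivOfIsCompl V W hc).symm

/-- Up to isomorphism, a module has only finitely many indecomposable direct summands. -/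
theorem exists_finite_indecomposable_summands [IsArtinianRing R] (M : Type u) [AddCommGroup M]
    [Module R M] [Module.Finite R M] :
    ∃ T : Set (ModuleCat.{u} R), T.Finite ∧ (∀ X ∈ T, IsDirectSummand R X M) ∧
      ∀ N : ModuleCat.{u} R, IsIndecomposableModule R N → IsDirectSummand R N M →
        ∃ X ∈ T, Nonempty (N ≃ₗ[R] X) := by
  obtain ⟨m, F, hF, hM⟩ := memAdd_indecomposable (R := R) M
  refine ⟨Set.range F, Set.finite_range F, by rintro _ ⟨i, rfl⟩; exact (hF i).2,
    fun N hN hNM => ?_⟩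
  have := hNM.finite
  have := hN.isLocalRing
  obtain ⟨i, hi⟩ := (hNM.trans hM).exists_of_pi
  have := hN.1
  exact ⟨F i, ⟨i, rfl⟩, (hF i).1.equiv_of_isDirectSummand hi⟩

/-- A property of elements that, up to an equivalence relation, only occurs in a finite set has
a finite list of pairwise inequivalent representatives. -/
theorem exists_finite_representatives {α : Type*} (r : Setoid α) (P : α → Prop) (T : Set α)
    (hT : T.Finite) (h : ∀ a, P a → ∃ t ∈ T, r a t) :
    ∃ (m : ℕ) (O : Fin m → α), (∀ i, P (O i)) ∧ (∀ i j, r (O i) (O j) → i = j) ∧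
      ∀ a, P a → ∃ i, r a (O i) := by
  let S : Set (Quotient r) := Quotient.mk r '' {a | P a}
  have hS : S.Finite := by
    refine (hT.image (Quotient.mk r)).subset ?_
    rintro _ ⟨a, ha, rfl⟩
    obtain ⟨t, ht, hat⟩ := h a ha
    exact ⟨t, ht, Quotient.sound (r.symm hat)⟩
  have := hS.to_subtype
  obtain ⟨m, ⟨e⟩⟩ := Finite.exists_equiv_fin S
  have hc (i : Fin m) : ∃ a, P a ∧ Quotient.mk r a = e.symm i := (e.symm i).2
  choose O hO hO' using hc
  refine ⟨m, O, hO, fun i j hij => ?_, fun a ha => ?_⟩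
  · refine e.symm.injective (Subtype.ext ?_)
    rw [← hO', ← hO']
    exact Quotient.sound hij
  · refine ⟨e ⟨_, a, ha, rfl⟩, Quotient.exact ?_⟩
    rw [hO', e.symm_apply_apply]

/-! ### Multiplicities of indecomposable modules -/

section Multiplicity

variable (k : Type u) [Field k] [Algebra k R]
variable (N M M' M'' : Type u) [AddCommGroup N] [Module R N] [AddCommGroup M] [Module R M]
  [AddCommGroup M'] [Module R M'] [AddCommGroup M''] [Module R M'']
  [Module k N] [IsScalarTower k R N] [Module k M] [IsScalarTower k R M]
  [Module k M'] [IsScalarTower k R M'] [Module k M''] [IsScalarTower k R M'']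

/-- The radical morphisms `N → M`, for `N` with local endomorphism ring: those which are not split
monomorphisms. -/
def radicalHom [IsLocalRing (Module.End R N)] : Submodule k (N →ₗ[R] M) where
  carrier := {f | ∀ g : M →ₗ[R] N, ¬ IsUnit (g ∘ₗ f : Module.End R N)}
  zero_mem' g := by
    rw [LinearMap.comp_zero]
    exact not_isUnit_zero
  add_mem' {f f'} hf hf' g := by
    rw [LinearMap.comp_add]
    exact IsLocalRing.nonunits_add (hf g) (hf' g)
  smul_mem' c f hf g := by
    have : (g ∘ₗ (c • f) : Module.End R N) = (c • g) ∘ₗ f := by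
      ext x
      simp [LinearMap.map_smul_of_tower]
    rw [this]
    exact hf _

variable {M M' M''} in
theorem radicalHom_prod [IsLocalRing (Module.End R N)] (e : M ≃ₗ[R] M' × M'')
    (f : N →ₗ[R] M) : f ∈ radicalHom k N M ↔
      (LinearMap.fst R M' M'' ∘ₗ e.toLinearMap) ∘ₗ f ∈ radicalHom k N M' ∧
      (LinearMap.snd R M' M'' ∘ₗ e.toLinearMap) ∘ₗ f ∈ radicalHom k N M'' := by
  constructor
  · intro hf
    exact ⟨fun g => hf (g ∘ₗ LinearMap.fst R M' M'' ∘ₗ e.toLinearMap),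
      fun g => hf (g ∘ₗ LinearMap.snd R M' M'' ∘ₗ e.toLinearMap)⟩
  · rintro ⟨h₁, h₂⟩ g
    have := IsLocalRing.nonunits_add (h₁ (g ∘ₗ e.symm.toLinearMap ∘ₗ LinearMap.inl R M' M''))
      (h₂ (g ∘ₗ e.symm.toLinearMap ∘ₗ LinearMap.inr R M' M''))
    have hg : (g ∘ₗ f : Module.End R N) =
        (g ∘ₗ e.symm.toLinearMap ∘ₗ LinearMap.inl R M' M'') ∘ₗ
          (LinearMap.fst R M' M'' ∘ₗ e.toLinearMap) ∘ₗ f +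
        (g ∘ₗ e.symm.toLinearMap ∘ₗ LinearMap.inr R M' M'') ∘ₗ
          (LinearMap.snd R M' M'' ∘ₗ e.toLinearMap) ∘ₗ f := by
      refine LinearMap.ext fun x => ?_
      change g (f x) = g (e.symm ((e (f x)).1, 0)) + g (e.symm (0, (e (f x)).2))
      rw [← map_add, ← map_add, Prod.mk_add_mk, add_zero, zero_add, Prod.mk.eta,
        e.symm_apply_apply]
    rw [hg]
    exact this

/-- The multiplicity of `N` in `M`, up to the constant factor `dim (End N / rad End N)`. -/
noncomputable def summandMultiplicity [IsLocalRing (Module.End R N)] : ℕ :=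
  Module.finrank k ((N →ₗ[R] M) ⧸ radicalHom k N M)

theorem finite_linearMap [Module.Finite k R] [Module.Finite R N] [Module.Finite R M] :
    Module.Finite k (N →ₗ[R] M) := by
  have := Module.Finite.trans (R := k) R N
  have := Module.Finite.trans (R := k) R M
  exact Module.Finite.of_injective (LinearMap.restrictScalarsₗ k R N M k)
    (LinearMap.restrictScalars_injective k)

variable {M M' M''} in
theorem summandMultiplicity_prod [Module.Finite k R] [Module.Finite R N] [Module.Finite R M']
    [Module.Finite R M''] [IsLocalRing (Module.End R N)] (e : M ≃ₗ[R] M' × M'') :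
    summandMultiplicity (R := R) k N M =
      summandMultiplicity (R := R) k N M' + summandMultiplicity (R := R) k N M'' := by
  have := finite_linearMap (R := R) k N M'
  have := finite_linearMap (R := R) k N M''
  let c₁ : (N →ₗ[R] M) →ₗ[k] (N →ₗ[R] M') :=
    LinearMap.compRight k (LinearMap.fst R M' M'' ∘ₗ e.toLinearMap)
  let c₂ : (N →ₗ[R] M) →ₗ[k] (N →ₗ[R] M'') :=
    LinearMap.compRight k (LinearMap.snd R M' M'' ∘ₗ e.toLinearMap)
  let T := ((radicalHom (R := R) k N M').mkQ ∘ₗ c₁).prod ((radicalHom (R := R) k N M'').mkQ ∘ₗ c₂)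
  have hT : LinearMap.ker T = radicalHom k N M := by
    ext f
    rw [radicalHom_prod k N e]
    simp only [T, LinearMap.ker_prod, Submodule.mem_inf, LinearMap.mem_ker, LinearMap.comp_apply,
      Submodule.mkQ_apply, Submodule.Quotient.mk_eq_zero]
    rfl
  have hs : Function.Surjective T := by
    rintro ⟨x, y⟩
    obtain ⟨f, rfl⟩ := Submodule.mkQ_surjective _ x
    obtain ⟨g, rfl⟩ := Submodule.mkQ_surjective _ y
    have h₁ : c₁ (e.symm.toLinearMap ∘ₗ f.prod g) = f := LinearMap.ext fun x => by
      change (e (e.symm (f x, g x))).1 = f x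
      rw [e.apply_symm_apply]
    have h₂ : c₂ (e.symm.toLinearMap ∘ₗ f.prod g) = g := LinearMap.ext fun x => by
      change (e (e.symm (f x, g x))).2 = g x
      rw [e.apply_symm_apply]
    exact ⟨e.symm.toLinearMap ∘ₗ f.prod g, Prod.ext
      (congrArg (radicalHom (R := R) k N M').mkQ h₁) (congrArg (radicalHom (R := R) k N M'').mkQ h₂)⟩
  have := (T.quotKerEquivOfSurjective hs).finrank_eq
  rwa [hT, Module.finrank_prod] at this

variable {N M} in
theorem isDirectSummand_of_summandMultiplicity_ne_zero [IsLocalRing (Module.End R N)]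
    (h : summandMultiplicity (R := R) k N M ≠ 0) : IsDirectSummand R N M := by
  have : radicalHom (R := R) k N M ≠ ⊤ := fun ht => h <| by
    have : Subsingleton ((N →ₗ[R] M) ⧸ radicalHom k N M) :=
      Submodule.Quotient.subsingleton_iff.2 ht
    exact Module.finrank_zero_of_subsingleton
  obtain ⟨f, -, hf⟩ := SetLike.exists_of_lt (lt_top_iff_ne_top.2 this)
  have hf' : ¬ ∀ g : M →ₗ[R] N, ¬ IsUnit (g ∘ₗ f : Module.End R N) := hf
  push Not at hf'
  obtain ⟨g, u, hu⟩ := hf'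
  refine .of_retract f ((↑u⁻¹ : Module.End R N) ∘ₗ g) fun x => ?_
  have : (↑u⁻¹ * ↑u : Module.End R N) x = x := by rw [Units.inv_mul]; rfl
  rwa [hu] at this

theorem summandMultiplicity_self_ne_zero [Module.Finite k R] [Module.Finite R N]
    [IsLocalRing (Module.End R N)] : summandMultiplicity (R := R) k N N ≠ 0 := by
  have := finite_linearMap (R := R) k N N
  have : Nontrivial ((N →ₗ[R] N) ⧸ radicalHom (R := R) k N N) := by
    rw [Submodule.Quotient.nontrivial_iff]
    intro h
    have : LinearMap.id ∈ radicalHom (R := R) k N N := by rw [h]; trivial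
    exact this LinearMap.id isUnit_one
  exact Module.finrank_pos.ne'

end Multiplicity

/-- A nonprojective indecomposable module `N` is detected by a homomorphism on `K₀`: the
multiplicity of `N`, which vanishes on the modules that do not have `N` as a summand. -/
theorem exists_multiplicity_hom (k : Type u) [Field k] [Algebra k R] [Module.Finite k R]
    [IsArtinianRing R] (N : FGModuleCat.{u} R) (hN : IsIndecomposableModule R N)
    (hN' : ¬ Module.Projective R N) :
    ∃ φ : SyzygyK0 R →+ ℤ, φ (SyzygyK0.mk R N) ≠ 0 ∧
      ∀ M : FGModuleCat.{u} R, φ (SyzygyK0.mk R M) ≠ 0 → IsDirectSummand R N M := by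
  have := hN.isLocalRing
  let inst (M : FGModuleCat.{u} R) : Module k M := Module.compHom M (algebraMap k R)
  have tower (M : FGModuleCat.{u} R) : IsScalarTower k R M :=
    ⟨fun c r m => by rw [Algebra.smul_def, mul_smul]; rfl⟩
  let φ₀ : FreeAbelianGroup (FGModuleCat.{u} R) →+ ℤ :=
    FreeAbelianGroup.lift fun M => (summandMultiplicity (R := R) k N M : ℤ)
  have hφ₀ (M : FGModuleCat.{u} R) :
      φ₀ (FreeAbelianGroup.of M) = summandMultiplicity (R := R) k N M :=
    FreeAbelianGroup.lift_apply_of _ _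
  have hrel : AddSubgroup.closure (syzygyK0Relations R) ≤ φ₀.ker := by
    rw [AddSubgroup.closure_le]
    rintro x (⟨M, M', M'', ⟨e⟩, rfl⟩ | ⟨P, hP, rfl⟩)
    · change φ₀ _ = 0
      rw [map_sub, map_sub, hφ₀, hφ₀, hφ₀, summandMultiplicity_prod k N e]
      push_cast
      ring
    · change φ₀ _ = 0
      rw [hφ₀, Nat.cast_eq_zero]
      by_contra h
      exact hN' (isDirectSummand_of_summandMultiplicity_ne_zero k h).projective
  refine ⟨QuotientAddGroup.lift _ φ₀ hrel, ?_, fun M hM => ?_⟩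
  · change φ₀ _ ≠ 0
    rw [hφ₀, Nat.cast_ne_zero]
    exact summandMultiplicity_self_ne_zero k N
  · change φ₀ _ ≠ 0 at hM
    rw [hφ₀, Nat.cast_ne_zero] at hM
    exact isDirectSummand_of_summandMultiplicity_ne_zero k hM

/-- A finitely generated subgroup of `K₀` only involves finitely many modules. -/
theorem exists_finite_support (G : AddSubgroup (SyzygyK0 R)) (hG : G.FG) :
    ∃ T : Set (FGModuleCat.{u} R), T.Finite ∧ ∀ φ : SyzygyK0 R →+ ℤ,
      (∀ M ∈ T, φ (SyzygyK0.mk R M) = 0) → ∀ x ∈ G, φ x = 0 := by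
  have h₁ (x : FreeAbelianGroup (FGModuleCat.{u} R)) : ∃ T : Set (FGModuleCat.{u} R), T.Finite ∧
      ∀ φ : SyzygyK0 R →+ ℤ, (∀ M ∈ T, φ (SyzygyK0.mk R M) = 0) →
        φ (QuotientAddGroup.mk x) = 0 := by
    induction x using FreeAbelianGroup.induction_on with
    | zero => exact ⟨∅, Set.finite_empty, fun φ _ => map_zero φ⟩
    | of M => exact ⟨{M}, Set.finite_singleton M, fun φ h => h M rfl⟩
    | neg M ih =>
      obtain ⟨T, hT, h⟩ := ih
      exact ⟨T, hT, fun φ hφ => by rw [QuotientAddGroup.mk_neg, map_neg, h φ hφ, neg_zero]⟩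
    | add x y hx hy =>
      obtain ⟨T, hT, h⟩ := hx
      obtain ⟨T', hT', h'⟩ := hy
      exact ⟨T ∪ T', hT.union hT', fun φ hφ => by
        rw [QuotientAddGroup.mk_add, map_add, h φ fun M hM => hφ M (Or.inl hM),
          h' φ fun M hM => hφ M (Or.inr hM), add_zero]⟩
  obtain ⟨S, rfl⟩ := hG
  have h₂ (x : SyzygyK0 R) : ∃ T : Set (FGModuleCat.{u} R), T.Finite ∧
      ∀ φ : SyzygyK0 R →+ ℤ, (∀ M ∈ T, φ (SyzygyK0.mk R M) = 0) → φ x = 0 := by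
    obtain ⟨y, rfl⟩ := QuotientAddGroup.mk_surjective x
    exact h₁ y
  choose T hT h using h₂
  refine ⟨⋃ x ∈ S, T x, S.finite_toSet.biUnion fun x _ => hT x, fun φ hφ => ?_⟩
  change AddSubgroup.closure (S : Set (SyzygyK0 R)) ≤ φ.ker
  rw [AddSubgroup.closure_le]
  exact fun x hx => h x φ fun M hM => hφ M (Set.mem_biUnion hx hM)

/-- Up to isomorphism, only finitely many indecomposable modules have their class in a given
finitely generated subgroup of `K₀`. -/
theorem exists_finite_indecomposables_of_fg (k : Type u) [Field k] [Algebra k R]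
    [Module.Finite k R] [IsArtinianRing R] (G : AddSubgroup (SyzygyK0 R)) (hG : G.FG) :
    ∃ (m : ℕ) (O : Fin m → FGModuleCat.{u} R),
      (∀ i, IsIndecomposableModule R (O i) ∧ SyzygyK0.mk R (O i) ∈ G) ∧
      (∀ i j, Nonempty (O i ≃ₗ[R] O j) → i = j) ∧
      ∀ N : FGModuleCat.{u} R, IsIndecomposableModule R N → SyzygyK0.mk R N ∈ G →
        ∃ i, Nonempty (N ≃ₗ[R] O i) := by
  obtain ⟨T, hT, hTG⟩ := exists_finite_support G hG
  -- the regular module is added to take care of the projective modules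
  have hT' := hT.insert (FGModuleCat.of R R)
  choose U hU hUs hUN using fun M : FGModuleCat.{u} R =>
    exists_finite_indecomposable_summands (R := R) M
  have key (N : FGModuleCat.{u} R) (hN : IsIndecomposableModule R N)
      (hNG : SyzygyK0.mk R N ∈ G) :
      ∃ M ∈ insert (FGModuleCat.of R R) T, IsDirectSummand R N M := by
    by_cases hP : Module.Projective R N
    · obtain ⟨m, f, hf⟩ := Module.Finite.exists_fin' R N
      obtain ⟨s, hs⟩ := f.exists_rightInverse_of_surjective (LinearMap.range_eq_top.2 hf)
      have := hN.isLocalRing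
      obtain ⟨-, h⟩ := (IsDirectSummand.of_retract s f (LinearMap.congr_fun hs)).exists_of_pi
      exact ⟨_, Set.mem_insert _ _, h⟩
    · obtain ⟨φ, hφ, hφ'⟩ := exists_multiplicity_hom k N hN hP
      by_contra! hc
      refine hφ (hTG φ (fun M hM => ?_) _ hNG)
      by_contra h
      exact hc M (Set.mem_insert_of_mem _ hM) (hφ' M h)
  let r : Setoid (FGModuleCat.{u} R) :=
    { r := fun X Y => Nonempty (X ≃ₗ[R] Y)
      iseqv := ⟨fun X => ⟨LinearEquiv.refl R X⟩, fun ⟨e⟩ => ⟨e.symm⟩,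
        fun ⟨e⟩ ⟨f⟩ => ⟨e.trans f⟩⟩ }
  have hfin : {X : FGModuleCat.{u} R |
      ∃ M ∈ insert (FGModuleCat.of R R) T, X.obj ∈ U M}.Finite := by
    refine Set.Finite.subset (Set.Finite.preimage (f := fun X : FGModuleCat.{u} R => X.obj)
      ?_ (hT'.biUnion fun M _ => hU M)) ?_
    · rintro ⟨X, hX⟩ - ⟨Y, hY⟩ - h
      cases h
      rfl
    · rintro X ⟨M, hM, hX⟩
      exact Set.mem_biUnion hM hX
  obtain ⟨m, O, h₁, h₂, h₃⟩ := exists_finite_representatives r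
    (fun N => IsIndecomposableModule R N ∧ SyzygyK0.mk R N ∈ G) _ hfin fun N hN => by
      obtain ⟨M, hM, hNM⟩ := key N hN.1 hN.2
      obtain ⟨X, hX, e⟩ := hUN M N.obj hN.1 hNM
      have := (hUs M X hX).finite
      exact ⟨⟨X, this⟩, ⟨M, hM, hX⟩, e⟩
  exact ⟨m, O, h₁, h₂, fun N hN hNG => h₃ N ⟨hN, hNG⟩⟩

end KrullSchmidt

/-! ### Simple modules and radicals of projective modules -/

section Radical

variable {R : Type u} [Ring R]

/-- A module modulo its radical is semisimple. -/
theorem isSemisimpleModule_quotient_jacobson_smul [IsSemiprimaryRing R] (M : Type u)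
    [AddCommGroup M] [Module R M] :
    IsSemisimpleModule R (M ⧸ (Ring.jacobson R • ⊤ : Submodule R M)) := by
  have h : Module.IsTorsionBySet R (M ⧸ (Ring.jacobson R • ⊤ : Submodule R M))
      (Ring.jacobson R : Set R) := by
    rw [Module.isTorsionBySet_quotient_iff]
    exact fun m i hi => Submodule.smul_mem_smul hi trivial
  let _ := h.module
  exact (h.semilinearMap.isSemisimpleModule_iff_of_bijective Function.bijective_id).2
    inferInstance

/-- The kernel of a projective cover lies in the radical. -/
theorem IsProjectiveCover.ker_le [IsSemiprimaryRing R] {P M : Type u} [AddCommGroup P]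
    [Module R P] [AddCommGroup M] [Module R M] {π : P →ₗ[R] M} (h : IsProjectiveCover π) :
    LinearMap.ker π ≤ Ring.jacobson R • ⊤ := by
  have := isSemisimpleModule_quotient_jacobson_smul (R := R) P
  set q := (Ring.jacobson R • ⊤ : Submodule R P).mkQ
  obtain ⟨W, hW⟩ := exists_isCompl ((LinearMap.ker π).map q)
  have h₁ : W.comap q = ⊤ := by
    refine h.superfluous _ (eq_top_iff.2 fun x _ => ?_)
    have hx : q x ∈ (LinearMap.ker π).map q ⊔ W := by rw [hW.sup_eq_top]; trivial
    obtain ⟨_, ⟨v, hv, rfl⟩, w, hw, hvw⟩ := Submodule.mem_sup.1 hx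
    refine Submodule.mem_sup.2 ⟨x - v, ?_, v, hv, by abel⟩
    rw [Submodule.mem_comap, map_sub, ← hvw, add_sub_cancel_left]
    exact hw
  have h₂ : W = ⊤ := eq_top_iff.2 fun y _ => by
    obtain ⟨x, rfl⟩ := Submodule.mkQ_surjective _ y
    have : x ∈ W.comap q := by rw [h₁]; trivial
    exact this
  have h₃ : (LinearMap.ker π).map q = ⊥ := by simpa [h₂] using hW.inf_eq_bot
  rw [← LinearMap.le_ker_iff_map] at h₃
  simpa [q] using h₃

/-- A finitely generated projective module is the projective cover of its semisimple quotient. -/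
theorem isProjectiveCover_mkQ_jacobson (P : Type u) [AddCommGroup P] [Module R P]
    [Module.Finite R P] [Module.Projective R P] :
    IsProjectiveCover (Ring.jacobson R • ⊤ : Submodule R P).mkQ where
  projective := inferInstance
  surjective := Submodule.mkQ_surjective _
  superfluous U hU := by
    rw [Submodule.ker_mkQ] at hU
    have h : (⊤ : Submodule R (P ⧸ U)) = ⊥ := by
      refine Submodule.FG.eq_bot_of_le_jacobson_smul Module.Finite.fg_top ?_
      have h₀ : U.map U.mkQ = ⊥ := by rw [← LinearMap.le_ker_iff_map, Submodule.ker_mkQ]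
      have := congrArg (Submodule.map U.mkQ) hU
      rw [Submodule.map_sup, Submodule.map_smul'', Submodule.map_top, Submodule.range_mkQ,
        h₀, bot_sup_eq] at this
      exact this.ge
    rw [← U.ker_mkQ, LinearMap.ker_eq_top]
    exact LinearMap.ext fun x => (Submodule.mem_bot R).1 (h ▸ Submodule.mem_top)

theorem exists_isSumOfSimples [IsArtinianRing R] :
    ∃ S : ModuleCat.{u} R, Module.Finite R S ∧ IsSumOfSimples R S := by
  obtain ⟨T, hT, hTs, hTN⟩ :=
    exists_finite_indecomposable_summands (R := R) (R ⧸ (Ring.jacobson R • ⊤ : Submodule R R))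
  let r : Setoid (ModuleCat.{u} R) :=
    { r := fun X Y => Nonempty (X ≃ₗ[R] Y)
      iseqv := ⟨fun X => ⟨LinearEquiv.refl R X⟩, fun ⟨e⟩ => ⟨e.symm⟩,
        fun ⟨e⟩ ⟨f⟩ => ⟨e.trans f⟩⟩ }
  obtain ⟨m, O, h₁, h₂, h₃⟩ := exists_finite_representatives r
    (fun X => IsSimpleModule R X) T hT fun X hX => by
      refine hTN X (IsIndecomposableModule.of_isSimpleModule) ?_
      -- the simple module is a quotient of the semisimple module `R / rad R`, so a summand
      obtain ⟨x, hx⟩ := @exists_ne X (IsSimpleModule.nontrivial R X) 0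
      let f := LinearMap.toSpanSingleton R X x
      have hf := IsSimpleModule.toSpanSingleton_surjective R hx
      have hle : (Ring.jacobson R • ⊤ : Submodule R R) ≤ LinearMap.ker f :=
        (Ring.jacobson_smul_top_le R R).trans (IsSemisimpleModule.jacobson_le_ker _ _ _ _ f)
      have := isSemisimpleModule_quotient_jacobson_smul (R := R) R
      obtain ⟨s, hs⟩ := IsSemisimpleModule.lifting_property (Submodule.liftQ _ f hle)
        (fun y => by
          obtain ⟨r, rfl⟩ := hf y
          exact ⟨Submodule.Quotient.mk r, rfl⟩) LinearMap.id
      exact .of_retract s (Submodule.liftQ _ f hle) (LinearMap.congr_fun hs)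
  have : ∀ i, Module.Finite R (O i) := fun i => by
    have := h₁ i
    infer_instance
  exact ⟨ModuleCat.of R (∀ i, O i), inferInstanceAs (Module.Finite R (∀ i, O i)),
    m, O, h₁, h₂, h₃, ⟨LinearEquiv.refl R _⟩⟩

theorem IsSumOfSimples.finite {S : ModuleCat.{u} R} (hS : IsSumOfSimples R S) :
    Module.Finite R S := by
  obtain ⟨m, T, hT, -, -, ⟨e⟩⟩ := hS
  have : ∀ i, Module.Finite R (T i) := fun i => by
    have := hT i
    infer_instance
  exact Module.Finite.equiv e.symm

/-- If `S` is the sum of the simple modules, every finitely generated semisimple module lies in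
`add S`. -/
theorem IsSumOfSimples.memAdd {S : ModuleCat.{u} R} (hS : IsSumOfSimples R S) [IsArtinianRing R]
    (M : Type u) [AddCommGroup M] [Module R M] [Module.Finite R M] [IsSemisimpleModule R M] :
    MemAdd R (fun X => X = S) M := by
  obtain ⟨m, T, -, -, hT, ⟨e⟩⟩ := hS
  refine MemAdd.trans (fun X hX => ?_) (memAdd_indecomposable (R := R) M)
  obtain ⟨i, p, h⟩ := isDirectSummand_iff_retract.1 hX.2
  have := IsSemisimpleModule.of_injective i (Function.LeftInverse.injective h)
  obtain ⟨j, ⟨f⟩⟩ := hT X hX.1.isSimpleModule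
  exact (MemAdd.of_mem (𝒞 := fun X => X = S) rfl).of_isDirectSummand
    ((IsDirectSummand.of_equiv f).trans ((IsDirectSummand.of_pi j).trans (.of_equiv e.symm)))

end Radical

/-! ### Inflation and restriction -/

section Functors

open MulOpposite

variable {A C : Type u} [Ring A] [Ring C]

section Inflation

variable (r : C →+* A)

/-- Inflation of homomorphisms. -/
def inflateMap {X Y : ModuleCat.{u} Aᵐᵒᵖ} (f : X →ₗ[Aᵐᵒᵖ] Y) :
    inflateModule r X →ₗ[Cᵐᵒᵖ] inflateModule r Y where
  toFun x := f x
  map_add' x y := map_add f x y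
  map_smul' c x := map_smul f (RingHom.op r c) x

theorem MemAdd.inflate {𝒞 : ModuleCat.{u} Aᵐᵒᵖ → Prop} {𝒟 : ModuleCat.{u} Cᵐᵒᵖ → Prop}
    {X : ModuleCat.{u} Aᵐᵒᵖ} (hX : MemAdd Aᵐᵒᵖ 𝒞 X)
    (h : ∀ Y, 𝒞 Y → MemAdd Cᵐᵒᵖ 𝒟 (inflateModule r Y)) : MemAdd Cᵐᵒᵖ 𝒟 (inflateModule r X) := by
  obtain ⟨m, F, hF, hX⟩ := hX
  obtain ⟨i, p, hip⟩ := isDirectSummand_iff_retract.1 hX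
  have h₁ : MemAdd Cᵐᵒᵖ 𝒟 (∀ i, inflateModule r (F i)) := MemAdd.pi fun i => h _ (hF i)
  let e : inflateModule r (ModuleCat.of Aᵐᵒᵖ (∀ i, F i)) ≃ₗ[Cᵐᵒᵖ] ∀ i, inflateModule r (F i) :=
    { toFun := fun x => x
      map_add' := fun _ _ => rfl
      map_smul' := fun _ _ => rfl
      invFun := fun x => x
      left_inv := fun _ => rfl
      right_inv := fun _ => rfl }
  exact (h₁.of_equiv e).of_isDirectSummand
    (.of_retract (inflateMap r (Y := ModuleCat.of Aᵐᵒᵖ (∀ i, F i)) i)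
      (inflateMap r (X := ModuleCat.of Aᵐᵒᵖ (∀ i, F i)) p) hip)

theorem finite_inflateModule_iff (hr : Function.Surjective r) (X : ModuleCat.{u} Aᵐᵒᵖ) :
    Module.Finite Cᵐᵒᵖ (inflateModule r X) ↔ Module.Finite Aᵐᵒᵖ X := by
  have : RingHomSurjective (RingHom.op r) := ⟨fun a => by
    obtain ⟨c, hc⟩ := hr a.unop
    exact ⟨op c, congrArg op hc⟩⟩
  let f : inflateModule r X →ₛₗ[RingHom.op r] X :=
    { toFun := fun x => x
      map_add' := fun _ _ => rfl
      map_smul' := fun _ _ => rfl }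
  exact LinearMap.finite_iff_of_bijective f Function.bijective_id

end Inflation

section Restriction

variable (j : A →ₙ+* C) {M N : Type u} [AddCommGroup M] [Module Cᵐᵒᵖ M]
  [AddCommGroup N] [Module Cᵐᵒᵖ N]

theorem restrictedPart.one_smul_coe (m : restrictedPart j M) : op (j 1) • (m : M) = m := m.2

theorem op_smul_op_smul_eq (c d : C) (m : M) : op c • op d • m = op (d * c) • m := by
  rw [smul_smul, op_mul]

theorem smul_mem_restrictedPart (m : M) : op (j 1) • m ∈ restrictedPart j M := by
  change op (j 1) • op (j 1) • m = op (j 1) • m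
  rw [op_smul_op_smul_eq, ← map_mul, one_mul]

/-- Restriction of homomorphisms. -/
def restrictMap (f : M →ₗ[Cᵐᵒᵖ] N) : restrictedPart j M →ₗ[Aᵐᵒᵖ] restrictedPart j N where
  toFun x := ⟨f x, by
    change op (j 1) • f x = f x
    rw [← map_smul, restrictedPart.one_smul_coe]⟩
  map_add' x y := Subtype.ext (map_add f _ _)
  map_smul' c x := Subtype.ext (map_smul f _ _)

theorem IsDirectSummand.restrict (h : IsDirectSummand Cᵐᵒᵖ M N) :
    IsDirectSummand Aᵐᵒᵖ (restrictedPart j M) (restrictedPart j N) := by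
  obtain ⟨i, p, h⟩ := isDirectSummand_iff_retract.1 h
  exact .of_retract (restrictMap j i) (restrictMap j p) fun x => Subtype.ext (h x)

/-- Restriction commutes with direct sums. -/
def restrictPiEquiv {m : ℕ} (F : Fin m → Type u) [∀ i, AddCommGroup (F i)]
    [∀ i, Module Cᵐᵒᵖ (F i)] :
    restrictedPart j (∀ i, F i) ≃ₗ[Aᵐᵒᵖ] ∀ i, restrictedPart j (F i) where
  toFun x i := ⟨(x : ∀ i, F i) i, congrFun x.2 i⟩
  map_add' _ _ := rfl
  map_smul' _ _ := rfl
  invFun x := ⟨fun i => x i, funext fun i => (x i).2⟩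
  left_inv _ := rfl
  right_inv _ := rfl

end Restriction

end Functors

/-! ### Syzygies over a Morita context algebra -/

section Morita

open MulOpposite

/-- The properties of a Morita context algebra `C` with `A` and `B` on the diagonal that matter for
syzygies: `A = e C e` and `B = f C f` for complementary idempotents `e` and `f`, both are quotients
of `C`, and `rad C * f C e = 0 = rad C * e C f`. -/
structure IsMoritaSplitting {A B C : Type u} [Ring A] [Ring B] [Ring C] (jA : A →ₙ+* C)
    (rA : C →+* A) (jB : B →ₙ+* C) (rB : C →+* B) : Prop where
  rA_jA : ∀ a, rA (jA a) = a
  jA_rA : ∀ c, jA (rA c) = jA 1 * c * jA 1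
  rB_jB : ∀ b, rB (jB b) = b
  jB_rB : ∀ c, jB (rB c) = jB 1 * c * jB 1
  one_add_one : jA 1 + jB 1 = 1
  radA : ∀ y ∈ Ring.jacobson Cᵐᵒᵖ, ∀ c, unop y * jB 1 * c * jA 1 = 0
  radB : ∀ y ∈ Ring.jacobson Cᵐᵒᵖ, ∀ c, unop y * jA 1 * c * jB 1 = 0

namespace IsMoritaSplitting

variable {A B C : Type u} [Ring A] [Ring B] [Ring C] {jA : A →ₙ+* C}
  {rA : C →+* A} {jB : B →ₙ+* C} {rB : C →+* B}

theorem symm (h : IsMoritaSplitting jA rA jB rB) : IsMoritaSplitting jB rB jA rA where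
  rA_jA := h.rB_jB
  jA_rA := h.jB_rB
  rB_jB := h.rA_jA
  jB_rB := h.jA_rA
  one_add_one := by rw [add_comm, h.one_add_one]
  radA := h.radB
  radB := h.radA

theorem rA_surjective (h : IsMoritaSplitting jA rA jB rB) : Function.Surjective rA :=
  fun a => ⟨jA a, h.rA_jA a⟩

theorem rA_jB_one (h : IsMoritaSplitting jA rA jB rB) : rA (jB 1) = 0 := by
  rw [eq_sub_of_add_eq' h.one_add_one, map_sub, map_one, h.rA_jA, sub_self]

section Modules

variable {M : Type u} [AddCommGroup M] [Module Cᵐᵒᵖ M]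

theorem smul_add_smul (h : IsMoritaSplitting jA rA jB rB) (m : M) :
    op (jA 1) • m + op (jB 1) • m = m := by
  rw [← add_smul, ← op_add, h.one_add_one, op_one, one_smul]

/-- If `M f C e = 0`, then `C` acts on `M e` through its quotient `A`. -/
theorem smul_eq (h : IsMoritaSplitting jA rA jB rB)
    (hM : ∀ (c : Cᵐᵒᵖ) (m : M), op (jA 1) • c • op (jB 1) • m = 0) (c : Cᵐᵒᵖ) (m : M) :
    op (jA 1) • c • m = op (jA (rA (unop c))) • op (jA 1) • m := by
  have h₁ : op (jA 1) • c • m = op (jA 1) • c • op (jA 1) • m := by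
    conv_lhs => rw [← h.smul_add_smul m, smul_add, smul_add, hM, add_zero]
  have h₂ : jA 1 * jA 1 = jA 1 := by rw [← map_mul, mul_one]
  rw [h₁, h.jA_rA, ← op_unop c]
  simp only [op_smul_op_smul_eq, unop_op, ← mul_assoc, h₂]

/-- If `M f C e = 0`, then multiplication by `e` is a homomorphism from `M` to the inflation
of `M e`. -/
noncomputable def toInflate (h : IsMoritaSplitting jA rA jB rB)
    (hM : ∀ (c : Cᵐᵒᵖ) (m : M), op (jA 1) • c • op (jB 1) • m = 0) :
    M →ₗ[Cᵐᵒᵖ] inflateModule rA (ModuleCat.of Aᵐᵒᵖ (restrictedPart jA M)) where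
  toFun m := (⟨op (jA 1) • m, smul_mem_restrictedPart jA m⟩ : restrictedPart jA M)
  map_add' m m' := Subtype.ext (smul_add _ m m')
  map_smul' c m := Subtype.ext (h.smul_eq hM c m)

theorem finite_restrictedPart (h : IsMoritaSplitting jA rA jB rB)
    (hM : ∀ (c : Cᵐᵒᵖ) (m : M), op (jA 1) • c • op (jB 1) • m = 0) [Module.Finite Cᵐᵒᵖ M] :
    Module.Finite Aᵐᵒᵖ (restrictedPart jA M) :=
  (finite_inflateModule_iff rA h.rA_surjective (ModuleCat.of Aᵐᵒᵖ (restrictedPart jA M))).1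
    (Module.Finite.of_surjective (h.toInflate hM) fun x => ⟨(x : restrictedPart jA M).1,
      Subtype.ext (x : restrictedPart jA M).2⟩)

/-- If `M f C e = 0` and `M e C f = 0`, then `M` is the direct sum of `M e` and `M f`. -/
noncomputable def splitEquiv (h : IsMoritaSplitting jA rA jB rB)
    (hA : ∀ (c : Cᵐᵒᵖ) (m : M), op (jA 1) • c • op (jB 1) • m = 0)
    (hB : ∀ (c : Cᵐᵒᵖ) (m : M), op (jB 1) • c • op (jA 1) • m = 0) :
    M ≃ₗ[Cᵐᵒᵖ] inflateModule rA (ModuleCat.of Aᵐᵒᵖ (restrictedPart jA M)) ×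
      inflateModule rB (ModuleCat.of Bᵐᵒᵖ (restrictedPart jB M)) where
  __ := (h.toInflate hA).prod (h.symm.toInflate hB)
  invFun x := (x.1 : restrictedPart jA M).1 + (x.2 : restrictedPart jB M).1
  left_inv m := h.smul_add_smul m
  right_inv := by
    rintro ⟨⟨x, hx⟩, ⟨y, hy⟩⟩
    have h₁ : op (jA 1) • y = 0 := by
      have := h.smul_add_smul y
      rwa [show op (jB 1) • y = y from hy, add_eq_right] at this
    have h₂ : op (jB 1) • x = 0 := by
      have := h.smul_add_smul x
      rwa [show op (jA 1) • x = x from hx, add_eq_left] at this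
    refine Prod.ext (Subtype.ext ?_) (Subtype.ext ?_)
    · change op (jA 1) • (x + y) = x
      rw [smul_add, h₁, add_zero, show op (jA 1) • x = x from hx]
    · change op (jB 1) • (x + y) = y
      rw [smul_add, h₂, zero_add, show op (jB 1) • y = y from hy]

/-- A submodule of a radical satisfies the conditions of the splitting. -/
theorem smul_smul_of_le_jacobson (h : IsMoritaSplitting jA rA jB rB) (K : Submodule Cᵐᵒᵖ M)
    (hK : K ≤ Ring.jacobson Cᵐᵒᵖ • ⊤) (c : Cᵐᵒᵖ) (m : K) :
    op (jA 1) • c • op (jB 1) • m = 0 := by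
  refine Subtype.ext ?_
  change op (jA 1) • c • op (jB 1) • (m : M) = 0
  refine Submodule.smul_induction_on (hK m.2) (fun y hy x _ => ?_) fun x y hx hy => ?_
  · rw [smul_smul, smul_smul, smul_smul]
    have : op (jA 1) * (c * (op (jB 1) * y)) = 0 := by
      rw [← unop_inj, unop_mul, unop_mul, unop_mul, unop_op, unop_op, unop_zero,
        ← h.radA y hy (unop c)]
    simp only [mul_assoc, this, zero_smul]
  · rw [smul_add, smul_add, smul_add, hx, hy, add_zero]

end Modules

/-- The idempotent `f` kills the inflations of `A`-modules. -/
theorem smul_inflate (h : IsMoritaSplitting jA rA jB rB) (X : ModuleCat.{u} Aᵐᵒᵖ)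
    (x : inflateModule rA X) : op (jB 1) • x = 0 := by
  have : op (jB 1) • x = (op (rA (jB 1)) • (x : X) : X) := rfl
  rw [this, h.rA_jB_one, op_zero, zero_smul]

/-- On an inflated `A`-module, `jA a` acts as `a`. -/
theorem smul_inflate' (h : IsMoritaSplitting jA rA jB rB) (X : ModuleCat.{u} Aᵐᵒᵖ)
    (a : A) (x : inflateModule rA X) : op (jA a) • x = (op a • (x : X) : X) := by
  have : op (jA a) • x = (op (rA (jA a)) • (x : X) : X) := rfl
  rw [this, h.rA_jA]

section Cover

variable {P : Type u} [AddCommGroup P] [Module Cᵐᵒᵖ P] {X : ModuleCat.{u} Aᵐᵒᵖ}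
  {π : P →ₗ[Cᵐᵒᵖ] inflateModule rA X}

/-- The source `P` of a projective cover of an `A`-module has `P f C e = 0`. -/
theorem smul_smul_of_cover [IsSemiprimaryRing Cᵐᵒᵖ] (h : IsMoritaSplitting jA rA jB rB)
    (hπ : IsProjectiveCover π) (c : Cᵐᵒᵖ) (m : P) :
    op (jA 1) • c • op (jB 1) • m = 0 := by
  have hm : op (jB 1) • m ∈ LinearMap.ker π := by
    rw [LinearMap.mem_ker, map_smul, h.smul_inflate]
  have := h.smul_smul_of_le_jacobson _ hπ.ker_le c ⟨_, hm⟩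
  have h₁ := congrArg Subtype.val this
  change op (jA 1) • c • op (jB 1) • op (jB 1) • m = 0 at h₁
  rwa [op_smul_op_smul_eq (jB 1) (jB 1), ← map_mul, one_mul] at h₁

/-- If `P` is projective over `C` and `P f C e = 0`, then `P e` is projective over `A`. -/
theorem projective_restrictedPart (h : IsMoritaSplitting jA rA jB rB)
    [Module.Projective Cᵐᵒᵖ P]
    (hP : ∀ (c : Cᵐᵒᵖ) (m : P), op (jA 1) • c • op (jB 1) • m = 0) :
    Module.Projective Aᵐᵒᵖ (restrictedPart jA P) := by
  refine Module.Projective.of_lifting_property'' fun g hg => ?_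
  obtain ⟨l, hl⟩ := Module.projective_lifting_property
    (inflateMap rA (X := ModuleCat.of Aᵐᵒᵖ (restrictedPart jA P →₀ Aᵐᵒᵖ))
      (Y := ModuleCat.of Aᵐᵒᵖ (restrictedPart jA P)) g) (h.toInflate hP) hg
  let l' : restrictedPart jA P →ₗ[Aᵐᵒᵖ] (restrictedPart jA P →₀ Aᵐᵒᵖ) :=
    { toFun := fun m => l (m : P)
      map_add' := fun m m' => map_add l (m : P) (m' : P)
      map_smul' := fun a m => by
        refine (map_smul l (op (jA (unop a))) (m : P)).trans ?_
        exact h.smul_inflate' (ModuleCat.of Aᵐᵒᵖ (restrictedPart jA P →₀ Aᵐᵒᵖ)) (unop a) _ }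
  refine ⟨l', LinearMap.ext fun m => Subtype.ext ?_⟩
  have h₁ := congrArg (fun x => (x : restrictedPart jA P).1) (LinearMap.congr_fun hl (m : P))
  exact h₁.trans m.2

/-- The homomorphism `P e → X` induced by a homomorphism from `P` to the inflation of `X`. -/
noncomputable def restrictCover (h : IsMoritaSplitting jA rA jB rB)
    (π : P →ₗ[Cᵐᵒᵖ] inflateModule rA X) :
    restrictedPart jA P →ₗ[Aᵐᵒᵖ] X where
  toFun m := π (m : P)
  map_add' m m' := map_add π (m : P) (m' : P)
  map_smul' a m := (map_smul π (op (jA (unop a))) (m : P)).trans (h.smul_inflate' X (unop a) _)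

/-- If `P` is a projective cover of an `A`-module `X` over `C`, then `P e` is one over `A`. -/
theorem isProjectiveCover_restrictCover [IsSemiprimaryRing Cᵐᵒᵖ]
    (h : IsMoritaSplitting jA rA jB rB) (hπ : IsProjectiveCover π) :
    IsProjectiveCover (h.restrictCover π) where
  projective :=
    have := hπ.projective
    h.projective_restrictedPart (h.smul_smul_of_cover hπ)
  surjective x := by
    obtain ⟨p, hp⟩ := hπ.surjective x
    refine ⟨⟨_, smul_mem_restrictedPart jA p⟩, ?_⟩
    change π (op (jA 1) • p) = x
    rw [map_smul, hp]
    exact (h.smul_inflate' X 1 x).trans (one_smul Aᵐᵒᵖ (x : X))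
  superfluous U hU := by
    -- the elements of `P` whose component in `P e` lies in `U` form a `C`-submodule
    let U' : Submodule Cᵐᵒᵖ P :=
      { carrier := {p | (⟨_, smul_mem_restrictedPart jA p⟩ : restrictedPart jA P) ∈ U}
        zero_mem' := by
          have : (⟨_, smul_mem_restrictedPart jA (0 : P)⟩ : restrictedPart jA P) = 0 :=
            Subtype.ext (smul_zero _)
          exact (congrArg (· ∈ U) this).mpr (U.zero_mem)
        add_mem' := fun {p q} hp hq => by
          have : (⟨_, smul_mem_restrictedPart jA (p + q)⟩ : restrictedPart jA P) =
              ⟨_, smul_mem_restrictedPart jA p⟩ + ⟨_, smul_mem_restrictedPart jA q⟩ :=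
            Subtype.ext (smul_add _ _ _)
          exact (congrArg (· ∈ U) this).mpr (U.add_mem hp hq)
        smul_mem' := fun c p hp => by
          have : (⟨_, smul_mem_restrictedPart jA (c • p)⟩ : restrictedPart jA P) =
              op (rA (unop c)) • ⟨_, smul_mem_restrictedPart jA p⟩ :=
            Subtype.ext (h.smul_eq (h.smul_smul_of_cover hπ) c p)
          exact (congrArg (· ∈ U) this).mpr (U.smul_mem (op (rA (unop c))) hp) }
    have hU' : U' = ⊤ := by
      refine hπ.superfluous _ (eq_top_iff.2 fun p _ => ?_)
      have hp : (⟨_, smul_mem_restrictedPart jA p⟩ : restrictedPart jA P) ∈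
          U ⊔ LinearMap.ker (h.restrictCover π) := by
        rw [hU]; trivial
      obtain ⟨v, hv, w, hw, hvw⟩ := Submodule.mem_sup.1 hp
      refine Submodule.mem_sup.2 ⟨p - w, ?_, w, hw, by abel⟩
      change (⟨_, smul_mem_restrictedPart jA (p - (w : P))⟩ : restrictedPart jA P) ∈ U
      convert hv
      have : (v : P) + w = op (jA 1) • p := congrArg Subtype.val hvw
      rw [smul_sub, ← this, restrictedPart.one_smul_coe, add_sub_cancel_right]
    refine eq_top_iff.2 fun x _ => ?_
    have hx : (x : P) ∈ U' := by rw [hU']; trivial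
    have hx' : (⟨_, smul_mem_restrictedPart jA (x : P)⟩ : restrictedPart jA P) ∈ U := hx
    convert hx'
    exact x.2.symm

/-- The kernel of the restricted cover is the restriction of the kernel. -/
noncomputable def kerRestrictCoverEquiv (h : IsMoritaSplitting jA rA jB rB)
    (π : P →ₗ[Cᵐᵒᵖ] inflateModule rA X) :
    restrictedPart jA (LinearMap.ker π) ≃ₗ[Aᵐᵒᵖ] LinearMap.ker (h.restrictCover π) where
  toFun x := ⟨⟨(x : LinearMap.ker π).1, congrArg Subtype.val x.2⟩, (x : LinearMap.ker π).2⟩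
  map_add' _ _ := rfl
  map_smul' _ _ := rfl
  invFun x := ⟨⟨(x : restrictedPart jA P).1, x.2⟩, Subtype.ext (x : restrictedPart jA P).2⟩
  left_inv _ := rfl
  right_inv _ := rfl

/-- On the side of `B`, the kernel of a projective cover `P` of an `A`-module agrees with the
radical of `P`. -/
noncomputable def restrictKerEquiv [IsSemiprimaryRing Cᵐᵒᵖ] (h : IsMoritaSplitting jA rA jB rB)
    (hπ : IsProjectiveCover π) :
    restrictedPart jB (LinearMap.ker π) ≃ₗ[Bᵐᵒᵖ]
      restrictedPart jB (Ring.jacobson Cᵐᵒᵖ • ⊤ : Submodule Cᵐᵒᵖ P) where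
  toFun x := ⟨⟨(x : LinearMap.ker π).1, hπ.ker_le (x : LinearMap.ker π).2⟩,
    Subtype.ext (show op (jB 1) • x.1.1 = x.1.1 from
      congrArg Subtype.val (show op (jB 1) • x.1 = x.1 from x.2))⟩
  map_add' _ _ := rfl
  map_smul' _ _ := rfl
  invFun x := ⟨⟨x.1.1, by
    have : op (jB 1) • x.1.1 = x.1.1 := congrArg Subtype.val
      (show op (jB 1) • x.1 = x.1 from x.2)
    rw [LinearMap.mem_ker, ← this, map_smul, h.smul_inflate]⟩,
    Subtype.ext (show op (jB 1) • x.1.1 = x.1.1 from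
      congrArg Subtype.val (show op (jB 1) • x.1 = x.1 from x.2))⟩
  left_inv _ := rfl
  right_inv _ := rfl

end Cover

/-- The syzygy over `C` of an `A`-module `X` is the direct sum of `Ω_A(X)` and of a `B`-module in
`add Π_B(Ω_C(C₀))`, where `C₀` is the sum of the simple `C`-modules. -/
theorem exists_isSyzygy_inflate [IsArtinianRing Cᵐᵒᵖ] (h : IsMoritaSplitting jA rA jB rB)
    {S L : ModuleCat.{u} Cᵐᵒᵖ} (hS : IsSumOfSimples Cᵐᵒᵖ S) (hL : IsSyzygy Cᵐᵒᵖ S L)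
    (X : ModuleCat.{u} Aᵐᵒᵖ) [Module.Finite Aᵐᵒᵖ X] :
    ∃ (X' : ModuleCat.{u} Aᵐᵒᵖ) (Y' : ModuleCat.{u} Bᵐᵒᵖ), IsSyzygy Aᵐᵒᵖ X X' ∧
      MemAdd Bᵐᵒᵖ (fun Y => Y = restrictModule jB L) Y' ∧
      IsSyzygy Cᵐᵒᵖ (inflateModule rA X) (inflateModule rA X' × inflateModule rB Y') := by
  have : Module.Finite Cᵐᵒᵖ (inflateModule rA X) :=
    (finite_inflateModule_iff rA h.rA_surjective X).2 inferInstance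
  obtain ⟨P, π, hπ⟩ := exists_isProjectiveCover (R := Cᵐᵒᵖ) (inflateModule rA X)
  have := hπ.projective
  have := hπ.finite
  refine ⟨ModuleCat.of _ (restrictedPart jA (LinearMap.ker π)),
    ModuleCat.of _ (restrictedPart jB (LinearMap.ker π)), ?_, ?_, ?_⟩
  · exact (h.isProjectiveCover_restrictCover hπ).isSyzygy.of_equiv (LinearEquiv.refl _ _)
      (h.kerRestrictCoverEquiv π)
  · -- the radical of `P` is the syzygy of a semisimple module, so a summand of a power of `L`
    have := isSemisimpleModule_quotient_jacobson_smul (R := Cᵐᵒᵖ) P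
    have := hS.finite
    obtain ⟨m, F, hF, hm⟩ := hS.memAdd (P ⧸ (Ring.jacobson Cᵐᵒᵖ • ⊤ : Submodule Cᵐᵒᵖ P))
    obtain rfl : F = fun _ => S := funext hF
    have h₁ := (isProjectiveCover_mkQ_jacobson (R := Cᵐᵒᵖ) P).isSyzygy
    have h₂ : IsSyzygy Cᵐᵒᵖ (Fin m → S) (Fin m → L) := IsSyzygy.pi fun _ => hL
    rw [Submodule.ker_mkQ] at h₁
    have h₃ := (h₁.isDirectSummand h₂ hm).restrict jB
    exact ⟨m, fun _ => restrictModule jB L, fun _ => rfl,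
      (IsDirectSummand.of_equiv (h.restrictKerEquiv hπ)).trans
        (h₃.trans (.of_equiv (restrictPiEquiv jB fun _ : Fin m => L)))⟩
  · exact hπ.isSyzygy.of_equiv (LinearEquiv.refl _ _)
      (h.splitEquiv (h.smul_smul_of_le_jacobson _ hπ.ker_le)
        (h.symm.smul_smul_of_le_jacobson _ hπ.ker_le)).symm

end IsMoritaSplitting

end Morita

/-! ### Iterated syzygies and Igusa-Todorov modules -/

section Presentations

variable {R : Type u} [Ring R]

/-- There is an exact sequence `0 → V₁ → V₀ → N → 0` with `V₀, V₁ ∈ add V`. -/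
def HasAddPresentation (V : ModuleCat.{u} R) (N : Type u) [AddCommGroup N] [Module R N] : Prop :=
  ∃ (V₁ V₀ : ModuleCat.{u} R) (f : V₁ →ₗ[R] V₀) (g : V₀ →ₗ[R] N),
    MemAdd R (fun X => X = V) V₁ ∧ MemAdd R (fun X => X = V) V₀ ∧
    Function.Injective f ∧ Function.Exact f g ∧ Function.Surjective g

namespace HasAddPresentation

variable {V : ModuleCat.{u} R} {N N' : Type u} [AddCommGroup N] [Module R N] [AddCommGroup N']
  [Module R N']

theorem of_equiv (h : HasAddPresentation V N) (e : N ≃ₗ[R] N') : HasAddPresentation V N' := by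
  obtain ⟨V₁, V₀, f, g, h₁, h₀, hf, hfg, hg⟩ := h
  refine ⟨V₁, V₀, f, e.toLinearMap ∘ₗ g, h₁, h₀, hf, fun x => ?_, e.surjective.comp hg⟩
  rw [← hfg x]
  exact e.map_eq_zero_iff

theorem prod (h : HasAddPresentation V N) (h' : HasAddPresentation V N') :
    HasAddPresentation V (N × N') := by
  obtain ⟨V₁, V₀, f, g, h₁, h₀, hf, hfg, hg⟩ := h
  obtain ⟨V₁', V₀', f', g', h₁', h₀', hf', hfg', hg'⟩ := h'
  refine ⟨ModuleCat.of R (V₁ × V₁'), ModuleCat.of R (V₀ × V₀'), f.prodMap f', g.prodMap g',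
    h₁.prod h₁', h₀.prod h₀', hf.prodMap hf', fun x => ?_, hg.prodMap hg'⟩
  constructor
  · intro hx
    obtain ⟨y, hy⟩ := (hfg x.1).1 (congrArg Prod.fst hx)
    obtain ⟨y', hy'⟩ := (hfg' x.2).1 (congrArg Prod.snd hx)
    exact ⟨(y, y'), Prod.ext hy hy'⟩
  · rintro ⟨y, rfl⟩
    exact Prod.ext ((hfg _).2 ⟨y.1, rfl⟩) ((hfg' _).2 ⟨y.2, rfl⟩)

theorem of_memAdd (h : MemAdd R (fun X => X = V) N) : HasAddPresentation V N :=
  ⟨ModuleCat.of R PUnit, ModuleCat.of R N, 0, LinearMap.id, .of_subsingleton, h,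
    Function.injective_of_subsingleton _, fun x => ⟨fun hx => ⟨0, hx.symm⟩, by
      rintro ⟨y, rfl⟩
      rfl⟩, fun x => ⟨x, rfl⟩⟩

theorem inflate {A C : Type u} [Ring A] [Ring C] (r : C →+* A) {V X : ModuleCat.{u} Aᵐᵒᵖ}
    {V' : ModuleCat.{u} Cᵐᵒᵖ} (h : HasAddPresentation V X)
    (hV : IsDirectSummand Cᵐᵒᵖ (inflateModule r V) V') :
    HasAddPresentation V' (inflateModule r X) := by
  obtain ⟨V₁, V₀, f, g, h₁, h₀, hf, hfg, hg⟩ := h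
  have hV' : ∀ Y, Y = V → MemAdd Cᵐᵒᵖ (fun X => X = V') (inflateModule r Y) := by
    rintro _ rfl
    exact (MemAdd.of_mem (𝒞 := fun X => X = V') rfl).of_isDirectSummand hV
  exact ⟨inflateModule r V₁, inflateModule r V₀, inflateMap r f, inflateMap r g,
    h₁.inflate r hV', h₀.inflate r hV', hf, hfg, hg⟩

end HasAddPresentation

end Presentations

section MoritaSyzygies

open MulOpposite

namespace IsMoritaSplitting

variable {A B C : Type u} [Ring A] [Ring B] [Ring C] {jA : A →ₙ+* C}
  {rA : C →+* A} {jB : B →ₙ+* C} {rB : C →+* B}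

theorem isArtinianRing [IsArtinianRing Cᵐᵒᵖ] (h : IsMoritaSplitting jA rA jB rB) :
    IsArtinianRing Aᵐᵒᵖ :=
  Function.Surjective.isArtinianRing (f := RingHom.op rA) fun a => by
    obtain ⟨c, hc⟩ := h.rA_surjective a.unop
    exact ⟨op c, congrArg op hc⟩

/-- Syzygies over `C` satisfy one of the conditions of the splitting. -/
theorem smul_smul_of_isSyzygy [IsSemiprimaryRing Cᵐᵒᵖ] (h : IsMoritaSplitting jA rA jB rB)
    {M N : Type u} [AddCommGroup M] [Module Cᵐᵒᵖ M] [AddCommGroup N] [Module Cᵐᵒᵖ N]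
    (hN : IsSyzygy Cᵐᵒᵖ M N) (c : Cᵐᵒᵖ) (x : N) : op (jA 1) • c • op (jB 1) • x = 0 := by
  obtain ⟨P, π, hπ, ⟨e⟩⟩ := isSyzygy_iff.1 hN
  apply e.injective
  rw [map_smul, map_smul, map_smul, map_zero]
  exact h.smul_smul_of_le_jacobson _ hπ.ker_le c (e x)

/-- For every finitely generated `A`-module `X`, the `i`-th syzygy of `X` over `C` is
`Ωⁱ_A(X) ⊕ U ⊕ W` with `U ∈ add 𝒜` and `W ∈ add ℬ`. -/
def SyzygiesDecompose (rA : C →+* A) (rB : C →+* B) (𝒜 : ModuleCat.{u} Aᵐᵒᵖ → Prop)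
    (ℬ : ModuleCat.{u} Bᵐᵒᵖ → Prop) (i : ℕ) : Prop :=
  ∀ X : ModuleCat.{u} Aᵐᵒᵖ, Module.Finite Aᵐᵒᵖ X →
    ∃ (X' U : ModuleCat.{u} Aᵐᵒᵖ) (W : ModuleCat.{u} Bᵐᵒᵖ), IsNthSyzygy Aᵐᵒᵖ i X X' ∧
      MemAdd Aᵐᵒᵖ 𝒜 U ∧ MemAdd Bᵐᵒᵖ ℬ W ∧
      IsNthSyzygy Cᵐᵒᵖ i (inflateModule rA X)
        (ModuleCat.of Cᵐᵒᵖ (inflateModule rA X' × inflateModule rA U × inflateModule rB W))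

theorem syzygiesDecompose_zero (𝒜 : ModuleCat.{u} Aᵐᵒᵖ → Prop)
    (ℬ : ModuleCat.{u} Bᵐᵒᵖ → Prop) : SyzygiesDecompose rA rB 𝒜 ℬ 0 := by
  intro X _
  have h₁ : Subsingleton (inflateModule rA (ModuleCat.of Aᵐᵒᵖ PUnit)) :=
    inferInstanceAs (Subsingleton PUnit)
  have h₂ : Subsingleton (inflateModule rB (ModuleCat.of Bᵐᵒᵖ PUnit)) :=
    inferInstanceAs (Subsingleton PUnit)
  refine ⟨X, ModuleCat.of _ PUnit, ModuleCat.of _ PUnit, ⟨LinearEquiv.refl _ _⟩, .of_subsingleton,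
    .of_subsingleton, ⟨LinearEquiv.ofBijective (LinearMap.fst _ _ _) ⟨fun x y hxy => ?_,
      fun x => ⟨(x, 0), rfl⟩⟩⟩⟩
  exact Prod.ext hxy (Subsingleton.elim _ _)

section

variable [IsArtinianRing Cᵐᵒᵖ] {S L : ModuleCat.{u} Cᵐᵒᵖ}
  {𝒜 : ModuleCat.{u} Aᵐᵒᵖ → Prop} {ℬ : ModuleCat.{u} Bᵐᵒᵖ → Prop}

/-- In `Ω_C(X) = Ω_A(X) ⊕ Y'` the module `Y'` is a summand of a sum of copies of `Π_B(Ω_C(C₀))`, so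
the main term `Ωⁱ_B(Y')` of `Ωⁱ_C(Y')` lies in `add ℬ` and joins the error terms. -/
theorem syzygiesDecompose_succ (h : IsMoritaSplitting jA rA jB rB)
    (hS : IsSumOfSimples Cᵐᵒᵖ S) (hL : IsSyzygy Cᵐᵒᵖ S L)
    (hℬ : ∀ i Y, IsNthSyzygy Bᵐᵒᵖ i (restrictModule jB L) Y → ℬ Y) {i : ℕ}
    (ihA : SyzygiesDecompose rA rB 𝒜 ℬ i) (ihB : SyzygiesDecompose rB rA ℬ 𝒜 i) :
    SyzygiesDecompose rA rB 𝒜 ℬ (i + 1) := by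
  intro X _
  have := h.isArtinianRing
  have := h.symm.isArtinianRing
  have := hS.finite
  have := hL.finite
  have : Module.Finite Bᵐᵒᵖ (restrictModule jB L) :=
    h.symm.finite_restrictedPart (h.symm.smul_smul_of_isSyzygy hL)
  obtain ⟨X', Y', hX', hY', hXY⟩ := h.exists_isSyzygy_inflate hS hL X
  have := hX'.finite
  have : Module.Finite Bᵐᵒᵖ Y' := hY'.finite (by rintro _ rfl; assumption)
  obtain ⟨X'', U, W, hX'', hU, hW, hC⟩ := ihA X' inferInstance
  obtain ⟨Y'', W', U', hY'', hW', hU', hC'⟩ := ihB Y' inferInstance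
  refine ⟨X'', ModuleCat.of _ (U × U'), ModuleCat.of _ (W × (Y'' × W')), ⟨X', hX', hX''⟩,
    hU.prod hU', hW.prod (MemAdd.prod ?_ hW'), _, hXY, (hC.prod hC').of_equiv_right ?_⟩
  · obtain ⟨m, F, hF, hm⟩ := hY'
    obtain rfl : F = fun _ => restrictModule jB L := funext hF
    obtain ⟨Z, hZ⟩ := exists_isNthSyzygy i (restrictModule jB L)
    exact ⟨m, fun _ => Z, fun _ => hℬ i Z hZ, hY''.isDirectSummand
      (IsNthSyzygy.pi fun _ : Fin m => hZ) hm⟩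
  · exact
      { toFun := fun x => ((x.1, x.2.1.1, x.2.2.1), (x.2.2.2.1, x.2.2.2.2, x.2.1.2))
        map_add' := fun _ _ => rfl
        map_smul' := fun _ _ => rfl
        invFun := fun x => (x.1.1, (x.1.2.1, x.2.2.2), (x.1.2.2, (x.2.1, x.2.2.1)))
        left_inv := fun _ => rfl
        right_inv := fun _ => rfl }

theorem syzygiesDecompose (h : IsMoritaSplitting jA rA jB rB)
    (hS : IsSumOfSimples Cᵐᵒᵖ S) (hL : IsSyzygy Cᵐᵒᵖ S L)
    (h𝒜 : ∀ i X, IsNthSyzygy Aᵐᵒᵖ i (restrictModule jA L) X → 𝒜 X)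
    (hℬ : ∀ i Y, IsNthSyzygy Bᵐᵒᵖ i (restrictModule jB L) Y → ℬ Y) (i : ℕ) :
    SyzygiesDecompose rA rB 𝒜 ℬ i ∧ SyzygiesDecompose rB rA ℬ 𝒜 i := by
  induction i with
  | zero => exact ⟨syzygiesDecompose_zero 𝒜 ℬ, syzygiesDecompose_zero ℬ 𝒜⟩
  | succ i ih =>
    exact ⟨h.syzygiesDecompose_succ hS hL hℬ ih.1 ih.2,
      h.symm.syzygiesDecompose_succ hS hL h𝒜 ih.2 ih.1⟩

/-- If `V` and `W` are `n`-Igusa-Todorov modules over `A` and `B`, then a `C`-module `E` which has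
`V`, `W` and all members of `add 𝒜` and `add ℬ` in `add E` is `(n + 1)`-Igusa-Todorov. -/
theorem isIgusaTodorovModule (h : IsMoritaSplitting jA rA jB rB)
    (hS : IsSumOfSimples Cᵐᵒᵖ S) (hL : IsSyzygy Cᵐᵒᵖ S L)
    (h𝒜 : ∀ i X, IsNthSyzygy Aᵐᵒᵖ i (restrictModule jA L) X → 𝒜 X)
    (hℬ : ∀ i Y, IsNthSyzygy Bᵐᵒᵖ i (restrictModule jB L) Y → ℬ Y) {n : ℕ}
    {V : ModuleCat.{u} Aᵐᵒᵖ} {W : ModuleCat.{u} Bᵐᵒᵖ} (hV : IsIgusaTodorovModule Aᵐᵒᵖ n V)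
    (hW : IsIgusaTodorovModule Bᵐᵒᵖ n W) {E : ModuleCat.{u} Cᵐᵒᵖ} (hE : Module.Finite Cᵐᵒᵖ E)
    (hVE : IsDirectSummand Cᵐᵒᵖ (inflateModule rA V) E)
    (hWE : IsDirectSummand Cᵐᵒᵖ (inflateModule rB W) E)
    (hO : ∀ (X : ModuleCat.{u} Aᵐᵒᵖ) (Y : ModuleCat.{u} Bᵐᵒᵖ), MemAdd Aᵐᵒᵖ 𝒜 X →
      MemAdd Bᵐᵒᵖ ℬ Y →
      MemAdd Cᵐᵒᵖ (fun Z => Z = E) (inflateModule rA X × inflateModule rB Y)) :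
    IsIgusaTodorovModule Cᵐᵒᵖ (n + 1) E := by
  refine ⟨hE, fun M hM => ?_⟩
  obtain ⟨K, hK⟩ := exists_isSyzygy (R := Cᵐᵒᵖ) M
  have := hK.finite
  have hKA := h.smul_smul_of_isSyzygy hK
  have hKB := h.symm.smul_smul_of_isSyzygy hK
  have hXf := h.finite_restrictedPart hKA
  have hYf := h.symm.finite_restrictedPart hKB
  obtain ⟨hdA, hdB⟩ := h.syzygiesDecompose hS hL h𝒜 hℬ n
  obtain ⟨X', U, W₁, hX', hU, hW₁, hC⟩ := hdA (restrictModule jA K) hXf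
  obtain ⟨Y', W₂, U₂, hY', hW₂, hU₂, hC'⟩ := hdB (restrictModule jB K) hYf
  obtain ⟨NA, hNA, hPA⟩ := hV.2 (restrictModule jA K) hXf
  obtain ⟨NB, hNB, hPB⟩ := hW.2 (restrictModule jB K) hYf
  obtain ⟨eA⟩ := hNA.exists_equiv hX' (LinearEquiv.refl _ _)
  obtain ⟨eB⟩ := hNB.exists_equiv hY' (LinearEquiv.refl _ _)
  refine ⟨_, ⟨K, hK, (hC.prod hC').of_equiv_left (h.splitEquiv hKA hKB).symm⟩, ?_⟩
  have hPA' : HasAddPresentation V NA := hPA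
  have hPB' : HasAddPresentation W NB := hPB
  have hZ₂ := (hO U₂ W₂ hU₂ hW₂).of_equiv (LinearEquiv.prodComm Cᵐᵒᵖ _ _)
  exact ((HasAddPresentation.inflate rA (hPA'.of_equiv eA) hVE).prod
      (.of_memAdd (hO U W₁ hU hW₁))).prod
    ((HasAddPresentation.inflate rB (hPB'.of_equiv eB) hWE).prod (.of_memAdd hZ₂))

end

end IsMoritaSplitting

end MoritaSyzygies

/-! ### Path algebras -/

namespace PathAlgebra

variable {k : Type u} [Field k] {Q : Type u} [Quiver.{u} Q]

theorem ofPath_cons_eq {a b c : Q} (p : Quiver.Path a b) (e : b ⟶ c) :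
    ofPath k (p.cons e) = ofPath k p * ofPath k e.toPath := by
  rw [ofPath_mul_comp]; rfl

/-- The coefficient of a path in an element of the path algebra. -/
def coeff (x : PathAlgebra k Q) (p : AllPaths Q) : k := DFunLike.coe (F := AllPaths Q →₀ k) x p

/-- A subspace contains an element if it contains all paths that occur in it. -/
theorem mem_of_coeff {W : Submodule k (PathAlgebra k Q)} {x : PathAlgebra k Q}
    (h : ∀ p : AllPaths Q, coeff x p ≠ 0 → ofPath k p.2.2 ∈ W) : x ∈ W := by
  have hx : x = ∑ p ∈ Finsupp.support (M := k) x, coeff x p • ofPath k p.2.2 := by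
    refine (Finsupp.sum_single (M := k) x).symm.trans (Finset.sum_congr rfl fun p _ => ?_)
    refine Eq.trans ?_ (Finsupp.smul_single (coeff x p) p (1 : k)).symm
    rw [smul_eq_mul, mul_one]
    rfl
  rw [hx]
  exact W.sum_mem fun p hp => W.smul_mem _ (h p (Finsupp.mem_support_iff.1 hp))

theorem coeff_ofPath_of_ne {p q : AllPaths Q} (h : p ≠ q) : coeff (ofPath k p.2.2) q = 0 :=
  Finsupp.single_eq_of_ne h.symm

theorem finite_paths [Finite Q] [∀ a b : Q, Finite (a ⟶ b)] (n : ℕ) :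
    {p : AllPaths Q | p.2.2.length < n}.Finite := by
  induction n with
  | zero => simp
  | succ n ih =>
    refine ((Set.finite_range fun a : Q => (⟨a, a, .nil⟩ : AllPaths Q)).union
      (ih.biUnion fun p _ => Set.finite_range fun e : Σ c, p.2.1 ⟶ c =>
        (⟨p.1, e.1, p.2.2.cons e.2⟩ : AllPaths Q))).subset ?_
    rintro ⟨a, b, p⟩ hp
    cases p with
    | nil => exact Or.inl ⟨a, rfl⟩
    | cons p e => exact Or.inr (Set.mem_biUnion (x := (⟨a, _, p⟩ : AllPaths Q))
        (Nat.lt_of_succ_lt_succ hp) ⟨⟨_, e⟩, rfl⟩)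

variable [Fintype Q]

/-- A bound quiver algebra is finite dimensional. -/
theorem finite_boundQuiverAlgebra [∀ a b : Q, Finite (a ⟶ b)] {I : Ideal (PathAlgebra k Q)}
    [I.IsTwoSided] (hI : IsAdmissible I) : Module.Finite k (BoundQuiverAlgebra I) := by
  obtain ⟨-, m, -, hm⟩ := hI
  let f : PathAlgebra k Q →ₗ[k] BoundQuiverAlgebra I := (I.restrictScalars k).mkQ
  let T : Set (BoundQuiverAlgebra I) :=
    (fun p : AllPaths Q => f (ofPath k p.2.2)) '' {p | p.2.2.length < m}
  have hT : T.Finite := (finite_paths m).image _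
  refine ⟨⟨hT.toFinset, ?_⟩⟩
  rw [hT.coe_toFinset]
  refine eq_top_iff.2 fun y _ => ?_
  obtain ⟨x, rfl⟩ := Submodule.mkQ_surjective (I.restrictScalars k) y
  change x ∈ (Submodule.span k T).comap f
  refine mem_of_coeff fun p _ => ?_
  rw [Submodule.mem_comap]
  by_cases hp : p.2.2.length < m
  · exact Submodule.subset_span ⟨p, hp, rfl⟩
  · rw [show f (ofPath k p.2.2) = 0 from
      (Submodule.Quotient.mk_eq_zero (I.restrictScalars k)).2 (hm _ _ _ (not_lt.1 hp))]
    exact Submodule.zero_mem _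

theorem isArtinianRing_op [∀ a b : Q, Finite (a ⟶ b)] {I : Ideal (PathAlgebra k Q)}
    [I.IsTwoSided] (hI : IsAdmissible I) :
    Module.Finite k (BoundQuiverAlgebra I)ᵐᵒᵖ ∧ IsArtinianRing (BoundQuiverAlgebra I)ᵐᵒᵖ := by
  have := finite_boundQuiverAlgebra hI
  have : Module.Finite k (BoundQuiverAlgebra I)ᵐᵒᵖ :=
    Module.Finite.equiv (MulOpposite.opLinearEquiv k)
  exact ⟨this, IsArtinianRing.of_finite k _⟩

open Classical in
/-- The homomorphism `kQ → k` given by the vertex `v`: it sends the trivial path at `v` to `1` and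
all other paths to `0`. -/
noncomputable def vertexHom (v : Q) : PathAlgebra k Q →+* k :=
  LiftData.ringHom
    { vert := fun a => if a = v then 1 else 0
      arr := fun _ => 0
      idem := fun a => by split_ifs <;> simp
      orth := fun a b hab => by
        split_ifs with h₁ h₂
        · exact absurd (h₁.trans h₂.symm) hab
        all_goals simp
      vert_arr := fun _ => mul_zero _
      arr_vert := fun _ => zero_mul _ } (by simp)

theorem vertexHom_cons (v : Q) {a b c : Q} (p : Quiver.Path a b) (e : b ⟶ c) :
    vertexHom (k := k) v (ofPath k (p.cons e)) = 0 :=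
  (LiftData.hom_ofPath _ _).trans (mul_zero _)

theorem vertexHom_nil_self (v : Q) :
    vertexHom (k := k) v (ofPath k (Quiver.Path.nil : Quiver.Path v v)) = 1 :=
  (LiftData.hom_ofPath _ _).trans (if_pos rfl)

theorem vertexHom_nil_of_ne {v a : Q} (h : a ≠ v) :
    vertexHom (k := k) v (ofPath k (Quiver.Path.nil : Quiver.Path a a)) = 0 :=
  (LiftData.hom_ofPath _ _).trans (if_neg h)

theorem vertexHom_smul (v : Q) (c : k) (x : PathAlgebra k Q) :
    vertexHom v (c • x) = c * vertexHom v x := LiftData.hom_smul _ c x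

theorem vertexHom_apply (v : Q) (x : PathAlgebra k Q) :
    vertexHom v x = coeff x ⟨v, v, .nil⟩ := by
  let f : PathAlgebra k Q →ₗ[k] k :=
    { toFun := vertexHom v
      map_add' := map_add _
      map_smul' := vertexHom_smul v }
  let g : PathAlgebra k Q →ₗ[k] k := Finsupp.lapply (⟨v, v, .nil⟩ : AllPaths Q)
  have : f = g := by
    refine hom_ext fun {a b} p => ?_
    cases p with
    | nil =>
      by_cases h : a = v
      · subst h
        exact (vertexHom_nil_self a).trans Finsupp.single_eq_same.symm
      · exact (vertexHom_nil_of_ne h).trans (coeff_ofPath_of_ne (p := ⟨a, a, .nil⟩) fun h' =>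
          h (congrArg Sigma.fst h')).symm
    | cons p e =>
      refine (vertexHom_cons v p e).trans (coeff_ofPath_of_ne (p := ⟨a, _, p.cons e⟩) ?_).symm
      intro h'
      have : (⟨a, _, p.cons e⟩ : AllPaths Q).2.2.length = 0 := by rw [h']; rfl
      simp at this
  exact LinearMap.congr_fun this x

/-- The radical of a bound quiver algebra consists of combinations of paths of positive length. -/
theorem mem_span_of_mem_jacobson {I : Ideal (PathAlgebra k Q)} [I.IsTwoSided]
    (hI : IsAdmissible I) {x : PathAlgebra k Q}
    (hx : MulOpposite.op (Ideal.Quotient.mk I x) ∈ Ring.jacobson (BoundQuiverAlgebra I)ᵐᵒᵖ)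
    {W : Submodule k (PathAlgebra k Q)}
    (hW : ∀ {a b : Q} (p : Quiver.Path a b), 0 < p.length → ofPath k p ∈ W) : x ∈ W := by
  refine mem_of_coeff fun p hp => hW p.2.2 (Nat.pos_of_ne_zero fun h0 => hp ?_)
  obtain ⟨a, b, p⟩ := p
  cases p with
  | cons p e => simp at h0
  | nil =>
    rw [← vertexHom_apply]
    -- the vertex homomorphism factors through `kQ/I`, and `k` has zero radical
    have hle : ∀ y ∈ I, vertexHom (k := k) a y = 0 := fun y hy => by
      refine Submodule.span_induction (p := fun y _ => vertexHom (k := k) a y = 0) ?_ (map_zero _)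
        (fun y z _ _ hy hz => by rw [map_add, hy, hz, add_zero])
        (fun c y _ hy => by rw [vertexHom_smul, hy, mul_zero]) (hI.1 y hy)
      rintro _ ⟨b, c, p, hp, rfl⟩
      cases p with
      | nil => simp at hp
      | cons p e => exact vertexHom_cons a p e
    let χ : BoundQuiverAlgebra I →+* k := Ideal.Quotient.lift I (vertexHom a) hle
    have hχ : Function.Surjective (RingHom.op χ) := fun c => by
      refine ⟨MulOpposite.op (Ideal.Quotient.mk I (c.unop • ofPath k (.nil : Quiver.Path a a))),
        MulOpposite.unop_injective ?_⟩
      change vertexHom a (c.unop • ofPath k (.nil : Quiver.Path a a)) = c.unop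
      rw [vertexHom_smul, vertexHom_nil_self, mul_one]
    have : RingHomSurjective (RingHom.op χ) := ⟨hχ⟩
    have h₁ := Ring.le_comap_jacobson (RingHom.op χ) hx
    rw [Ideal.mem_comap, IsSemisimpleRing.jacobson_eq_bot, Ideal.mem_bot] at h₁
    exact congrArg MulOpposite.unop h₁

end PathAlgebra

/-! ### The bound quiver algebra of a Morita context -/

section MoritaQuivers

open MoritaQuiver PathAlgebra

variable {k : Type u} [Field k] {QA QB : Type u} [Quiver.{u} QA] [Quiver.{u} QB]
  {J : QA → QB → Type u} {K : QB → QA → Type u}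

theorem MoritaQuiver.finite_hom [∀ a a' : QA, Finite (a ⟶ a')] [∀ b b' : QB, Finite (b ⟶ b')]
    [∀ a b, Finite (J a b)] [∀ b a, Finite (K b a)] (x y : MoritaQuiver J K) :
    Finite (x ⟶ y) := by
  change Finite (Arrow x y)
  rcases x with a | b <;> rcases y with a' | b'
  · exact Finite.of_surjective (fun α : a ⟶ a' => Arrow.arrA α) fun e => by cases e; exact ⟨_, rfl⟩
  · exact Finite.of_surjective (fun j : J a b' => Arrow.arrJ j) fun e => by cases e; exact ⟨_, rfl⟩
  · exact Finite.of_surjective (fun κ : K b a' => Arrow.arrK κ) fun e => by cases e; exact ⟨_, rfl⟩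
  · exact Finite.of_surjective (fun β : b ⟶ b' => Arrow.arrB β) fun e => by cases e; exact ⟨_, rfl⟩

variable [Fintype QA] [Fintype QB]

variable (J K) in
theorem MoritaQuiver.projA_inclA (x : PathAlgebra k QA) : projA J K k (inclA J K k x) = x := by
  let f : PathAlgebra k QA →ₗ[k] PathAlgebra k QA :=
    { toFun := fun x => projA J K k (inclA J K k x)
      map_add' := fun x y => by rw [map_add, map_add]
      map_smul' := fun c x => (congrArg _ (LiftData.hom_smul _ c x)).trans
        (LiftData.hom_smul _ c _) }
  have : f = LinearMap.id := by
    refine hom_ext fun p => ?_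
    change projA J K k (inclA J K k (ofPath k p)) = ofPath k p
    induction p with
    | nil => rw [inclA_nil, projA_nil_inA]
    | cons p e ih =>
      rw [ofPath_cons_eq, map_mul, map_mul, ih, inclA_arrow, projA_homA]
  exact LinearMap.congr_fun this x

variable (J K) in
theorem MoritaQuiver.projB_inclB (x : PathAlgebra k QB) : projB J K k (inclB J K k x) = x := by
  let f : PathAlgebra k QB →ₗ[k] PathAlgebra k QB :=
    { toFun := fun x => projB J K k (inclB J K k x)
      map_add' := fun x y => by rw [map_add, map_add]
      map_smul' := fun c x => (congrArg _ (LiftData.hom_smul _ c x)).trans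
        (LiftData.hom_smul _ c _) }
  have : f = LinearMap.id := by
    refine hom_ext fun p => ?_
    change projB J K k (inclB J K k (ofPath k p)) = ofPath k p
    induction p with
    | nil => rw [inclB_nil, projB_nil_inB]
    | cons p e ih =>
      rw [ofPath_cons_eq, map_mul, map_mul, ih, inclB_arrow, projB_homB]
  exact LinearMap.congr_fun this x

variable (k J K) in
theorem MoritaQuiver.inclA_one_add_inclB_one :
    inclA J K k 1 + inclB J K k 1 = (1 : PathAlgebra k (MoritaQuiver J K)) := by
  rw [one_def', one_def', one_def', map_sum, map_sum, sum_univ]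
  simp only [inclA_nil, inclB_nil]

namespace IsMoritaIdeal

variable {IA : Ideal (PathAlgebra k QA)} {IB : Ideal (PathAlgebra k QB)}
  {IC : Ideal (PathAlgebra k (MoritaQuiver J K))}
  [IA.IsTwoSided] [IB.IsTwoSided] [IC.IsTwoSided]

/-- Modulo `IC`, the projection to `kQA` is `x ↦ e x e`. -/
theorem inclA_projA_sub_mem (h : IsMoritaIdeal IA IB IC)
    (x : PathAlgebra k (MoritaQuiver J K)) :
    inclA J K k (projA J K k x) - inclA J K k 1 * x * inclA J K k 1 ∈ IC := by
  let f : PathAlgebra k (MoritaQuiver J K) →ₗ[k] PathAlgebra k (MoritaQuiver J K) :=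
    { toFun := fun x => inclA J K k (projA J K k x) - inclA J K k 1 * x * inclA J K k 1
      map_add' := fun x y => by simp only [map_add, mul_add, add_mul]; abel
      map_smul' := fun c x => by
        rw [show projA J K k (c • x) = c • projA J K k x from LiftData.hom_smul _ c x,
          show inclA J K k (c • projA J K k x) = c • inclA J K k (projA J K k x) from
            LiftData.hom_smul _ c _, mul_smul_comm, smul_mul_assoc, smul_sub, RingHom.id_apply] }
  change x ∈ (IC.restrictScalars k).comap f
  refine mem_of_coeff fun p _ => ?_
  obtain ⟨y, z, p⟩ := p
  change inclA J K k (projA J K k (ofPath k p)) -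
    inclA J K k 1 * ofPath k p * inclA J K k 1 ∈ IC
  cases y with
  | inA a =>
    rw [inclA_one_mul_ofPath]
    exact h.keyA p
  | inB b =>
    rw [inclA_one_mul_ofPath', projA_of_source, map_zero, zero_mul, sub_zero]
    exact IC.zero_mem

/-- Modulo `IC`, the projection to `kQB` is `x ↦ f x f`. -/
theorem inclB_projB_sub_mem (h : IsMoritaIdeal IA IB IC)
    (x : PathAlgebra k (MoritaQuiver J K)) :
    inclB J K k (projB J K k x) - inclB J K k 1 * x * inclB J K k 1 ∈ IC := by
  let f : PathAlgebra k (MoritaQuiver J K) →ₗ[k] PathAlgebra k (MoritaQuiver J K) :=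
    { toFun := fun x => inclB J K k (projB J K k x) - inclB J K k 1 * x * inclB J K k 1
      map_add' := fun x y => by simp only [map_add, mul_add, add_mul]; abel
      map_smul' := fun c x => by
        rw [show projB J K k (c • x) = c • projB J K k x from LiftData.hom_smul _ c x,
          show inclB J K k (c • projB J K k x) = c • inclB J K k (projB J K k x) from
            LiftData.hom_smul _ c _, mul_smul_comm, smul_mul_assoc, smul_sub, RingHom.id_apply] }
  change x ∈ (IC.restrictScalars k).comap f
  refine mem_of_coeff fun p _ => ?_
  obtain ⟨y, z, p⟩ := p
  change inclB J K k (projB J K k (ofPath k p)) -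
    inclB J K k 1 * ofPath k p * inclB J K k 1 ∈ IC
  cases y with
  | inB b =>
    rw [inclB_one_mul_ofPath]
    exact h.keyB p
  | inA a =>
    rw [inclB_one_mul_ofPath', projB_of_source, map_zero, zero_mul, sub_zero]
    exact IC.zero_mem

/-- A path of positive length that ends in `QB`, continued to a vertex of `QA`, lies in `IC`: it
runs through one of the zero relations `β βₖ`, `αⱼ βₖ`. -/
theorem comp_mem_of_inB_inA (h : IsMoritaIdeal IA IB IC) {x : MoritaQuiver J K} {b : QB}
    (p : Quiver.Path x (inB b)) (hp : 0 < p.length) {y : MoritaQuiver J K}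
    (q : Quiver.Path (inB b) y) (a : QA) (hy : y = inA a) : ofPath k (p.comp q) ∈ IC := by
  induction q generalizing a with
  | nil => cases hy
  | cons q e ih =>
    subst hy
    change Arrow _ _ at e
    cases e with
    | arrA α =>
      rw [Quiver.Path.comp_cons, ofPath_cons_eq]
      exact IC.mul_mem_right _ (ih _ rfl)
    | arrK κ =>
      rw [Quiver.Path.comp_cons]
      have hr : 0 < (p.comp q).length := by rw [Quiver.Path.length_comp]; omega
      generalize p.comp q = r at hr
      cases r with
      | nil => simp at hr
      | cons r e' =>
        have h₁ : ofPath k ((r.cons e').cons (homK J κ)) =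
            ofPath k r * twoArrows k e' (homK J κ) := by
          rw [twoArrows, ofPath_mul_comp]; rfl
        change ofPath k ((r.cons e').cons (homK J κ)) ∈ IC
        rw [h₁]
        refine IC.mul_mem_left _ ?_
        change Arrow _ _ at e'
        cases e' with
        | arrB β => exact h.arrB_arrK β κ
        | arrJ j => exact h.arrJ_arrK j κ

/-- The counterpart of `comp_mem_of_inB_inA`, with the zero relations `α αⱼ` and `βₖ αⱼ`. -/
theorem comp_mem_of_inA_inB (h : IsMoritaIdeal IA IB IC) {x : MoritaQuiver J K} {a : QA}
    (p : Quiver.Path x (inA a)) (hp : 0 < p.length) {y : MoritaQuiver J K}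
    (q : Quiver.Path (inA a) y) (b : QB) (hy : y = inB b) : ofPath k (p.comp q) ∈ IC := by
  induction q generalizing b with
  | nil => cases hy
  | cons q e ih =>
    subst hy
    change Arrow _ _ at e
    cases e with
    | arrB β =>
      rw [Quiver.Path.comp_cons, ofPath_cons_eq]
      exact IC.mul_mem_right _ (ih _ rfl)
    | arrJ j =>
      rw [Quiver.Path.comp_cons]
      have hr : 0 < (p.comp q).length := by rw [Quiver.Path.length_comp]; omega
      generalize p.comp q = r at hr
      cases r with
      | nil => simp at hr
      | cons r e' =>
        have h₁ : ofPath k ((r.cons e').cons (homJ K j)) =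
            ofPath k r * twoArrows k e' (homJ K j) := by
          rw [twoArrows, ofPath_mul_comp]; rfl
        change ofPath k ((r.cons e').cons (homJ K j)) ∈ IC
        rw [h₁]
        refine IC.mul_mem_left _ ?_
        change Arrow _ _ at e'
        cases e' with
        | arrA α => exact h.arrA_arrJ α j
        | arrK κ => exact h.arrK_arrJ κ j

/-- `rad C * f C e = 0`. -/
theorem jacobson_mul_inclB_inclA (hIC : IsAdmissible IC) (h : IsMoritaIdeal IA IB IC)
    {x : PathAlgebra k (MoritaQuiver J K)}
    (hx : MulOpposite.op (Ideal.Quotient.mk IC x) ∈ Ring.jacobson (BoundQuiverAlgebra IC)ᵐᵒᵖ)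
    (z : PathAlgebra k (MoritaQuiver J K)) :
    x * inclB J K k 1 * z * inclA J K k 1 ∈ IC := by
  change x ∈ (IC.restrictScalars k).comap
    (LinearMap.mulRight k (inclA J K k 1) ∘ₗ LinearMap.mulRight k z ∘ₗ
      LinearMap.mulRight k (inclB J K k 1))
  refine mem_span_of_mem_jacobson hIC hx fun {v w} p hp => ?_
  change z ∈ (IC.restrictScalars k).comap
    (LinearMap.mulRight k (inclA J K k 1) ∘ₗ LinearMap.mulLeft k (ofPath k p * inclB J K k 1))
  refine mem_of_coeff fun q _ => ?_
  obtain ⟨v', w', q⟩ := q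
  change ofPath k p * inclB J K k 1 * ofPath k q * inclA J K k 1 ∈ IC
  cases w with
  | inA a =>
    rw [ofPath_mul_inclB_one', zero_mul, zero_mul]
    exact IC.zero_mem
  | inB b =>
    rw [ofPath_mul_inclB_one, mul_assoc]
    cases w' with
    | inB b' =>
      rw [ofPath_mul_inclA_one', mul_zero]
      exact IC.zero_mem
    | inA a =>
      rw [ofPath_mul_inclA_one]
      by_cases hv : v' = inB b
      · subst hv
        rw [ofPath_mul_comp]
        exact h.comp_mem_of_inB_inA p hp q a rfl
      · rw [ofPath_mul_of_ne _ _ hv]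
        exact IC.zero_mem

/-- `rad C * e C f = 0`. -/
theorem jacobson_mul_inclA_inclB (hIC : IsAdmissible IC) (h : IsMoritaIdeal IA IB IC)
    {x : PathAlgebra k (MoritaQuiver J K)}
    (hx : MulOpposite.op (Ideal.Quotient.mk IC x) ∈ Ring.jacobson (BoundQuiverAlgebra IC)ᵐᵒᵖ)
    (z : PathAlgebra k (MoritaQuiver J K)) :
    x * inclA J K k 1 * z * inclB J K k 1 ∈ IC := by
  change x ∈ (IC.restrictScalars k).comap
    (LinearMap.mulRight k (inclB J K k 1) ∘ₗ LinearMap.mulRight k z ∘ₗ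
      LinearMap.mulRight k (inclA J K k 1))
  refine mem_span_of_mem_jacobson hIC hx fun {v w} p hp => ?_
  change z ∈ (IC.restrictScalars k).comap
    (LinearMap.mulRight k (inclB J K k 1) ∘ₗ LinearMap.mulLeft k (ofPath k p * inclA J K k 1))
  refine mem_of_coeff fun q _ => ?_
  obtain ⟨v', w', q⟩ := q
  change ofPath k p * inclA J K k 1 * ofPath k q * inclB J K k 1 ∈ IC
  cases w with
  | inB b =>
    rw [ofPath_mul_inclA_one', zero_mul, zero_mul]
    exact IC.zero_mem
  | inA a =>
    rw [ofPath_mul_inclA_one, mul_assoc]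
    cases w' with
    | inA a' =>
      rw [ofPath_mul_inclB_one', mul_zero]
      exact IC.zero_mem
    | inB b =>
      rw [ofPath_mul_inclB_one]
      by_cases hv : v' = inA a
      · subst hv
        rw [ofPath_mul_comp]
        exact h.comp_mem_of_inA_inB p hp q b rfl
      · rw [ofPath_mul_of_ne _ _ hv]
        exact IC.zero_mem

theorem isMoritaSplitting (hIC : IsAdmissible IC) (h : IsMoritaIdeal IA IB IC) :
    IsMoritaSplitting h.jA h.rA h.jB h.rB where
  rA_jA a := by
    obtain ⟨x, rfl⟩ := Ideal.Quotient.mk_surjective a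
    exact congrArg (Ideal.Quotient.mk IA) (projA_inclA J K x)
  jA_rA c := by
    obtain ⟨x, rfl⟩ := Ideal.Quotient.mk_surjective c
    exact Ideal.Quotient.eq.2 (h.inclA_projA_sub_mem x)
  rB_jB b := by
    obtain ⟨x, rfl⟩ := Ideal.Quotient.mk_surjective b
    exact congrArg (Ideal.Quotient.mk IB) (projB_inclB J K x)
  jB_rB c := by
    obtain ⟨x, rfl⟩ := Ideal.Quotient.mk_surjective c
    exact Ideal.Quotient.eq.2 (h.inclB_projB_sub_mem x)
  one_add_one := congrArg (Ideal.Quotient.mk IC) (inclA_one_add_inclB_one k J K)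
  radA y hy c := by
    obtain ⟨x, hx⟩ := Ideal.Quotient.mk_surjective y.unop
    obtain ⟨z, rfl⟩ := Ideal.Quotient.mk_surjective c
    rw [← hx]
    rw [← MulOpposite.op_unop y, ← hx] at hy
    exact Ideal.Quotient.eq_zero_iff_mem.2 (h.jacobson_mul_inclB_inclA hIC hy z)
  radB y hy c := by
    obtain ⟨x, hx⟩ := Ideal.Quotient.mk_surjective y.unop
    obtain ⟨z, rfl⟩ := Ideal.Quotient.mk_surjective c
    rw [← hx]
    rw [← MulOpposite.op_unop y, ← hx] at hy
    exact Ideal.Quotient.eq_zero_iff_mem.2 (h.jacobson_mul_inclA_inclB hIC hy z)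

end IsMoritaIdeal

end MoritaQuivers

/-! ### The orbit modules and the Igusa-Todorov module -/

section Orbits

open MoritaQuiver PathAlgebra

theorem finite_regular_op (A : Type u) [Ring A] : Module.Finite Aᵐᵒᵖ A :=
  ⟨⟨{1}, by
    rw [Finset.coe_singleton]
    refine eq_top_iff.2 fun a _ => Submodule.mem_span_singleton.2
      ⟨MulOpposite.op a, one_mul a⟩⟩⟩

variable {k : Type u} [Field k] {QA QB : Type u} [Quiver.{u} QA] [Quiver.{u} QB]
  {J : QA → QB → Type u} {K : QB → QA → Type u} [Fintype QA] [Fintype QB]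
  {IA : Ideal (PathAlgebra k QA)} {IB : Ideal (PathAlgebra k QB)}
  {IC : Ideal (PathAlgebra k (MoritaQuiver J K))}
  [IA.IsTwoSided] [IB.IsTwoSided] [IC.IsTwoSided]

namespace IsMoritaIdeal

variable [IsArtinianRing (BoundQuiverAlgebra IC)ᵐᵒᵖ]

theorem finite_of_orbitA (hIC : IsAdmissible IC) (h : IsMoritaIdeal IA IB IC)
    {X : ModuleCat.{u} (BoundQuiverAlgebra IA)ᵐᵒᵖ} (hX : h.orbitA X) :
    Module.Finite (BoundQuiverAlgebra IA)ᵐᵒᵖ X := by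
  obtain ⟨S, L, n, hS, hL, hX⟩ := hX
  have hs := h.isMoritaSplitting hIC
  have := hs.isArtinianRing
  have := hS.finite
  have := hL.finite
  have : Module.Finite (BoundQuiverAlgebra IA)ᵐᵒᵖ (restrictModule h.jA L) :=
    hs.finite_restrictedPart (hs.smul_smul_of_isSyzygy hL)
  exact hX.finite

theorem finite_of_orbitB (hIC : IsAdmissible IC) (h : IsMoritaIdeal IA IB IC)
    {Y : ModuleCat.{u} (BoundQuiverAlgebra IB)ᵐᵒᵖ} (hY : h.orbitB Y) :
    Module.Finite (BoundQuiverAlgebra IB)ᵐᵒᵖ Y := by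
  obtain ⟨S, L, n, hS, hL, hY⟩ := hY
  have hs := (h.isMoritaSplitting hIC).symm
  have := hs.isArtinianRing
  have := hS.finite
  have := hL.finite
  have : Module.Finite (BoundQuiverAlgebra IB)ᵐᵒᵖ (restrictModule h.jB L) :=
    hs.finite_restrictedPart (hs.smul_smul_of_isSyzygy hL)
  exact hY.finite

/-- Every module `X ⊕ Y` with `X` and `Y` in the additive closures of the orbits is a direct sum
of indecomposable modules whose class lies in the orbit group. -/
theorem memAdd_of_isOrbitIndecomposables (hIC : IsAdmissible IC) (h : IsMoritaIdeal IA IB IC)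
    {m : ℕ} {O : Fin m → FGModuleCat.{u} (BoundQuiverAlgebra IC)ᵐᵒᵖ}
    (hO : h.IsOrbitIndecomposables O) {E : ModuleCat.{u} (BoundQuiverAlgebra IC)ᵐᵒᵖ}
    (hE : ∀ i, IsDirectSummand (BoundQuiverAlgebra IC)ᵐᵒᵖ (O i) E)
    {X : ModuleCat.{u} (BoundQuiverAlgebra IA)ᵐᵒᵖ} {Y : ModuleCat.{u} (BoundQuiverAlgebra IB)ᵐᵒᵖ}
    (hX : MemAdd _ h.orbitA X) (hY : MemAdd _ h.orbitB Y) :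
    MemAdd (BoundQuiverAlgebra IC)ᵐᵒᵖ (fun Z => Z = E)
      (inflateModule h.rA X × inflateModule h.rB Y) := by
  have hs := h.isMoritaSplitting hIC
  have := (finite_inflateModule_iff h.rA hs.rA_surjective X).2
    (hX.finite fun _ => h.finite_of_orbitA hIC)
  have := (finite_inflateModule_iff h.rB hs.symm.rA_surjective Y).2
    (hY.finite fun _ => h.finite_of_orbitB hIC)
  refine MemAdd.trans (fun N hN => ?_) (memAdd_indecomposable _)
  obtain ⟨i, ⟨e⟩⟩ := hO.2.2 ⟨N, hN.2.finite⟩ hN.1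
    (AddSubgroup.subset_closure ⟨X, Y, _, hX, hY, hN.2, rfl⟩)
  exact (MemAdd.of_mem (𝒞 := fun Z => Z = E) rfl).of_isDirectSummand
    ((IsDirectSummand.of_equiv e).trans (hE i))

theorem isIgusaTodorovModule_sum (hIC : IsAdmissible IC) (h : IsMoritaIdeal IA IB IC)
    {m : ℕ} {O : Fin m → FGModuleCat.{u} (BoundQuiverAlgebra IC)ᵐᵒᵖ}
    (hO : h.IsOrbitIndecomposables O) {n : ℕ}
    {V : ModuleCat.{u} (BoundQuiverAlgebra IA)ᵐᵒᵖ} {W : ModuleCat.{u} (BoundQuiverAlgebra IB)ᵐᵒᵖ}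
    (hV : IsIgusaTodorovModule (BoundQuiverAlgebra IA)ᵐᵒᵖ n V)
    (hW : IsIgusaTodorovModule (BoundQuiverAlgebra IB)ᵐᵒᵖ n W) :
    IsIgusaTodorovModule (BoundQuiverAlgebra IC)ᵐᵒᵖ (n + 1) (h.igusaTodorovSum V W O) := by
  have hs := h.isMoritaSplitting hIC
  obtain ⟨S, hSf, hS⟩ := exists_isSumOfSimples (R := (BoundQuiverAlgebra IC)ᵐᵒᵖ)
  obtain ⟨L, hL⟩ := exists_isSyzygy (R := (BoundQuiverAlgebra IC)ᵐᵒᵖ) S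
  have := (finite_inflateModule_iff h.rA hs.rA_surjective V).2 hV.1
  have := (finite_inflateModule_iff h.rB hs.symm.rA_surjective W).2 hW.1
  have := (finite_inflateModule_iff h.rA hs.rA_surjective
    (ModuleCat.of (BoundQuiverAlgebra IA)ᵐᵒᵖ (BoundQuiverAlgebra IA))).2 (finite_regular_op _)
  have := (finite_inflateModule_iff h.rB hs.symm.rA_surjective
    (ModuleCat.of (BoundQuiverAlgebra IB)ᵐᵒᵖ (BoundQuiverAlgebra IB))).2 (finite_regular_op _)
  refine hs.isIgusaTodorovModule hS hL (𝒜 := h.orbitA) (ℬ := h.orbitB)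
    (fun i X hX => ⟨S, L, i, hS, hL, hX⟩) (fun i Y hY => ⟨S, L, i, hS, hL, hY⟩) hV hW
    (inferInstanceAs (Module.Finite (BoundQuiverAlgebra IC)ᵐᵒᵖ (_ × _ × _ × _ × (∀ i, O i)))) .fst
    (IsDirectSummand.fst.trans (IsDirectSummand.snd.trans .snd)) fun X Y hX hY =>
      h.memAdd_of_isOrbitIndecomposables hIC hO (fun i => ?_) hX hY
  exact (IsDirectSummand.of_pi (F := fun i => (O i : Type u)) i).trans
    (IsDirectSummand.snd.trans (IsDirectSummand.snd.trans (IsDirectSummand.snd.trans .snd)))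

end IsMoritaIdeal

end Orbits


theorem proposition3p2 {k : Type u} [Field k]
    -- the finite quivers `QA` and `QB`, and the arrows `J`, `K` between them
    {QA QB : Type u} [Quiver.{u} QA] [Quiver.{u} QB] [Fintype QA] [Fintype QB]
    [∀ a a' : QA, Finite (a ⟶ a')] [∀ b b' : QB, Finite (b ⟶ b')]
    (J : QA → QB → Type u) (K : QB → QA → Type u)
    [∀ a b, Finite (J a b)] [∀ b a, Finite (K b a)]
    -- the admissible ideals of relations
    (IA : Ideal (PathAlgebra k QA)) (IB : Ideal (PathAlgebra k QB))
    (IC : Ideal (PathAlgebra k (MoritaQuiver J K)))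
    [IA.IsTwoSided] [IB.IsTwoSided] [IC.IsTwoSided]
    (hIA : PathAlgebra.IsAdmissible IA) (hIB : PathAlgebra.IsAdmissible IB)
    (hIC : PathAlgebra.IsAdmissible IC)
    (h : IsMoritaIdeal IA IB IC)
    -- the orbit group is finitely generated
    (hO : h.orbitGroup.FG)
    (n : ℕ)
    (hA : IsIgusaTodorovAlgebra n (BoundQuiverAlgebra IA))
    (hB : IsIgusaTodorovAlgebra n (BoundQuiverAlgebra IB)) :
    IsIgusaTodorovAlgebra (n + 1) (BoundQuiverAlgebra IC) ∧
    ∃ (m : ℕ) (O : Fin m → FGModuleCat.{u} (BoundQuiverAlgebra IC)ᵐᵒᵖ),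
      h.IsOrbitIndecomposables O ∧
      ∀ (V : ModuleCat.{u} (BoundQuiverAlgebra IA)ᵐᵒᵖ)
        (W : ModuleCat.{u} (BoundQuiverAlgebra IB)ᵐᵒᵖ),
        IsIgusaTodorovModule (BoundQuiverAlgebra IA)ᵐᵒᵖ n V →
        IsIgusaTodorovModule (BoundQuiverAlgebra IB)ᵐᵒᵖ n W →
        IsIgusaTodorovModule (BoundQuiverAlgebra IC)ᵐᵒᵖ (n + 1)
          (h.igusaTodorovSum V W O) := by
  have : ∀ x y : MoritaQuiver J K, Finite (x ⟶ y) := MoritaQuiver.finite_hom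
  obtain ⟨_, _⟩ := PathAlgebra.isArtinianRing_op hIC
  obtain ⟨m, O, hO₁, hO₂, hO₃⟩ := exists_finite_indecomposables_of_fg k h.orbitGroup hO
  have hO' : h.IsOrbitIndecomposables O := ⟨hO₁, hO₂, hO₃⟩
  obtain ⟨V, hV⟩ := hA
  obtain ⟨W, hW⟩ := hB
  exact ⟨⟨_, h.isIgusaTodorovModule_sum hIC hO' hV hW⟩, m, O, hO', fun V W hV hW =>
    h.isIgusaTodorovModule_sum hIC hO' hV hW⟩
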